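/- Let $(\Sigma,g)$ be a smooth oriented Riemannian surface, $j$ its canonical complex structure (rotation by $+90^\circ$), $\nabla$ its Levi-Civita connection. A vector $\xi$ tangent to $T\Sigma$, the velocity at $0$ of a curve $(p(s),V(s))$, is identified with the pair $(P\xi,K\xi)=(p'(0),\nabla_{p'}V(0))$. On $T\Sigma$ consider the symplectic form $\Omega(\xi,\eta)=g(K\xi,P\eta)-g(P\xi,K\eta)$, the complex structure $\mathbb J=j\oplus j$ and the neutral metric $\mathbb G(\xi,\eta)=\Omega(\mathbb J\xi,\eta)$. Let $L$ be a rank one Lagrangian surface of $T\Sigma$, that is, a smooth surface with a smooth immersion $X:L\to T\Sigma$ such that $X^*\Omega=0$ and the composition of $X$ with the projection $T\Sigma\to\Sigma$ has rank one at every point. Then: 1. $L$ is locally an affine normal bundle over a curve of $\Sigma$: around every point of $L$ there are coordinates $(s,t)\in(s_0,s_1)\times(t_0,t_1)$, a smooth unit speed curve $\gamma:(s_0,s_1)\to\Sigma$ and a smooth function $a:(s_0,s_1)\to\mathbb R$ such that $$X(s,t)=\bigl(\gamma(s),\,a(s)\gamma'(s)+t\,j\gamma'(s)\bigr).$$ 2.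 $L$ is Hamiltonian stationary: it is a critical point of the area $\int\sqrt{|EG-F^2|}\,ds\,dt$ of the metric induced by $\mathbb G$, under compactly supported variations (within coordinate patches) whose variation vector $V$ is Hamiltonian, i.e. $\Omega(V,dX(\cdot))=du$ with $u$ smooth and compactly supported. Moreover it satisfies the corresponding Euler equation $\operatorname{div}(\mathbb J\vec H)=0$, where $\vec H$ is the mean curvature vector of $L$ with respect to $\mathbb G$ and the divergence is that of the induced metric. 3. The metric induced on $L$ by $\mathbb G$ is nondegenerate and flat. 4. Each piece of $L$ parametrized as in 1 is minimal ($\vec H=0$) if and only if its base curve $\gamma$ is a geodesic of $(\Sigma,g)$. Consequently $L$ is minimal if and only if all the base curves $\gamma$ of such pieces are geodesics. -/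

import Mathlib

set_option maxSynthPendingDepth 3

open Set Bundle Manifold
open scoped ContDiff

noncomputable section

namespace TangentSurface

/-! ### Pseudo-Riemannian geometry in coordinates

`V` and `F` are finite-dimensional real normed spaces in the applications.  A pseudo-metric on an
open set of `F` is a map `h : F → F →L[ℝ] F →L[ℝ] ℝ` whose values are symmetric and nondegenerate
on that set. -/

section Coordinates

variable {V F : Type*} [NormedAddCommGroup V] [NormedSpace ℝ V]
  [NormedAddCommGroup F] [NormedSpace ℝ F]

/-- The map `(u, v) ↦ (w ↦ B w u v)` attached to a trilinear form `B`. -/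
def lastSlots (B : F →L[ℝ] F →L[ℝ] F →L[ℝ] ℝ) : F →L[ℝ] F →L[ℝ] F →L[ℝ] ℝ :=
  (ContinuousLinearMap.flipₗᵢ ℝ F F ℝ : (F →L[ℝ] F →L[ℝ] ℝ) →L[ℝ] (F →L[ℝ] F →L[ℝ] ℝ)) ∘L B.flip

/-- Christoffel symbols of the first kind:
`w ↦ (1/2) (∂_u h(v, w) + ∂_v h(u, w) - ∂_w h(u, v))`. -/
def christoffelFirst (h : F → F →L[ℝ] F →L[ℝ] ℝ) (x : F) : F →L[ℝ] F →L[ℝ] F →L[ℝ] ℝ :=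
  (1 / 2 : ℝ) • (fderiv ℝ h x + (fderiv ℝ h x).flip - lastSlots (fderiv ℝ h x))

theorem christoffelFirst_apply (h : F → F →L[ℝ] F →L[ℝ] ℝ) (x u v w : F) :
    christoffelFirst h x u v w =
      (1 / 2) * (fderiv ℝ h x u v w + fderiv ℝ h x v u w - fderiv ℝ h x w u v) := by
  simp [christoffelFirst, lastSlots]

/-- Christoffel symbols of the second kind of the Levi-Civita connection of `h`, that is
`h x (christoffel h x u v) w = christoffelFirst h x u v w`: the covariant derivative of a vector
field `Y` in the direction `u` is `∂_u Y + christoffel h x u (Y x)`. -/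
def christoffel (h : F → F →L[ℝ] F →L[ℝ] ℝ) (x : F) : F →L[ℝ] F →L[ℝ] F :=
  ContinuousLinearMap.compL ℝ F (F →L[ℝ] ℝ) F (h x).inverse ∘L christoffelFirst h x

/-- The Riemann curvature tensor `R(u, v) w` of the Levi-Civita connection of `h`. -/
def curvature (h : F → F →L[ℝ] F →L[ℝ] ℝ) (x u v w : F) : F :=
  fderiv ℝ (christoffel h) x u v w - fderiv ℝ (christoffel h) x v u w
    + christoffel h x u (christoffel h x v w) - christoffel h x v (christoffel h x u w)

/-- The metric induced by `h` through `f`. -/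
def pullbackMetric (h : F → F →L[ℝ] F →L[ℝ] ℝ) (f : V → F) (z : V) : V →L[ℝ] V →L[ℝ] ℝ :=
  (h (f z)).bilinearComp (fderiv ℝ f z) (fderiv ℝ f z)

/-- A bilinear form is nondegenerate. -/
def Nondegenerate (m : V →L[ℝ] V →L[ℝ] ℝ) : Prop :=
  ∀ u : V, (∀ w : V, m u w = 0) → u = 0

/-- The tangential part of an ambient vector `ξ` at `f z`, as a vector of the parameter space:
the vector `u` with `h (df u) (df w) = h ξ (df w)` for all `w`. -/
def tangentPart (h : F → F →L[ℝ] F →L[ℝ] ℝ) (f : V → F) (z : V) (ξ : F) : V :=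
  (pullbackMetric h f z).inverse ((h (f z) ξ) ∘L fderiv ℝ f z)

/-- The normal part of an ambient vector at `f z`. -/
def normalPart (h : F → F →L[ℝ] F →L[ℝ] ℝ) (f : V → F) (z : V) (ξ : F) : F :=
  ξ - fderiv ℝ f z (tangentPart h f z ξ)

/-- The ambient covariant derivative `D_{df u} (df v)` along `f`, for constant `u` and `v`. -/
def ambientHessian (h : F → F →L[ℝ] F →L[ℝ] ℝ) (f : V → F) (z u v : V) : F :=
  fderiv ℝ (fderiv ℝ f) z u v + christoffel h (f z) (fderiv ℝ f z u) (fderiv ℝ f z v)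

/-- The second fundamental form `II(u, v)`, the normal part of `D_{df u} (df v)`. -/
def secondFundamentalForm (h : F → F →L[ℝ] F →L[ℝ] ℝ) (f : V → F) (z u v : V) : F :=
  normalPart h f z (ambientHessian h f z u v)

/-- The divergence of a vector field `W` with respect to (the Levi-Civita connection of) `m`:
the trace of `u ↦ ∇_u W`. -/
def divergence (m : V → V →L[ℝ] V →L[ℝ] ℝ) (W : V → V) (z : V) : ℝ :=
  LinearMap.trace ℝ V
    ((fderiv ℝ W z + (christoffel m z).flip (W z) : V →L[ℝ] V) : V →ₗ[ℝ] V)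

end Coordinates

/-- The model of a surface. -/
abbrev Plane : Type := EuclideanSpace ℝ (Fin 2)

/-- The standard basis of the plane. -/
def e (i : Fin 2) : Plane := EuclideanSpace.single i 1

section PlaneCoordinates

variable {F : Type*} [NormedAddCommGroup F] [NormedSpace ℝ F]

/-- The Gram matrix `((E, F), (F, G))` of a bilinear form on the plane. -/
def gram (m : Plane →L[ℝ] Plane →L[ℝ] ℝ) : Matrix (Fin 2) (Fin 2) ℝ :=
  Matrix.of fun i k => m (e i) (e k)

/-- The mean curvature vector of the parametrized surface `f`, half the trace of the second
fundamental form with respect to the induced metric. -/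
def meanCurvature (h : F → F →L[ℝ] F →L[ℝ] ℝ) (f : Plane → F) (z : Plane) : F :=
  (1 / 2 : ℝ) • ∑ i, ∑ k,
    (gram (pullbackMetric h f z))⁻¹ i k • secondFundamentalForm h f z (e i) (e k)

/-- The area of the parametrized surface `f` over `A`, for the induced metric: the integral of
`√|E G - F²|`. -/
def area (h : F → F →L[ℝ] F →L[ℝ] ℝ) (f : Plane → F) (A : Set Plane) : ℝ :=
  ∫ z in A, Real.sqrt |(gram (pullbackMetric h f z)).det|

end PlaneCoordinates

/-! ### The structures of the tangent bundle of an oriented Riemannian surface -/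

section Surface

variable {S : Type*} [TopologicalSpace S] [ChartedSpace Plane S] [IsManifold (𝓡 2) ∞ S]
  [RiemannianBundle (fun p : S => TangentSpace (𝓡 2) p)]

/-- An orientation of a surface: orientations of the tangent spaces, locally constant in the local
trivializations of the tangent bundle. -/
structure SurfaceOrientation (S : Type*) [TopologicalSpace S] [ChartedSpace Plane S]
    [IsManifold (𝓡 2) ∞ S] where
  at_point : ∀ p : S, Orientation ℝ (TangentSpace (𝓡 2) p) (Fin 2)
  locally_constant : ∀ p : S, ∃ o : Orientation ℝ Plane (Fin 2), ∀ᶠ q in nhds p,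
    ∀ hq : q ∈ (trivializationAt Plane (TangentSpace (𝓡 2)) p).baseSet,
      Orientation.map (Fin 2)
        ((trivializationAt Plane (TangentSpace (𝓡 2)) p).continuousLinearEquivAt ℝ q
          hq).toLinearEquiv (at_point q) = o

theorem finrank_tangent {S : Type*} [TopologicalSpace S] [ChartedSpace Plane S] (p : S) : Module.finrank ℝ (TangentSpace (𝓡 2) p) = 2 :=
  (finrank_euclideanSpace_fin : Module.finrank ℝ Plane = 2)

/-- The complex structure `j`: rotation by a right angle in the oriented Euclidean plane `T_p S`. -/
def rot (o : SurfaceOrientation S) (p : S) :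
    TangentSpace (𝓡 2) p →L[ℝ] TangentSpace (𝓡 2) p :=
  haveI : Fact (Module.finrank ℝ (TangentSpace (𝓡 2) p) = 2) := ⟨finrank_tangent p⟩
  ((o.at_point p).rightAngleRotation.toContinuousLinearEquiv :
    TangentSpace (𝓡 2) p →L[ℝ] TangentSpace (𝓡 2) p)

/-- The metric `g` in a chart. -/
def metricIn (φ : OpenPartialHomeomorph S Plane) (x : Plane) : Plane →L[ℝ] Plane →L[ℝ] ℝ :=
  (innerSL ℝ : TangentSpace (𝓡 2) (φ.symm x) →L[ℝ] TangentSpace (𝓡 2) (φ.symm x) →L[ℝ]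
    ℝ).bilinearComp (mfderiv (𝓡 2) (𝓡 2) φ.symm x) (mfderiv (𝓡 2) (𝓡 2) φ.symm x)

/-- The complex structure `j` in a chart. -/
def rotIn (o : SurfaceOrientation S) (φ : OpenPartialHomeomorph S Plane) (x : Plane) :
    Plane →L[ℝ] Plane :=
  (mfderiv (𝓡 2) (𝓡 2) φ (φ.symm x)) ∘L (rot o (φ.symm x)) ∘L (mfderiv (𝓡 2) (𝓡 2) φ.symm x)

/-! In the chart `φ` of `S` a point `v ∈ T_p S` of the tangent bundle has coordinates
`(φ p, dφ v) = (x, y)`.  The following objects at `(x, y)` are given in these coordinates; a tangent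
vector of the tangent bundle is written `ξ = (ξ.1, ξ.2)`. -/

/-- The connection map `K`, in coordinates `K ξ = ξ.2 + Γ(ξ.1, y)`: if `ξ` is the velocity of
`(p(s), V(s))` then `K ξ = ∇_{p'} V`. -/
def connectionIn (φ : OpenPartialHomeomorph S Plane) (q : Plane × Plane) :
    Plane × Plane →L[ℝ] Plane :=
  ContinuousLinearMap.snd ℝ Plane Plane +
    (christoffel (metricIn φ) q.1).flip q.2 ∘L ContinuousLinearMap.fst ℝ Plane Plane

/-- The symplectic form `Ω(ξ, η) = g(K ξ, P η) - g(P ξ, K η)`, where `P` is the differential of the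
projection to `S`. -/
def omegaIn (φ : OpenPartialHomeomorph S Plane) (q : Plane × Plane) :
    Plane × Plane →L[ℝ] Plane × Plane →L[ℝ] ℝ :=
  (metricIn φ q.1).bilinearComp (connectionIn φ q) (ContinuousLinearMap.fst ℝ Plane Plane) -
    (metricIn φ q.1).bilinearComp (ContinuousLinearMap.fst ℝ Plane Plane) (connectionIn φ q)

/-- The complex structure `J = j ⊕ j`, that is `P (J ξ) = j (P ξ)` and `K (J ξ) = j (K ξ)`. -/
def complexIn (o : SurfaceOrientation S) (φ : OpenPartialHomeomorph S Plane) (q : Plane × Plane) :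
    Plane × Plane →L[ℝ] Plane × Plane :=
  (rotIn o φ q.1 ∘L ContinuousLinearMap.fst ℝ Plane Plane).prod
    (rotIn o φ q.1 ∘L connectionIn φ q -
      (christoffel (metricIn φ) q.1).flip q.2 ∘L rotIn o φ q.1 ∘L
        ContinuousLinearMap.fst ℝ Plane Plane)

/-- The neutral metric `G(ξ, η) = Ω(J ξ, η)`. -/
def neutralIn (o : SurfaceOrientation S) (φ : OpenPartialHomeomorph S Plane) (q : Plane × Plane) :
    Plane × Plane →L[ℝ] Plane × Plane →L[ℝ] ℝ :=
  omegaIn φ q ∘L complexIn o φ q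

/-! ### Immersed surfaces of the tangent bundle -/

variable {L : Type*} [TopologicalSpace L] [ChartedSpace Plane L]

/-- The coordinate expression of `X : L → TS` in a chart `φ` of `S` and a chart `ψ` of `L`. -/
def localExpr (φ : OpenPartialHomeomorph S Plane) (ψ : OpenPartialHomeomorph L Plane)
    (X : L → TangentBundle (𝓡 2) S) (z : Plane) : Plane × Plane :=
  (φ (X (ψ.symm z)).proj,
    mfderiv (𝓡 2) (𝓡 2) φ (X (ψ.symm z)).proj (X (ψ.symm z)).snd)

/-- The open set of the plane on which the coordinate expression of `X` is meaningful. -/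
def localDomain (φ : OpenPartialHomeomorph S Plane) (ψ : OpenPartialHomeomorph L Plane)
    (X : L → TangentBundle (𝓡 2) S) : Set Plane :=
  {z ∈ ψ.target | (X (ψ.symm z)).proj ∈ φ.source}

/-- A property of the coordinate expressions of `X` holds at all points of `W`, in all smooth
charts of `S` and of `L`. -/
def InAllCharts (X : L → TangentBundle (𝓡 2) S) (W : Set L)
    (Q : OpenPartialHomeomorph S Plane → (Plane → Plane × Plane) → Plane → Prop) : Prop :=
  ∀ φ ∈ IsManifold.maximalAtlas (𝓡 2) ∞ S, ∀ ψ ∈ IsManifold.maximalAtlas (𝓡 2) ∞ L,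
    ∀ z ∈ localDomain φ ψ X, ψ.symm z ∈ W → Q φ (localExpr φ ψ X) z

/-- `X` is a smooth immersion. -/
def IsSmoothImmersion (X : L → TangentBundle (𝓡 2) S) : Prop :=
  ContMDiff (𝓡 2) (𝓡 2).tangent ∞ X ∧
    ∀ x : L, Function.Injective (mfderiv (𝓡 2) (𝓡 2).tangent X x)

/-- The projection of the surface to `S` has rank one everywhere. -/
def HasRankOne (X : L → TangentBundle (𝓡 2) S) : Prop :=
  ∀ x : L, Module.finrank ℝ
    (LinearMap.range (mfderiv (𝓡 2) (𝓡 2) (fun y : L => (X y).proj) x).toLinearMap) = 1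

/-- `Ω` vanishes on the surface. -/
def IsLagrangian (X : L → TangentBundle (𝓡 2) S) : Prop :=
  InAllCharts X univ fun φ f z =>
    ∀ u w : Plane, omegaIn φ (f z) (fderiv ℝ f z u) (fderiv ℝ f z w) = 0

/-- The induced metric is nondegenerate and its curvature tensor vanishes. -/
def IsFlat (o : SurfaceOrientation S) (X : L → TangentBundle (𝓡 2) S) : Prop :=
  InAllCharts X univ fun φ f z => Nondegenerate (pullbackMetric (neutralIn o φ) f z) ∧
    ∀ u v w : Plane, curvature (pullbackMetric (neutralIn o φ) f) z u v w = 0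

/-- The part `W` of the surface is minimal: the induced metric is nondegenerate and the mean
curvature vector vanishes there. -/
def IsMinimalOn (o : SurfaceOrientation S) (X : L → TangentBundle (𝓡 2) S) (W : Set L) : Prop :=
  InAllCharts X W fun φ f z => Nondegenerate (pullbackMetric (neutralIn o φ) f z) ∧
    meanCurvature (neutralIn o φ) f z = 0

/-- `div (J H) = 0`, where the divergence is that of the induced metric.  On a Lagrangian surface
with nondegenerate metric `J H` is tangent; it is here regarded as a vector field on the surface. -/
def HasDivergenceFreeJH (o : SurfaceOrientation S) (X : L → TangentBundle (𝓡 2) S) : Prop :=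
  InAllCharts X univ fun φ f z =>
    divergence (pullbackMetric (neutralIn o φ) f)
      (fun z' => tangentPart (neutralIn o φ) f z'
        (complexIn o φ (f z') (meanCurvature (neutralIn o φ) f z'))) z = 0

/-- The smooth variations `Φ ε`, `|ε| < δ`, of a parametrized surface `f : U → φ.target × Plane` of
the tangent bundle (in the chart `φ`) that are fixed outside a compact set `A ⊆ U` and whose
variation vector `∂Φ/∂ε` at `ε = 0` is Hamiltonian: `Ω(∂Φ/∂ε, df w) = du w` for all `w`, for some
smooth function `u` with compact support in `U`. -/
structure IsHamiltonianVariation (φ : OpenPartialHomeomorph S Plane) (U : Set Plane)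
    (f : Plane → Plane × Plane) (A : Set Plane) (δ : ℝ) (Φ : ℝ → Plane → Plane × Plane) : Prop where
  compact : IsCompact A
  subset : A ⊆ U
  pos : 0 < δ
  smooth : ContDiffOn ℝ ∞ (fun p : ℝ × Plane => Φ p.1 p.2) (Ioo (-δ) δ ×ˢ U)
  maps_to : ∀ ε ∈ Ioo (-δ) δ, ∀ z ∈ U, (Φ ε z).1 ∈ φ.target
  initial : ∀ z ∈ U, Φ 0 z = f z
  fixed : ∀ ε ∈ Ioo (-δ) δ, ∀ z ∈ U \ A, Φ ε z = f z
  hamiltonian : ∃ u : Plane → ℝ, ContDiff ℝ ∞ u ∧ HasCompactSupport u ∧ tsupport u ⊆ U ∧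
    ∀ z ∈ U, ∀ w : Plane,
      omegaIn φ (f z) (deriv (fun ε => Φ ε z) 0) (fderiv ℝ f z w) = fderiv ℝ u z w

/-- The surface is a critical point of the area of the induced metric under Hamiltonian variations
with compact support.  The variations are supported in coordinate patches; by a partition of unity
this is no restriction, as the first variation is linear in the Hamiltonian function. -/
def IsHamiltonianStationary (o : SurfaceOrientation S) (X : L → TangentBundle (𝓡 2) S) : Prop :=
  ∀ φ ∈ IsManifold.maximalAtlas (𝓡 2) ∞ S, ∀ ψ ∈ IsManifold.maximalAtlas (𝓡 2) ∞ L,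
    ∀ (A : Set Plane) (δ : ℝ) (Φ : ℝ → Plane → Plane × Plane),
      IsHamiltonianVariation φ (localDomain φ ψ X) (localExpr φ ψ X) A δ Φ →
        HasDerivAt (fun ε => area (neutralIn o φ) (Φ ε) A) 0 0

/-! ### Curves and affine normal bundles -/

/-- The velocity of a curve. -/
def velocity (γ : ℝ → S) (s : ℝ) : TangentSpace (𝓡 2) (γ s) :=
  mfderiv 𝓘(ℝ, ℝ) (𝓡 2) γ s (1 : ℝ)

/-- `∇_{γ'} γ' = 0` on the set `T` of parameters. -/
def IsGeodesicOn (γ : ℝ → S) (T : Set ℝ) : Prop :=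
  ∀ φ ∈ IsManifold.maximalAtlas (𝓡 2) ∞ S, ∀ s ∈ T, γ s ∈ φ.source →
    deriv (deriv fun r => φ (γ r)) s +
      christoffel (metricIn φ) (φ (γ s)) (deriv (fun r => φ (γ r)) s)
        (deriv (fun r => φ (γ r)) s) = 0

/-- The domain of the chart `ψ` of `L` is an affine normal bundle over the curve
`γ : (s₀, s₁) → S`: in the coordinates `(s, t) ∈ (s₀, s₁) × (t₀, t₁)` given by `ψ`,
`X = (γ(s), a(s) γ'(s) + t j γ'(s))`, with `γ` of unit speed. -/
structure IsAffineNormalPatch (o : SurfaceOrientation S) (X : L → TangentBundle (𝓡 2) S)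
    (ψ : OpenPartialHomeomorph L Plane) (s₀ s₁ t₀ t₁ : ℝ) (γ : ℝ → S) (a : ℝ → ℝ) : Prop where
  chart_mem : ψ ∈ IsManifold.maximalAtlas (𝓡 2) ∞ L
  s_lt : s₀ < s₁
  t_lt : t₀ < t₁
  target_eq : ψ.target = {z | z 0 ∈ Ioo s₀ s₁ ∧ z 1 ∈ Ioo t₀ t₁}
  smooth_curve : ContMDiffOn 𝓘(ℝ, ℝ) (𝓡 2) ∞ γ (Ioo s₀ s₁)
  unit_speed : ∀ s ∈ Ioo s₀ s₁, ‖velocity γ s‖ = 1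
  smooth_coeff : ContDiffOn ℝ ∞ a (Ioo s₀ s₁)
  eq : ∀ z ∈ ψ.target, X (ψ.symm z) =
    ⟨γ (z 0), a (z 0) • velocity γ (z 0) + z 1 • rot o (γ (z 0)) (velocity γ (z 0))⟩

end Surface

end TangentSurface

end

set_option linter.unusedSectionVars false

namespace TangentSurface

/-! ### Levi-Civita connections in coordinates, and metrics pulled back from a constant form. -/

section Coordinates

variable {V F W : Type*} [NormedAddCommGroup V] [NormedSpace ℝ V] [FiniteDimensional ℝ V]
  [NormedAddCommGroup F] [NormedSpace ℝ F] [FiniteDimensional ℝ F]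
  [NormedAddCommGroup W] [NormedSpace ℝ W] [FiniteDimensional ℝ W]

/-! In a chart of Σ the immersion becomes f = (x, y). Write n = jγ', and κ for the curvature of γ.

Normal form (`exists_rankOneFrame`, `RankOneFrame.exists_coordinates`). Since dx has rank one, dx =
λ ⊗ E locally, with E a unit field. The form λ = g(E, dx) is closed because ∇ is torsion free and E
has constant length, so λ = dσ on a ball. Symmetry of D²x makes E constant along ker dσ, so x and E
are functions of σ alone and x runs along a unit speed curve with velocity E. For u in ker dσ the
Lagrangian condition says that dy(u) is orthogonal to E. Hence the tangential component a of y is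
also a function of σ, and since f is an immersion the normal component τ = g(y, jE) is a second
coordinate.

Null coordinates (`AffineNormalForm.exists_nullCoordinates`). The derivatives of X satisfy P X_s =
γ', K X_s = (a' - tκ)γ' + aκ n and X_t = (0, n), so the induced metric is -2 ds (dt + aκ ds). With v
= t + b(s) and b' = aκ it becomes -2 dσ dv, which is nondegenerate and flat.

Mean curvature (`NullCoordinates.meanCurvature_eq`). For the metric -2 dσ dv one has H = -II(∂_σ,
∂_v). Covariant derivatives of vertical vectors are vertical and computed by the connection of Σ
(`KaehlerChart.christoffel_vertical`), so the derivative of (0, n) along ∂_σ is (0, ∇n) = (0, -κγ'),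
which is already normal. Thus H = (0, κγ'), and it vanishes exactly when γ is a geodesic. Moreover
𝕁H = (0, κn) = κ(σ) ∂_v, whose divergence in flat coordinates is ∂_v κ = 0.

Stationarity (`NullCoordinates.planeDiv_variation`, `hasDerivAt_area`). If the variation vector Y
has Hamiltonian function u, then the derivative of the area density is the Euclidean divergence of
the compactly supported field √|det| (Yᵀ + 2u 𝕁H), Yᵀ being the tangential part. Its integral is
therefore zero.

The functions σ, τ, v are arbitrary smooth coordinates on the parameter domain, not the standard
ones. A change of chart on L thus only changes these functions
(`IsAffineNormalPatch.exists_affineNormalForm`), and assertions in all charts need no separate proof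
of invariance. -/

theorem contDiffAt_clm {D E G : Type*} [NormedAddCommGroup D] [NormedSpace ℝ D]
    [NormedAddCommGroup E] [NormedSpace ℝ E] [FiniteDimensional ℝ E]
    [NormedAddCommGroup G] [NormedSpace ℝ G] {n : WithTop ℕ∞}
    {f : D → E →L[ℝ] G} {x : D} (h : ∀ y, ContDiffAt ℝ n (fun x => f x y) x) :
    ContDiffAt ℝ n f x := by
  let d := Module.finrank ℝ E
  have hd : d = Module.finrank ℝ (Fin d → ℝ) := (Module.finrank_fin_fun ℝ).symm
  let e₁ := ContinuousLinearEquiv.ofFinrankEq hd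
  let e₂ := (e₁.arrowCongr (1 : G ≃L[ℝ] G)).trans (ContinuousLinearEquiv.piRing (Fin d))
  rw [← Function.id_comp f, ← e₂.symm_comp_self]
  exact e₂.symm.contDiff.contDiffAt.comp x (contDiffAt_pi.mpr fun i => h _)

theorem hasFDerivAt_clm_const {D E G : Type*} [NormedAddCommGroup D] [NormedSpace ℝ D]
    [NormedAddCommGroup E] [NormedSpace ℝ E] [NormedAddCommGroup G] [NormedSpace ℝ G]
    {f : D → E →L[ℝ] G} {x : D} (hf : DifferentiableAt ℝ f x) (v : E) :
    HasFDerivAt (fun y => f y v) ((fderiv ℝ f x).flip v) x := by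
  have := hf.hasFDerivAt.clm_apply (hasFDerivAt_const v x)
  convert this using 1
  ext; simp

theorem contDiffAt_clm₂ {D : Type*} [NormedAddCommGroup D] [NormedSpace ℝ D] {n : WithTop ℕ∞}
    {h : D → F →L[ℝ] F →L[ℝ] ℝ} {x : D} (H : ∀ u v, ContDiffAt ℝ n (fun x => h x u v) x) :
    ContDiffAt ℝ n h x :=
  contDiffAt_clm fun u => contDiffAt_clm fun v => H u v

/-- Injectivity and equality of dimensions suffice. The point is that `inverse` takes the value 0 on
non-invertible maps, so `christoffel` and `tangentPart` have their intended meaning only through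
this lemma. -/
theorem Nondegenerate.isInvertible {m : V →L[ℝ] V →L[ℝ] ℝ} (hm : Nondegenerate m) :
    m.IsInvertible := by
  have hfin : Module.finrank ℝ V = Module.finrank ℝ (V →L[ℝ] ℝ) := by
    rw [← (LinearMap.toContinuousLinearMap (𝕜 := ℝ) (E := V) (F' := ℝ)).finrank_eq]
    exact (Subspace.dual_finrank_eq).symm
  have hinj : Function.Injective (m : V →ₗ[ℝ] V →L[ℝ] ℝ) := by
    rw [← LinearMap.ker_eq_bot, LinearMap.ker_eq_bot']
    intro u hu
    exact hm u fun w => by simpa using congrArg (fun l : V →L[ℝ] ℝ => l w) hu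
  refine ⟨(LinearEquiv.ofInjectiveOfFinrankEq _ hinj hfin).toContinuousLinearEquiv, ?_⟩
  ext u w
  rfl

theorem christoffel_spec {h : F → F →L[ℝ] F →L[ℝ] ℝ} {x : F} (hx : Nondegenerate (h x))
    (u v w : F) : h x (christoffel h x u v) w = christoffelFirst h x u v w :=
  congrArg (fun l : F →L[ℝ] ℝ => l w) (hx.isInvertible.self_apply_inverse (christoffelFirst h x u v))

/-- Connections are computed below by guessing the answer and checking it against all test vectors.
-/
theorem christoffel_eq {h : F → F →L[ℝ] F →L[ℝ] ℝ} {x u v a : F} (hx : Nondegenerate (h x))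
    (H : ∀ w, h x a w = christoffelFirst h x u v w) : christoffel h x u v = a :=
  (hx.isInvertible.inverse_apply_eq).2 (ContinuousLinearMap.ext fun w => (H w).symm)

theorem contDiffAt_christoffel {h : F → F →L[ℝ] F →L[ℝ] ℝ} {x : F} (hx : Nondegenerate (h x))
    (hh : ContDiffAt ℝ ∞ h x) : ContDiffAt ℝ ∞ (christoffel h) x := by
  have h1 : ContDiffAt ℝ ∞ (fderiv ℝ h) x := hh.fderiv_right (by simp)
  have h2 : ContDiffAt ℝ ∞ (fun y => (h y).inverse) x :=
    hx.isInvertible.contDiffAt_map_inverse.comp x hh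
  have h3 (u v w : F) : ContDiffAt ℝ ∞ (fun y => fderiv ℝ h y u v w) x :=
    ((h1.clm_apply contDiffAt_const).clm_apply contDiffAt_const).clm_apply contDiffAt_const
  have h4 (u v : F) : ContDiffAt ℝ ∞ (fun y => christoffelFirst h y u v) x := by
    refine contDiffAt_clm fun w => ?_
    simp only [christoffelFirst_apply]
    exact contDiffAt_const.mul (((h3 u v w).add (h3 v u w)).sub (h3 w u v))
  exact contDiffAt_clm fun u => contDiffAt_clm fun v => h2.clm_apply (h4 u v)

theorem fderiv_apply₂ {h : F → V →L[ℝ] V →L[ℝ] ℝ} {x : F} (hh : DifferentiableAt ℝ h x)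
    (u : F) (v w : V) : fderiv ℝ h x u v w = fderiv ℝ (fun y => h y v w) x u := by
  have := ((hh.hasFDerivAt.clm_apply (hasFDerivAt_const v x)).clm_apply
    (hasFDerivAt_const w x)).fderiv
  rw [this]; simp

theorem fderiv_symm {h : F → V →L[ℝ] V →L[ℝ] ℝ} {x : F} (hh : DifferentiableAt ℝ h x)
    (hs : ∀ᶠ y in nhds x, ∀ u v, h y u v = h y v u) (u : F) (v w : V) :
    fderiv ℝ h x u v w = fderiv ℝ h x u w v := by
  rw [fderiv_apply₂ hh, fderiv_apply₂ hh]
  rw [Filter.EventuallyEq.fderiv_eq (hs.mono fun y hy => hy v w)]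

theorem christoffel_symm {h : F → F →L[ℝ] F →L[ℝ] ℝ} {x : F} 
    (hh : DifferentiableAt ℝ h x) (hs : ∀ᶠ y in nhds x, ∀ u v, h y u v = h y v u) (u v : F) :
    christoffel h x u v = christoffel h x v u := by
  have : christoffelFirst h x u v = christoffelFirst h x v u := by
    ext w
    rw [christoffelFirst_apply, christoffelFirst_apply, fderiv_symm hh hs w u v]
    ring
  exact congrArg (h x).inverse this

/-- The Levi-Civita connection is metric. -/
theorem fderiv_metric {h : F → F →L[ℝ] F →L[ℝ] ℝ} {x : F} (hx : Nondegenerate (h x))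
    (hh : DifferentiableAt ℝ h x) (hs : ∀ᶠ y in nhds x, ∀ u v, h y u v = h y v u) (u v w : F) :
    fderiv ℝ h x u v w = h x (christoffel h x u v) w + h x v (christoffel h x u w) := by
  rw [hs.self_of_nhds v, christoffel_spec hx, christoffel_spec hx, christoffelFirst_apply,
    christoffelFirst_apply, fderiv_symm hh hs v u w, fderiv_symm hh hs w u v,
    fderiv_symm hh hs u w v]
  ring

theorem isInvertible_of_injective {A : V →L[ℝ] V} (hA : Function.Injective A) : A.IsInvertible :=
  ⟨(LinearEquiv.ofInjectiveEndo (A : V →ₗ[ℝ] V) hA).toContinuousLinearEquiv, by ext; rfl⟩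

/-- The Christoffel symbols of the pullback of a constant metric `B` by `θ`. -/
theorem christoffel_pullback_const {B : W →L[ℝ] W →L[ℝ] ℝ} (hBs : ∀ u v, B u v = B v u)
    {θ : V → W} {m : V → V →L[ℝ] V →L[ℝ] ℝ} {z : V} (hθ : ContDiffAt ℝ 2 θ z)
    (hm : ∀ᶠ y in nhds z, ∀ u v, m y u v = B (fderiv ℝ θ y u) (fderiv ℝ θ y v))
    (hnd : Nondegenerate (m z)) (hsurj : Function.Surjective (fderiv ℝ θ z)) (u v : V) :
    fderiv ℝ θ z (christoffel m z u v) = fderiv ℝ (fderiv ℝ θ) z u v := by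
  have hA : ContDiffAt ℝ 1 (fderiv ℝ θ) z := hθ.fderiv_right (by norm_num)
  have hA' : DifferentiableAt ℝ (fderiv ℝ θ) z := hA.differentiableAt (by simp)
  have hsymm : IsSymmSndFDerivAt ℝ θ z := hθ.isSymmSndFDerivAt (by simp)
  have hAv (v : V) : HasFDerivAt (fun y => fderiv ℝ θ y v) ((fderiv ℝ (fderiv ℝ θ) z).flip v) z :=
    hasFDerivAt_clm_const hA' v
  have hmd : DifferentiableAt ℝ m z := by
    refine ContDiffAt.differentiableAt (n := 1) (contDiffAt_clm₂ fun u v => ?_) (by simp)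
    have : ContDiffAt ℝ 1 (fun y => B (fderiv ℝ θ y u) (fderiv ℝ θ y v)) z :=
      (B.contDiff.contDiffAt.comp z (hA.clm_apply contDiffAt_const)).clm_apply
        (hA.clm_apply contDiffAt_const)
    exact this.congr_of_eventuallyEq (hm.mono fun y hy => hy u v)
  have hdm (u v w : V) : fderiv ℝ m z u v w =
      B (fderiv ℝ (fderiv ℝ θ) z u v) (fderiv ℝ θ z w) +
        B (fderiv ℝ θ z v) (fderiv ℝ (fderiv ℝ θ) z u w) := by
    rw [fderiv_apply₂ hmd, Filter.EventuallyEq.fderiv_eq (hm.mono fun y hy => hy v w)]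
    rw [(B.hasFDerivAt_of_bilinear (hAv v) (hAv w)).fderiv]
    simp [add_comm]
  obtain ⟨a, ha⟩ := hsurj (fderiv ℝ (fderiv ℝ θ) z u v)
  rw [christoffel_eq (a := a) hnd, ha]
  intro w
  -- Of the six terms of the form B(D²θ, Dθ) in Koszul's formula four cancel by symmetry of D²θ and
  -- B, and the other two are both equal to B(D²θ(u, v), Dθ w).
  rw [hm.self_of_nhds, ha, christoffelFirst_apply, hdm, hdm, hdm, hsymm.eq u w, hsymm.eq v w,
    hsymm.eq v u, hBs (fderiv ℝ θ z u), hBs (fderiv ℝ θ z v)]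
  ring

/-- The pullback of a constant metric by a local diffeomorphism is flat. -/
theorem curvature_pullback_const {B : W →L[ℝ] W →L[ℝ] ℝ} (hBs : ∀ u v, B u v = B v u)
    {θ : V → W} {m : V → V →L[ℝ] V →L[ℝ] ℝ} {z : V} (hθ : ContDiffAt ℝ ∞ θ z)
    (hm : ∀ᶠ y in nhds z, ∀ u v, m y u v = B (fderiv ℝ θ y u) (fderiv ℝ θ y v))
    (hnd : ∀ᶠ y in nhds z, Nondegenerate (m y))
    (hbij : ∀ᶠ y in nhds z, Function.Bijective (fderiv ℝ θ y)) (u v w : V) :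
    curvature m z u v w = 0 := by
  have hA : ContDiffAt ℝ ∞ (fderiv ℝ θ) z := hθ.fderiv_right (by simp)
  have hA' : DifferentiableAt ℝ (fderiv ℝ θ) z := hA.differentiableAt (by simp)
  have hDA : DifferentiableAt ℝ (fderiv ℝ (fderiv ℝ θ)) z :=
    (hA.fderiv_right (m := ∞) (by simp)).differentiableAt (by simp)
  have hm' : ContDiffAt ℝ ∞ m z := by
    refine contDiffAt_clm₂ fun u v => ?_
    have : ContDiffAt ℝ ∞ (fun y => B (fderiv ℝ θ y u) (fderiv ℝ θ y v)) z :=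
      (B.contDiff.contDiffAt.comp z (hA.clm_apply contDiffAt_const)).clm_apply
        (hA.clm_apply contDiffAt_const)
    exact this.congr_of_eventuallyEq (hm.mono fun y hy => hy u v)
  have hΓ : DifferentiableAt ℝ (christoffel m) z :=
    (contDiffAt_christoffel hnd.self_of_nhds hm').differentiableAt (by simp)
  have hev : ∀ᶠ y in nhds z, ∀ u v,
      fderiv ℝ θ y (christoffel m y u v) = fderiv ℝ (fderiv ℝ θ) y u v := by
    filter_upwards [hm.eventually_nhds, hnd, hbij, (hθ.of_le (m := 2) (by norm_cast)).eventually (by simp)]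
      with y h1 h2 h3 h4 u v
    exact christoffel_pullback_const hBs h4 h1 h2 h3.2 u v
  -- The identity Dθ Γ = D²θ holds near z, so it may be differentiated once more.
  have key (u v w : V) : fderiv ℝ θ z (fderiv ℝ (christoffel m) z u v w) =
      fderiv ℝ (fderiv ℝ (fderiv ℝ θ)) z u v w -
        fderiv ℝ (fderiv ℝ θ) z u (christoffel m z v w) := by
    have e1 := (hA'.hasFDerivAt.clm_apply ((hΓ.hasFDerivAt.clm_apply
      (hasFDerivAt_const v z)).clm_apply (hasFDerivAt_const w z))).fderiv
    have e2 := ((hDA.hasFDerivAt.clm_apply (hasFDerivAt_const v z)).clm_apply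
      (hasFDerivAt_const w z)).fderiv
    rw [Filter.EventuallyEq.fderiv_eq (hev.mono fun y hy => hy v w), e2] at e1
    have := congrArg (fun l : V →L[ℝ] W => l u) e1
    simp at this
    rw [this]; abel
  have hsymm : IsSymmSndFDerivAt ℝ (fderiv ℝ θ) z :=
    hA.isSymmSndFDerivAt (by simp; norm_cast)
  -- After applying Dθ the third derivatives cancel by symmetry in u, v, and the terms D²θ(u, Γ(v,
  -- w)) = Dθ Γ(u, Γ(v, w)) cancel the quadratic part of the curvature.
  apply hbij.self_of_nhds.1
  have e := hev.self_of_nhds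
  simp only [curvature, map_add, map_sub, key, e, hsymm.eq u v, map_zero]
  abel

/-- The divergence of a vector field in terms of flat coordinates `θ`. -/
theorem divergence_pullback_const {B : W →L[ℝ] W →L[ℝ] ℝ} (hBs : ∀ u v, B u v = B v u)
    {θ : V → W} {m : V → V →L[ℝ] V →L[ℝ] ℝ} {z : V} (hθ : ContDiffAt ℝ 2 θ z)
    (hm : ∀ᶠ y in nhds z, ∀ u v, m y u v = B (fderiv ℝ θ y u) (fderiv ℝ θ y v))
    (hnd : Nondegenerate (m z)) (hbij : Function.Bijective (fderiv ℝ θ z))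
    {Y : V → V} (hY : DifferentiableAt ℝ Y z) {l : V →L[ℝ] ℝ} {b : V} 
    (hl : ∀ u, fderiv ℝ (fun y => fderiv ℝ θ y (Y y)) z u = l u • fderiv ℝ θ z b) (hlb : l b = 0) :
    divergence m Y z = 0 := by
  have hA : ContDiffAt ℝ 1 (fderiv ℝ θ) z := hθ.fderiv_right (by norm_num)
  have hA' : DifferentiableAt ℝ (fderiv ℝ θ) z := hA.differentiableAt (by simp)
  -- Under Dθ the covariant derivative of Y becomes the ordinary derivative of Dθ Y. So ∇Y is the
  -- rank one map l ⊗ b, with trace l b.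
  have : (fderiv ℝ Y z + (christoffel m z).flip (Y z) : V →L[ℝ] V) = l.smulRight b := by
    ext u
    apply hbij.1
    have := (hA'.hasFDerivAt.clm_apply hY.hasFDerivAt).fderiv
    have h2 := hl u
    rw [this] at h2
    simp at h2
    simp [christoffel_pullback_const hBs hθ hm hnd hbij.2, h2]
  rw [divergence, this]
  have : ((l.smulRight b : V →L[ℝ] V) : V →ₗ[ℝ] V) = (l : V →ₗ[ℝ] ℝ).smulRight b := rfl
  rw [this, LinearMap.trace_smulRight]
  exact hlb

end Coordinates


/-! ### The symplectic, complex and neutral structures of the tangent bundle over a chart. -/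

/-- The coordinate expression `h` of a metric and `J` of its rotation by a right angle on an open
set of the plane. -/
structure KaehlerChart (T : Set Plane) (h : Plane → Plane →L[ℝ] Plane →L[ℝ] ℝ)
    (J : Plane → Plane →L[ℝ] Plane) : Prop where
  isOpen : IsOpen T
  smooth_metric : ∀ x ∈ T, ContDiffAt ℝ ∞ h x
  smooth_rot : ∀ x ∈ T, ContDiffAt ℝ ∞ J x
  symm : ∀ x ∈ T, ∀ u v, h x u v = h x v u
  pos : ∀ x ∈ T, ∀ u, u ≠ 0 → 0 < h x u u
  rot_rot : ∀ x ∈ T, ∀ u, J x (J x u) = -u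
  rot_skew : ∀ x ∈ T, ∀ u v, h x (J x u) v = -h x u (J x v)

/-- `connectionIn` for an arbitrary metric. -/
noncomputable def connectionOf (h : Plane → Plane →L[ℝ] Plane →L[ℝ] ℝ) (q : Plane × Plane) :
    Plane × Plane →L[ℝ] Plane :=
  ContinuousLinearMap.snd ℝ Plane Plane +
    (christoffel h q.1).flip q.2 ∘L ContinuousLinearMap.fst ℝ Plane Plane

/-- `omegaIn` for an arbitrary metric. -/
noncomputable def omegaOf (h : Plane → Plane →L[ℝ] Plane →L[ℝ] ℝ) (q : Plane × Plane) :
    Plane × Plane →L[ℝ] Plane × Plane →L[ℝ] ℝ :=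
  (h q.1).bilinearComp (connectionOf h q) (ContinuousLinearMap.fst ℝ Plane Plane) -
    (h q.1).bilinearComp (ContinuousLinearMap.fst ℝ Plane Plane) (connectionOf h q)

/-- `complexIn` for an arbitrary metric and complex structure. -/
noncomputable def complexOf (h : Plane → Plane →L[ℝ] Plane →L[ℝ] ℝ)
    (J : Plane → Plane →L[ℝ] Plane) (q : Plane × Plane) :
    Plane × Plane →L[ℝ] Plane × Plane :=
  (J q.1 ∘L ContinuousLinearMap.fst ℝ Plane Plane).prod
    (J q.1 ∘L connectionOf h q -
      (christoffel h q.1).flip q.2 ∘L J q.1 ∘L ContinuousLinearMap.fst ℝ Plane Plane)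

/-- `neutralIn` for an arbitrary metric and complex structure. -/
noncomputable def neutralOf (h : Plane → Plane →L[ℝ] Plane →L[ℝ] ℝ)
    (J : Plane → Plane →L[ℝ] Plane) (q : Plane × Plane) :
    Plane × Plane →L[ℝ] Plane × Plane →L[ℝ] ℝ :=
  omegaOf h q ∘L complexOf h J q

variable {T : Set Plane} {h : Plane → Plane →L[ℝ] Plane →L[ℝ] ℝ} {J : Plane → Plane →L[ℝ] Plane}

theorem connectionOf_apply (q ξ : Plane × Plane) :
    connectionOf h q ξ = ξ.2 + christoffel h q.1 ξ.1 q.2 := by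
  simp [connectionOf]

theorem omegaOf_apply (q ξ η : Plane × Plane) :
    omegaOf h q ξ η = h q.1 (connectionOf h q ξ) η.1 - h q.1 ξ.1 (connectionOf h q η) := by
  simp [omegaOf]

theorem complexOf_fst (q ξ : Plane × Plane) : (complexOf h J q ξ).1 = J q.1 ξ.1 := by
  simp [complexOf]

theorem connectionOf_complexOf (q ξ : Plane × Plane) :
    connectionOf h q (complexOf h J q ξ) = J q.1 (connectionOf h q ξ) := by
  rw [connectionOf_apply, complexOf_fst]
  simp [complexOf]

theorem neutralOf_apply' (q ξ η : Plane × Plane) :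
    neutralOf h J q ξ η = h q.1 (J q.1 (connectionOf h q ξ)) η.1 -
      h q.1 (J q.1 ξ.1) (connectionOf h q η) := by
  rw [← connectionOf_complexOf, ← complexOf_fst (h := h), ← omegaOf_apply]
  rfl

theorem complexOf_vertical (q : Plane × Plane) (b : Plane) :
    complexOf h J q (0, b) = (0, J q.1 b) := by
  ext1
  · simp [complexOf]
  · simp [complexOf, connectionOf]

namespace KaehlerChart

variable (C : KaehlerChart T h J)
include C

theorem nondegenerate {x : Plane} (hx : x ∈ T) : Nondegenerate (h x) := by
  intro u hu
  by_contra hne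
  exact (C.pos x hx u hne).ne' (hu u)

theorem symm_eventually {x : Plane} (hx : x ∈ T) : ∀ᶠ y in nhds x, ∀ u v, h y u v = h y v u :=
  (C.isOpen.eventually_mem hx).mono fun y hy => C.symm y hy

theorem metric_rot_rot {x : Plane} (hx : x ∈ T) (u v : Plane) :
    h x (J x u) (J x v) = h x u v := by
  rw [C.rot_skew x hx, C.rot_rot x hx, map_neg, neg_neg]

theorem metric_rot_self {x : Plane} (hx : x ∈ T) (u : Plane) : h x (J x u) u = 0 := by
  have := C.rot_skew x hx u u
  rw [C.symm x hx u] at this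
  linarith

theorem metric_self_rot {x : Plane} (hx : x ∈ T) (u : Plane) : h x u (J x u) = 0 := by
  rw [C.symm x hx, C.metric_rot_self hx]

/-- Otherwise v, Jv, w would be three nonzero mutually orthogonal vectors in a plane. -/
theorem eq_zero_of_orthogonal {x : Plane} (hx : x ∈ T) {v w : Plane} (hv : v ≠ 0)
    (h1 : h x w v = 0) (h2 : h x w (J x v) = 0) : w = 0 := by
  by_contra hw
  have hli : LinearIndependent ℝ ![v, J x v, w] := by
    rw [Fintype.linearIndependent_iff]
    intro g hg
    simp only [Fin.sum_univ_three, Matrix.cons_val_zero, Matrix.cons_val_one,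
      Matrix.cons_val_two, Matrix.tail_cons, Matrix.head_cons] at hg
    have h1' := h1
    rw [C.symm x hx] at h1'
    have h2' := h2
    rw [C.symm x hx] at h2'
    have a0 : g 0 * h x v v = 0 := by
      simpa [C.metric_rot_self hx, h1] using congrArg (fun a => h x a v) hg
    have a1 : g 1 * h x v v = 0 := by
      simpa [C.metric_self_rot hx, C.metric_rot_rot hx, h2] using
        congrArg (fun a => h x a (J x v)) hg
    have a2 : g 2 * h x w w = 0 := by
      simpa [h1', h2'] using congrArg (fun a => h x a w) hg
    have p1 := (C.pos x hx v hv).ne'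
    have p2 := (C.pos x hx w hw).ne'
    intro i
    fin_cases i
    · simpa [p1] using a0
    · simpa [p1] using a1
    · simpa [p2] using a2
  have := hli.fintype_card_le_finrank
  simp at this

theorem expand {x : Plane} (hx : x ∈ T) {v : Plane} (hv : h x v v = 1) (w : Plane) :
    w = h x w v • v + h x w (J x v) • J x v := by
  have hv0 : v ≠ 0 := by rintro rfl; simp at hv
  rw [← sub_eq_zero]
  apply C.eq_zero_of_orthogonal hx hv0
  · simp [hv, C.metric_rot_self hx]
  · simp [hv, C.metric_self_rot hx, C.metric_rot_rot hx]

/-- The complex structure is parallel. -/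
theorem parallel {x : Plane} (hx : x ∈ T) (u v : Plane) :
    fderiv ℝ J x u v = J x (christoffel h x u v) - christoffel h x u (J x v) := by
  have hJ : DifferentiableAt ℝ J x := (C.smooth_rot x hx).differentiableAt (by simp)
  have hh : DifferentiableAt ℝ h x := (C.smooth_metric x hx).differentiableAt (by simp)
  have hJv (v : Plane) : HasFDerivAt (fun y => J y v) ((fderiv ℝ J x).flip v) x :=
    hasFDerivAt_clm_const hJ v
  have hev : ∀ᶠ y in nhds x, y ∈ T := C.isOpen.eventually_mem hx
  have hsq (v : Plane) : fderiv ℝ J x u (J x v) + J x (fderiv ℝ J x u v) = 0 := by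
    have e1 := (hJ.hasFDerivAt.clm_apply (hJv v)).fderiv
    rw [Filter.EventuallyEq.fderiv_eq (hev.mono fun y hy => C.rot_rot y hy v)] at e1
    have := congrArg (fun l : Plane →L[ℝ] Plane => l u) e1
    simp at this
    rw [add_comm]; exact this.symm
  have hskew (v w : Plane) : fderiv ℝ h x u (J x v) w + h x (fderiv ℝ J x u v) w +
      (fderiv ℝ h x u v (J x w) + h x v (fderiv ℝ J x u w)) = 0 := by
    have e1 := (hh.hasFDerivAt.clm_apply (hJv v)).clm_apply (hasFDerivAt_const w x)
    have e2 := (hh.hasFDerivAt.clm_apply (hasFDerivAt_const v x)).clm_apply (hJv w)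
    have e3 := (e1.add e2).fderiv
    have : ((fun y => h y (J y v) w) + fun y => h y v (J y w)) =ᶠ[nhds x] fun _ => 0 :=
      hev.mono fun y hy => by simp [C.rot_skew y hy]
    rw [this.fderiv_eq] at e3
    have := congrArg (fun l : Plane →L[ℝ] ℝ => l u) e3
    simp at this
    linarith
  -- N is ∇_u J. It is skew because J is skew and h is parallel, and it anticommutes with J because
  -- J² = -1. In dimension two this forces N = 0: N v is orthogonal to v by skewness, and h(Nv, Jv)
  -- equals its own negative.
  set N : Plane → Plane := fun v =>
    fderiv ℝ J x u v - (J x (christoffel h x u v) - christoffel h x u (J x v)) with hN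
  have hNskew (v w : Plane) : h x (N v) w + h x v (N w) = 0 := by
    have e := hskew v w
    rw [fderiv_metric (C.nondegenerate hx) hh (C.symm_eventually hx),
      fderiv_metric (C.nondegenerate hx) hh (C.symm_eventually hx)] at e
    have e1 := C.rot_skew x hx (christoffel h x u v) w
    have e2 := C.rot_skew x hx v (christoffel h x u w)
    simp only [hN, map_sub, sub_apply]
    linarith
  have hNJ (v : Plane) : N (J x v) + J x (N v) = 0 := by
    have e := hsq v
    simp only [hN, map_sub, C.rot_rot x hx, map_neg]
    rw [← e]; abel
  rw [← sub_eq_zero]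
  change N v = 0
  rcases eq_or_ne v 0 with rfl | hv
  · simp [hN]
  · have e1 := hNskew v v
    rw [C.symm x hx v] at e1
    have e2 := hNskew v (J x v)
    have e3 := congrArg (fun a => h x v a) (hNJ v)
    have e4 := C.rot_skew x hx v (N v)
    rw [C.symm x hx (J x v)] at e4
    simp at e3
    exact C.eq_zero_of_orthogonal hx hv (by linarith) (by linarith)

/-- The derivative of the area form. -/
theorem hasFDerivAt_areaForm {x : Plane} (hx : x ∈ T) (a b : Plane) :
    ∃ D : Plane →L[ℝ] ℝ, HasFDerivAt (fun y => h y (J y a) b) D x ∧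
      ∀ u, D u = h x (J x (christoffel h x u a)) b + h x (J x a) (christoffel h x u b) := by
  have hJ : DifferentiableAt ℝ J x := (C.smooth_rot x hx).differentiableAt (by simp)
  have hh : DifferentiableAt ℝ h x := (C.smooth_metric x hx).differentiableAt (by simp)
  refine ⟨_, ((hh.hasFDerivAt.clm_apply
    (hJ.hasFDerivAt.clm_apply (hasFDerivAt_const a x))).clm_apply (hasFDerivAt_const b x)), ?_⟩
  intro u
  simp [fderiv_metric (C.nondegenerate hx) hh (C.symm_eventually hx), C.parallel hx]
  ring

/-- With ω = h(J·, ·) the neutral metric is the symmetrization of ω(Kξ, Pη). In this form its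
symmetry is visible, and so is the fact that vertical vectors are null. -/
theorem neutralOf_apply {q : Plane × Plane} (hq : q.1 ∈ T) (ξ η : Plane × Plane) :
    neutralOf h J q ξ η = h q.1 (J q.1 (connectionOf h q ξ)) η.1 +
      h q.1 (J q.1 (connectionOf h q η)) ξ.1 := by
  rw [neutralOf_apply', C.rot_skew q.1 hq ξ.1, C.symm q.1 hq ξ.1]
  ring

theorem neutralOf_symm {q : Plane × Plane} (hq : q.1 ∈ T) (ξ η : Plane × Plane) :
    neutralOf h J q ξ η = neutralOf h J q η ξ := by
  rw [C.neutralOf_apply hq, C.neutralOf_apply hq, add_comm]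

/-- The right-hand side does not involve the fibre coordinate of q. This is what makes the vertical
part of the connection computable. -/
theorem neutralOf_vertical {q : Plane × Plane} (hq : q.1 ∈ T) (b : Plane) (η : Plane × Plane) :
    neutralOf h J q (0, b) η = h q.1 (J q.1 b) η.1 := by
  rw [C.neutralOf_apply hq]
  simp [connectionOf_apply]

theorem neutralOf_nondegenerate {q : Plane × Plane} (hq : q.1 ∈ T) :
    Nondegenerate (neutralOf h J q) := by
  rintro ⟨a, b⟩ H
  have h1 : a = 0 := by
    apply C.nondegenerate hq
    intro w
    have := H (0, -J q.1 w)
    rw [C.neutralOf_symm hq, C.neutralOf_vertical hq] at this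
    simpa [C.rot_rot q.1 hq, C.symm q.1 hq w] using this
  subst h1
  have h2 : b = 0 := by
    apply C.nondegenerate hq
    intro w
    have := H (J q.1 w, 0)
    rw [C.neutralOf_vertical hq] at this
    simpa [C.metric_rot_rot hq] using this
  rw [h2]; rfl

theorem contDiffAt_christoffel {x : Plane} (hx : x ∈ T) : ContDiffAt ℝ ∞ (christoffel h) x :=
  TangentSurface.contDiffAt_christoffel (C.nondegenerate hx) (C.smooth_metric x hx)

theorem contDiffAt_neutralOf {q : Plane × Plane} (hq : q.1 ∈ T) :
    ContDiffAt ℝ ∞ (neutralOf h J) q := by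
  have hΓ : ContDiffAt ℝ ∞ (fun p : Plane × Plane => christoffel h p.1) q :=
    (C.contDiffAt_christoffel hq).comp q contDiffAt_fst
  have hh : ContDiffAt ℝ ∞ (fun p : Plane × Plane => h p.1) q :=
    (C.smooth_metric _ hq).comp q contDiffAt_fst
  have hJ : ContDiffAt ℝ ∞ (fun p : Plane × Plane => J p.1) q :=
    (C.smooth_rot _ hq).comp q contDiffAt_fst
  refine contDiffAt_clm₂ fun u v => ?_
  simp only [neutralOf_apply', connectionOf_apply]
  have hK (u : Plane × Plane) :
      ContDiffAt ℝ ∞ (fun p : Plane × Plane => u.2 + christoffel h p.1 u.1 p.2) q :=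
    contDiffAt_const.add ((hΓ.clm_apply contDiffAt_const).clm_apply contDiffAt_snd)
  exact ((hh.clm_apply (hJ.clm_apply (hK u))).clm_apply contDiffAt_const).sub
    ((hh.clm_apply (hJ.clm_apply contDiffAt_const)).clm_apply (hK v))

theorem neutralOf_symm_eventually {q : Plane × Plane} (hq : q.1 ∈ T) :
    ∀ᶠ p in nhds q, ∀ ξ η, neutralOf h J p ξ η = neutralOf h J p η ξ :=
  ((C.isOpen.preimage continuous_fst).eventually_mem hq).mono fun _ hp => C.neutralOf_symm hp

/-- Two of the three derivatives in Koszul's formula concern pairings with the vertical vector (0,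
b). They are derivatives of the parallel form ω on the base, and their Γ(ξ, ζ) terms cancel by
symmetry of Γ. The third is a derivative in the fibre direction. -/
theorem christoffelFirst_vertical {q : Plane × Plane} (hq : q.1 ∈ T) (ξ ζ : Plane × Plane)
    (b : Plane) : christoffelFirst (neutralOf h J) q ξ (0, b) ζ =
      h q.1 (J q.1 (christoffel h q.1 ξ.1 b)) ζ.1 := by
  have hG : DifferentiableAt ℝ (neutralOf h J) q :=
    (C.contDiffAt_neutralOf hq).differentiableAt (by simp)
  have hev : ∀ᶠ p : Plane × Plane in nhds q, p.1 ∈ T :=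
    (C.isOpen.preimage continuous_fst).eventually_mem hq
  have h1 (ξ ζ : Plane × Plane) : fderiv ℝ (neutralOf h J) q ξ (0, b) ζ =
      h q.1 (J q.1 (christoffel h q.1 ξ.1 b)) ζ.1 +
        h q.1 (J q.1 b) (christoffel h q.1 ξ.1 ζ.1) := by
    rw [fderiv_apply₂ hG, Filter.EventuallyEq.fderiv_eq
      (hev.mono fun p hp => C.neutralOf_vertical hp b ζ)]
    obtain ⟨D, hD, hD'⟩ := C.hasFDerivAt_areaForm hq b ζ.1
    have e1 : HasFDerivAt (fun p : Plane × Plane => h p.1 (J p.1 b) ζ.1)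
        (D ∘L ContinuousLinearMap.fst ℝ Plane Plane) q := hD.comp q hasFDerivAt_fst
    rw [e1.fderiv]
    simp [hD']
  have h2 : fderiv ℝ (neutralOf h J) q (0, b) ξ ζ =
      h q.1 (J q.1 (christoffel h q.1 ξ.1 b)) ζ.1 +
        h q.1 (J q.1 (christoffel h q.1 ζ.1 b)) ξ.1 := by
    rw [fderiv_apply₂ hG]
    have hd : DifferentiableAt ℝ (fun p => neutralOf h J p ξ ζ) q :=
      (hG.clm_apply (differentiableAt_const ξ)).clm_apply (differentiableAt_const ζ)
    have e1 := hd.hasFDerivAt.hasLineDerivAt (0, b)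
    refine e1.unique ?_
    -- The fibre coordinate enters only through K, linearly, so the metric coefficient is affine
    -- along a vertical line.
    have : (fun t : ℝ => neutralOf h J (q + t • ((0 : Plane), b)) ξ ζ) = fun t =>
        neutralOf h J q ξ ζ + t * (h q.1 (J q.1 (christoffel h q.1 ξ.1 b)) ζ.1 +
        h q.1 (J q.1 (christoffel h q.1 ζ.1 b)) ξ.1) := by
      funext t
      rw [C.neutralOf_apply hq, C.neutralOf_apply (by simpa using hq)]
      simp [connectionOf_apply]
      ring
    unfold HasLineDerivAt
    rw [this]
    exact (((hasDerivAt_id (0 : ℝ)).mul_const _).const_add _).congr_deriv (one_mul _)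
  rw [christoffelFirst_apply, h1, h2, fderiv_symm hG (C.neutralOf_symm_eventually hq), h1,
    christoffel_symm ((C.smooth_metric _ hq).differentiableAt (by simp)) (C.symm_eventually hq)
      ζ.1 ξ.1]
  ring

/-- The vertical covariant derivatives of the neutral metric. -/
theorem christoffel_vertical {q : Plane × Plane} (hq : q.1 ∈ T) (ξ : Plane × Plane)
    (b : Plane) : christoffel (neutralOf h J) q ξ (0, b) = (0, christoffel h q.1 ξ.1 b) := by
  refine christoffel_eq (C.neutralOf_nondegenerate hq) fun ζ => ?_
  rw [C.neutralOf_vertical hq, C.christoffelFirst_vertical hq]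

end KaehlerChart


variable {T : Set Plane} {h : Plane → Plane →L[ℝ] Plane →L[ℝ] ℝ} {J : Plane → Plane →L[ℝ] Plane}

/-! ### Unit speed curves -/

/-- The acceleration `∇_{c'} c'` of a curve. -/
noncomputable def acceleration (h : Plane → Plane →L[ℝ] Plane →L[ℝ] ℝ) (c : ℝ → Plane) (s : ℝ) :
    Plane :=
  deriv (deriv c) s + christoffel h (c s) (deriv c s) (deriv c s)

/-- The curvature of a unit speed curve. -/
noncomputable def curveCurvature (h : Plane → Plane →L[ℝ] Plane →L[ℝ] ℝ)
    (J : Plane → Plane →L[ℝ] Plane) (c : ℝ → Plane) (s : ℝ) : ℝ :=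
  h (c s) (acceleration h c s) (J (c s) (deriv c s))

/-- A smooth unit speed curve in a coordinate domain. -/
structure UnitSpeedCurve (T : Set Plane) (h : Plane → Plane →L[ℝ] Plane →L[ℝ] ℝ) (I : Set ℝ)
    (c : ℝ → Plane) : Prop where
  isOpen : IsOpen I
  smooth : ∀ s ∈ I, ContDiffAt ℝ ∞ c s
  mem : ∀ s ∈ I, c s ∈ T
  unit : ∀ s ∈ I, h (c s) (deriv c s) (deriv c s) = 1

theorem contDiffAt_deriv {E : Type*} [NormedAddCommGroup E] [NormedSpace ℝ E] {c : ℝ → E} {s : ℝ}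
    (hc : ContDiffAt ℝ ∞ c s) : ContDiffAt ℝ ∞ (deriv c) s := by
  have : ContDiffAt ℝ ∞ (fun r => fderiv ℝ c r 1) s :=
    (hc.fderiv_right (m := ∞) (by simp)).clm_apply contDiffAt_const
  simpa [fderiv_apply_one_eq_deriv] using this

theorem hasDerivAt_of_smooth {E : Type*} [NormedAddCommGroup E] [NormedSpace ℝ E] {c : ℝ → E}
    {s : ℝ} (hc : ContDiffAt ℝ ∞ c s) : HasDerivAt c (deriv c s) s :=
  (hc.differentiableAt (by simp)).hasDerivAt

namespace UnitSpeedCurve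

variable {I : Set ℝ} {c : ℝ → Plane} (U : UnitSpeedCurve T h I c) (C : KaehlerChart T h J)
include U C

theorem acceleration_orthogonal {s : ℝ} (hs : s ∈ I) :
    h (c s) (acceleration h c s) (deriv c s) = 0 := by
  have hT := U.mem s hs
  have hh : DifferentiableAt ℝ h (c s) := (C.smooth_metric _ hT).differentiableAt (by simp)
  have d1 := hasDerivAt_of_smooth (U.smooth s hs)
  have d2 := hasDerivAt_of_smooth (contDiffAt_deriv (U.smooth s hs))
  have e := ((hh.hasFDerivAt.comp_hasDerivAt s d1).clm_apply d2).clm_apply d2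
  have ev : (fun r => (h ∘ c) r (deriv c r) (deriv c r)) =ᶠ[nhds s] fun _ => (1 : ℝ) :=
    (U.isOpen.eventually_mem hs).mono fun r hr => U.unit r hr
  have e' := (e.congr_of_eventuallyEq ev.symm).unique (hasDerivAt_const s (1 : ℝ))
  simp [fderiv_metric (C.nondegenerate hT) hh (C.symm_eventually hT)] at e'
  rw [C.symm _ hT (deriv c s), C.symm _ hT (deriv c s)] at e'
  simp [acceleration]
  linarith

theorem acceleration_eq {s : ℝ} (hs : s ∈ I) :
    acceleration h c s = curveCurvature h J c s • J (c s) (deriv c s) := by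
  have := C.expand (U.mem s hs) (U.unit s hs) (acceleration h c s)
  rwa [U.acceleration_orthogonal C hs, zero_smul, zero_add] at this

theorem smooth_curveCurvature {s : ℝ} (hs : s ∈ I) : ContDiffAt ℝ ∞ (curveCurvature h J c) s := by
  have hT := U.mem s hs
  have d := contDiffAt_deriv (U.smooth s hs)
  have hh : ContDiffAt ℝ ∞ (fun r => h (c r)) s := (C.smooth_metric _ hT).comp s (U.smooth s hs)
  have hJ : ContDiffAt ℝ ∞ (fun r => J (c r)) s := (C.smooth_rot _ hT).comp s (U.smooth s hs)
  have hΓ : ContDiffAt ℝ ∞ (fun r => christoffel h (c r)) s :=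
    (C.contDiffAt_christoffel hT).comp s (U.smooth s hs)
  exact (hh.clm_apply ((contDiffAt_deriv d).add ((hΓ.clm_apply d).clm_apply d))).clm_apply
    (hJ.clm_apply d)

theorem smooth_normal {s : ℝ} (hs : s ∈ I) :
    ContDiffAt ℝ ∞ (fun r => J (c r) (deriv c r)) s :=
  ContDiffAt.clm_apply ((C.smooth_rot _ (U.mem s hs)).comp s (U.smooth s hs))
    (contDiffAt_deriv (U.smooth s hs))

/-- Frenet's equation: J is parallel, so ∇n = J(∇c') = J(κ J c') = -κ c'. The Christoffel term
converts ∇n into the ordinary derivative. -/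
theorem deriv_normal {s : ℝ} (hs : s ∈ I) :
    deriv (fun r => J (c r) (deriv c r)) s = -(curveCurvature h J c s • deriv c s) -
      christoffel h (c s) (deriv c s) (J (c s) (deriv c s)) := by
  have hT := U.mem s hs
  have hJ : DifferentiableAt ℝ J (c s) := (C.smooth_rot _ hT).differentiableAt (by simp)
  have d1 := hasDerivAt_of_smooth (U.smooth s hs)
  have d2 := hasDerivAt_of_smooth (contDiffAt_deriv (U.smooth s hs))
  have e := ((hJ.hasFDerivAt.comp_hasDerivAt s d1).clm_apply d2).deriv
  have e2 := congrArg (J (c s)) (U.acceleration_eq C hs)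
  rw [map_smul, C.rot_rot _ hT, acceleration, map_add] at e2
  simp only [Function.comp_apply] at e
  rw [e, C.parallel hT, ← smul_neg, ← e2]
  abel

end UnitSpeedCurve

/-! ### Affine normal bundles in coordinates -/

/-- The surface `f` is `(c(σ), a(σ) c'(σ) + τ J c'(σ))` on `N`, with coordinates `σ`, `τ`. -/
structure AffineNormalForm (T : Set Plane) (h : Plane → Plane →L[ℝ] Plane →L[ℝ] ℝ)
    (J : Plane → Plane →L[ℝ] Plane) (f : Plane → Plane × Plane) (N : Set Plane) (s₀ s₁ : ℝ)
    (σ τ : Plane → ℝ) (c : ℝ → Plane) (a : ℝ → ℝ) : Prop where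
  isOpen : IsOpen N
  curve : UnitSpeedCurve T h (Ioo s₀ s₁) c
  maps_to : ∀ z ∈ N, σ z ∈ Ioo s₀ s₁
  smooth_fst : ∀ z ∈ N, ContDiffAt ℝ ∞ σ z
  smooth_snd : ∀ z ∈ N, ContDiffAt ℝ ∞ τ z
  smooth_coeff : ∀ s ∈ Ioo s₀ s₁, ContDiffAt ℝ ∞ a s
  indep : ∀ z ∈ N, fderiv ℝ σ z (e 0) * fderiv ℝ τ z (e 1) -
    fderiv ℝ σ z (e 1) * fderiv ℝ τ z (e 0) ≠ 0
  eq : ∀ z ∈ N, f z = (c (σ z), a (σ z) • deriv c (σ z) + τ z • J (c (σ z)) (deriv c (σ z)))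

/-- Coordinates `σ`, `v` in which the metric induced on the surface `f` is `-2 dσ dv`, together
with the unit vector `t` tangent to the base curve, its curvature `k` and the vector `P = ∂f/∂σ`. -/
structure NullCoordinates (T : Set Plane) (h : Plane → Plane →L[ℝ] Plane →L[ℝ] ℝ)
    (J : Plane → Plane →L[ℝ] Plane) (f : Plane → Plane × Plane) (N : Set Plane)
    (σ v k : Plane → ℝ) (t : Plane → Plane) (P : Plane → Plane × Plane) : Prop where
  isOpen : IsOpen N
  mem : ∀ z ∈ N, (f z).1 ∈ T
  smooth : ∀ z ∈ N, ContDiffAt ℝ ∞ f z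
  smooth_fst : ∀ z ∈ N, ContDiffAt ℝ ∞ σ z
  smooth_snd : ∀ z ∈ N, ContDiffAt ℝ ∞ v z
  smooth_curvature : ∀ z ∈ N, ContDiffAt ℝ ∞ k z
  smooth_tangent : ∀ z ∈ N, ContDiffAt ℝ ∞ t z
  smooth_vector : ∀ z ∈ N, ContDiffAt ℝ ∞ P z
  indep : ∀ z ∈ N, fderiv ℝ σ z (e 0) * fderiv ℝ v z (e 1) -
    fderiv ℝ σ z (e 1) * fderiv ℝ v z (e 0) ≠ 0
  unit : ∀ z ∈ N, h (f z).1 (t z) (t z) = 1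
  fderiv_eq : ∀ z ∈ N, ∀ u, fderiv ℝ f z u =
    fderiv ℝ σ z u • P z + fderiv ℝ v z u • ((0 : Plane), J (f z).1 (t z))
  vector_fst : ∀ z ∈ N, (P z).1 = t z
  vector_connection : ∀ z ∈ N, ∃ r : ℝ, connectionOf h (f z) (P z) = r • t z
  fderiv_curvature : ∀ z ∈ N, ∃ r : ℝ, fderiv ℝ k z = r • fderiv ℝ σ z
  fderiv_normal : ∀ z ∈ N, ∀ u, fderiv ℝ (fun y => J (f y).1 (t y)) z u = fderiv ℝ σ z u •
    (-(k z • t z) - christoffel h (f z).1 (t z) (J (f z).1 (t z)))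

/-- The Poincaré lemma for the one-form k ds, whose closedness is automatic on a line. -/
theorem exists_primitive {s₀ s₁ : ℝ} {k : ℝ → ℝ} (hk : ∀ s ∈ Ioo s₀ s₁, DifferentiableAt ℝ k s) :
    ∃ b : ℝ → ℝ, ∀ s ∈ Ioo s₀ s₁, HasDerivAt b (k s) s := by
  have hw : DifferentiableOn ℝ (fun s => (1 : ℝ →L[ℝ] ℝ).smulRight (k s)) (Ioo s₀ s₁) := by
    intro s hs
    have := hk s hs
    exact DifferentiableAt.differentiableWithinAt (by fun_prop)
  obtain ⟨b, hb⟩ := (convex_Ioo s₀ s₁).exists_forall_hasFDerivAt_of_fderiv_symmetric isOpen_Ioo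
    hw (fun s _ x y => by
      have key (x y : ℝ) : (fderiv ℝ (fun s => (1 : ℝ →L[ℝ] ℝ).smulRight (k s)) s x) y =
          x * y * (fderiv ℝ (fun s => (1 : ℝ →L[ℝ] ℝ).smulRight (k s)) s 1) 1 := by
        conv_lhs => rw [← mul_one x, ← mul_one y, ← smul_eq_mul, ← smul_eq_mul, map_smul, map_smul]
        simp
        ring
      rw [key, key y]; ring)
  exact ⟨b, fun s hs => by simpa using (hb s hs).hasDerivAt⟩

theorem hasFDerivAt_comp_curve {V E : Type*} [NormedAddCommGroup V] [NormedSpace ℝ V]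
    [NormedAddCommGroup E] [NormedSpace ℝ E] {g : ℝ → E} {g' : E} {σ : V → ℝ} {l : V →L[ℝ] ℝ}
    {z : V} (hg : HasDerivAt g g' (σ z)) (hσ : HasFDerivAt σ l z) :
    HasFDerivAt (fun y => g (σ y)) (l.smulRight g') z := by
  refine (hg.hasFDerivAt.comp z hσ).congr_fderiv ?_
  ext; simp

/-- The induced metric is -2 dσ (dτ + aκ dσ). The form in brackets is closed, because a and κ are
functions of σ, and its primitive is the second null coordinate. -/
theorem AffineNormalForm.exists_nullCoordinates {f : Plane → Plane × Plane} {N : Set Plane}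
    {s₀ s₁ : ℝ} {σ τ : Plane → ℝ} {c : ℝ → Plane} {a : ℝ → ℝ} (C : KaehlerChart T h J)
    (A : AffineNormalForm T h J f N s₀ s₁ σ τ c a) :
    ∃ (v : Plane → ℝ) (P : Plane → Plane × Plane),
      NullCoordinates T h J f N σ v (fun z => curveCurvature h J c (σ z))
        (fun z => deriv c (σ z)) P := by
  have U := A.curve
  set κ := curveCurvature h J c with hκ
  set n : ℝ → Plane := fun r => J (c r) (deriv c r) with hn
  have sκ {s} (hs : s ∈ Ioo s₀ s₁) : ContDiffAt ℝ ∞ κ s := U.smooth_curveCurvature C hs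
  have sn {s} (hs : s ∈ Ioo s₀ s₁) : ContDiffAt ℝ ∞ n s := U.smooth_normal C hs
  have sc {s} (hs : s ∈ Ioo s₀ s₁) : ContDiffAt ℝ ∞ (deriv c) s := contDiffAt_deriv (U.smooth s hs)
  have sa {s} (hs : s ∈ Ioo s₀ s₁) : ContDiffAt ℝ ∞ a s := A.smooth_coeff s hs
  obtain ⟨b, hb⟩ := exists_primitive (s₀ := s₀) (s₁ := s₁) (k := fun s => a s * κ s) fun s hs =>
    ((sa hs).mul (sκ hs)).differentiableAt (by simp)
  have sb {s} (hs : s ∈ Ioo s₀ s₁) : ContDiffAt ℝ ∞ b s := by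
    have : ContDiffOn ℝ ∞ b (Ioo s₀ s₁) := by
      rw [contDiffOn_infty_iff_deriv_of_isOpen isOpen_Ioo]
      refine ⟨fun s hs => (hb s hs).differentiableAt.differentiableWithinAt, fun s hs => ?_⟩
      refine ContDiffWithinAt.congr (f := fun s => a s * κ s) ?_ (fun r hr => (hb r hr).deriv)
        (hb s hs).deriv
      exact ((sa hs).mul (sκ hs)).contDiffWithinAt
    exact this.contDiffAt (isOpen_Ioo.mem_nhds hs)
  have eqn : ∀ z ∈ N, ∀ᶠ y in nhds z, y ∈ N := fun z hz => A.isOpen.eventually_mem hz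
  have hfst : ∀ z ∈ N, (f z).1 = c (σ z) := fun z hz => by rw [A.eq z hz]
  have dσ : ∀ z ∈ N, HasFDerivAt σ (fderiv ℝ σ z) z := fun z hz =>
    ((A.smooth_fst z hz).differentiableAt (by simp)).hasFDerivAt
  have dτ : ∀ z ∈ N, HasFDerivAt τ (fderiv ℝ τ z) z := fun z hz =>
    ((A.smooth_snd z hz).differentiableAt (by simp)).hasFDerivAt
  have dv : ∀ z ∈ N, HasFDerivAt (fun z => τ z + b (σ z))
      (fderiv ℝ τ z + (a (σ z) * κ (σ z)) • fderiv ℝ σ z) z := fun z hz =>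
    (dτ z hz).add ((hb _ (A.maps_to z hz)).comp_hasFDerivAt z (dσ z hz))
  have hnormal : ∀ z ∈ N, (fun y => J (f y).1 (deriv c (σ y))) =ᶠ[nhds z] fun y => n (σ y) :=
    fun z hz => (eqn z hz).mono fun y hy => by simp [hn, hfst y hy]
  -- P is the derivative of f in σ at constant v = τ + b(σ). Fixing v instead of τ gives τ the
  -- derivative -aκ, whence the term in n.
  let P : Plane → Plane × Plane := fun z => (deriv c (σ z), deriv a (σ z) • deriv c (σ z) +
    a (σ z) • deriv (deriv c) (σ z) - (a (σ z) * κ (σ z)) • n (σ z) + τ z • deriv n (σ z))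
  have hf : ∀ z ∈ N, HasFDerivAt f ((fderiv ℝ σ z).smulRight (P z) +
      (fderiv ℝ τ z + (a (σ z) * κ (σ z)) • fderiv ℝ σ z).smulRight ((0 : Plane), n (σ z))) z := by
    intro z hz
    have hs := A.maps_to z hz
    have e1 := hasFDerivAt_comp_curve (hasDerivAt_of_smooth (U.smooth _ hs)) (dσ z hz)
    have e2 := hasFDerivAt_comp_curve (hasDerivAt_of_smooth (sc hs)) (dσ z hz)
    have e3 := hasFDerivAt_comp_curve (hasDerivAt_of_smooth (sa hs)) (dσ z hz)
    have e4 := hasFDerivAt_comp_curve (hasDerivAt_of_smooth (sn hs)) (dσ z hz)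
    have e5 := (e1.prodMk ((e3.smul e2).add ((dτ z hz).smul e4))).congr_of_eventuallyEq
      (f₁ := f) ((eqn z hz).mono fun y hy => A.eq y hy)
    refine e5.congr_fderiv ?_
    ext1 u
    refine Prod.ext ?_ ?_
    · simp [P]
    · simp [P]
      module
  have sσ {E : Type} [NormedAddCommGroup E] [NormedSpace ℝ E] {g : ℝ → E}
      (hg : ∀ s ∈ Ioo s₀ s₁, ContDiffAt ℝ ∞ g s) : ∀ z ∈ N, ContDiffAt ℝ ∞ (fun y => g (σ y)) z :=
    fun z hz => (hg _ (A.maps_to z hz)).comp z (A.smooth_fst z hz)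
  refine ⟨fun z => τ z + b (σ z), P, ?_⟩
  constructor
  · exact A.isOpen
  · intro z hz
    rw [hfst z hz]; exact U.mem _ (A.maps_to z hz)
  · intro z hz
    refine ContDiffAt.congr_of_eventuallyEq ?_ ((eqn z hz).mono fun y hy => A.eq y hy)
    exact (sσ U.smooth z hz).prodMk (((sσ (fun _ => sa) z hz).smul (sσ (fun _ => sc) z hz)).add
      ((A.smooth_snd z hz).smul (sσ (fun _ => sn) z hz)))
  · exact A.smooth_fst
  · exact fun z hz => (A.smooth_snd z hz).add (sσ (fun _ => sb) z hz)
  · exact sσ (fun _ => sκ)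
  · exact sσ (fun _ => sc)
  · intro z hz
    have h1 := sσ (fun _ => sc) z hz
    have h2 := sσ (fun _ => sn) z hz
    have h3 := sσ (fun _ => sa) z hz
    have h4 := sσ (fun _ => sκ) z hz
    have h5 := sσ (fun _ h => contDiffAt_deriv (sc h)) z hz
    have h6 := sσ (fun _ h => contDiffAt_deriv (sa h)) z hz
    have h7 := sσ (fun _ h => contDiffAt_deriv (sn h)) z hz
    exact h1.prodMk ((((h6.smul h1).add (h3.smul h5)).sub ((h3.mul h4).smul h2)).add
      ((A.smooth_snd z hz).smul h7))
  · intro z hz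
    rw [(dv z hz).fderiv]
    convert A.indep z hz using 1
    simp
    ring
  · intro z hz
    rw [hfst z hz]; exact U.unit _ (A.maps_to z hz)
  · intro z hz u
    rw [(hf z hz).fderiv, (dv z hz).fderiv, hfst z hz]
    simp [hn]
  · intro z hz; rfl
  · intro z hz
    have hs := A.maps_to z hz
    -- The normal part of K(∂f/∂σ), with τ fixed, is aκ n; it is removed by the -aκ n in P. The
    -- tangential part is a' from the coefficient a and -τκ from Frenet's equation.
    refine ⟨deriv a (σ z) - τ z * κ (σ z), ?_⟩
    have e1 := U.acceleration_eq C hs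
    have e2 : deriv n (σ z) = _ := U.deriv_normal C hs
    rw [connectionOf_apply, hfst z hz, show (f z).2 = _ from congrArg Prod.snd (A.eq z hz)]
    rw [acceleration, ← eq_sub_iff_add_eq] at e1
    simp only [P, e1, e2, map_add, map_smul]
    simp only [hn, hκ]
    module
  · intro z hz
    have := hasFDerivAt_comp_curve (hasDerivAt_of_smooth (sκ (A.maps_to z hz))) (dσ z hz)
    exact ⟨deriv κ (σ z), this.fderiv.trans (by ext; simp [mul_comm])⟩
  · intro z hz u
    have := hasFDerivAt_comp_curve (hasDerivAt_of_smooth (sn (A.maps_to z hz))) (dσ z hz)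
    have e2 : deriv n (σ z) = _ := U.deriv_normal C (A.maps_to z hz)
    rw [(hnormal z hz).fderiv_eq, show fderiv ℝ (fun y => n (σ y)) z = _ from this.fderiv, hfst z hz]
    simp [e2, hκ]


variable {T : Set Plane} {h : Plane → Plane →L[ℝ] Plane →L[ℝ] ℝ} {J : Plane → Plane →L[ℝ] Plane}

/-! ### Pairs of independent functionals on the plane -/

theorem plane_eq (u : Plane) : u = u 0 • e 0 + u 1 • e 1 := by
  ext i
  fin_cases i <;> simp [e]

/-- The determinant of two functionals. -/
noncomputable def coframeDet (l m : Plane →L[ℝ] ℝ) : ℝ := l (e 0) * m (e 1) - l (e 1) * m (e 0)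

/-- The first vector of the basis dual to `l`, `m`. -/
noncomputable def dualFst (l m : Plane →L[ℝ] ℝ) : Plane :=
  (coframeDet l m)⁻¹ • (m (e 1) • e 0 - m (e 0) • e 1)

/-- The second vector of the basis dual to `l`, `m`. -/
noncomputable def dualSnd (l m : Plane →L[ℝ] ℝ) : Plane :=
  (coframeDet l m)⁻¹ • (l (e 0) • e 1 - l (e 1) • e 0)

section Coframe

variable {l m : Plane →L[ℝ] ℝ} (hD : coframeDet l m ≠ 0)
include hD

theorem fst_dualFst : l (dualFst l m) = 1 := by
  simp [dualFst]; rw [inv_mul_eq_one₀ hD, coframeDet]; ring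

theorem snd_dualFst : m (dualFst l m) = 0 := by
  simp [dualFst]; right; ring

theorem fst_dualSnd : l (dualSnd l m) = 0 := by
  simp [dualSnd]; right; ring

theorem snd_dualSnd : m (dualSnd l m) = 1 := by
  simp [dualSnd]; rw [inv_mul_eq_one₀ hD, coframeDet]

theorem coframe_injective : Function.Injective (l.prod m) := by
  rw [injective_iff_map_eq_zero]
  intro u hu
  simp at hu
  obtain ⟨h1, h2⟩ := hu
  rw [plane_eq u] at h1 h2
  simp only [map_add, map_smul, smul_eq_mul] at h1 h2
  have a0 : u 0 * coframeDet l m = 0 := by rw [coframeDet]; linear_combination m (e 1) * h1 - l (e 1) * h2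
  have a1 : u 1 * coframeDet l m = 0 := by rw [coframeDet]; linear_combination l (e 0) * h2 - m (e 0) * h1
  rw [plane_eq u]
  simp [(mul_eq_zero.1 a0).resolve_right hD, (mul_eq_zero.1 a1).resolve_right hD]

theorem coframe_expand (u : Plane) : u = l u • dualFst l m + m u • dualSnd l m := by
  apply coframe_injective hD
  simp [fst_dualFst hD, snd_dualFst hD, fst_dualSnd hD, snd_dualSnd hD]

theorem coframe_surjective : Function.Surjective (l.prod m) := fun p =>
  ⟨p.1 • dualFst l m + p.2 • dualSnd l m, by
    simp [fst_dualFst hD, snd_dualFst hD, fst_dualSnd hD, snd_dualSnd hD]⟩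

theorem nondegenerate_coframe {b : Plane →L[ℝ] Plane →L[ℝ] ℝ}
    (hb : ∀ u w, b u w = -(l u * m w + m u * l w)) : Nondegenerate b := by
  intro u hu
  have h1 := hu (dualFst l m)
  have h2 := hu (dualSnd l m)
  rw [hb, fst_dualFst hD, snd_dualFst hD] at h1
  rw [hb, fst_dualSnd hD, snd_dualSnd hD] at h2
  apply coframe_injective hD
  simp
  constructor <;> linarith

omit hD in
theorem gram_coframe {b : Plane →L[ℝ] Plane →L[ℝ] ℝ}
    (hb : ∀ u w, b u w = -(l u * m w + m u * l w)) :
    (gram b).det = -(coframeDet l m) ^ 2 := by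
  simp only [gram, Matrix.det_fin_two, Matrix.of_apply, hb, coframeDet]
  ring

/-- The trace with respect to `-(l m + m l)` of a bilinear map. -/
theorem trace_coframe {E : Type*} [AddCommGroup E] [Module ℝ E] {b : Plane →L[ℝ] Plane →L[ℝ] ℝ}
    (hb : ∀ u w, b u w = -(l u * m w + m u * l w)) {S : Plane → Plane → E} {x y : E}
    (hS : ∀ u w, S u w = (l u * l w) • x + (l u * m w + m u * l w) • y) :
    ∑ i, ∑ k, (gram b)⁻¹ i k • S (e i) (e k) = (-2 : ℝ) • y := by
  have hdet : ((coframeDet l m) ^ 2) ≠ 0 := pow_ne_zero 2 hD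
  have hinv : (gram b)⁻¹ = (-(coframeDet l m ^ 2))⁻¹ • (gram b).adjugate := by
    rw [Matrix.inv_def, gram_coframe hb, Ring.inverse_eq_inv']
  rw [hinv]
  simp only [Fin.sum_univ_two, Matrix.adjugate_fin_two, gram, Matrix.of_apply, hb, hS,
    Matrix.smul_apply, Matrix.cons_val_zero, Matrix.cons_val_one, Matrix.cons_val', 
    smul_add, smul_smul, smul_eq_mul]
  -- With p, q the basis dual to l, m, the inverse metric is -(p ⊗ q + q ⊗ p). The coefficient x of
  -- l² is thus traced to 0 and y to -2y; the check is made after writing -2 over the Gram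
  -- determinant.
  have key : (-2 : ℝ) = (-(coframeDet l m ^ 2))⁻¹ * (2 * coframeDet l m ^ 2) := by
    field_simp
  rw [key]
  match_scalars <;> simp only [coframeDet] <;> ring

end Coframe

/-! ### Flatness, mean curvature and Euler equation in null coordinates. -/

namespace NullCoordinates

variable {f : Plane → Plane × Plane} {N : Set Plane} {σ v k : Plane → ℝ} {t : Plane → Plane}
  {P : Plane → Plane × Plane}

/-- `-(dσ dv + dv dσ)` on `ℝ × ℝ`. -/
noncomputable def nullForm : ℝ × ℝ →L[ℝ] ℝ × ℝ →L[ℝ] ℝ :=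
  -((ContinuousLinearMap.mul ℝ ℝ).bilinearComp (ContinuousLinearMap.fst ℝ ℝ ℝ)
      (ContinuousLinearMap.snd ℝ ℝ ℝ) +
    (ContinuousLinearMap.mul ℝ ℝ).bilinearComp (ContinuousLinearMap.snd ℝ ℝ ℝ)
      (ContinuousLinearMap.fst ℝ ℝ ℝ))

theorem nullForm_apply (x y : ℝ × ℝ) : nullForm x y = -(x.1 * y.2 + x.2 * y.1) := by
  simp [nullForm]

variable (X : NullCoordinates T h J f N σ v k t P) (C : KaehlerChart T h J)
include X C

omit C in
theorem det_ne {z : Plane} (hz : z ∈ N) : coframeDet (fderiv ℝ σ z) (fderiv ℝ v z) ≠ 0 :=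
  X.indep z hz

theorem neutral_vertical_normal {z : Plane} (hz : z ∈ N) (ξ : Plane × Plane) :
    neutralOf h J (f z) (0, J (f z).1 (t z)) ξ = -h (f z).1 (t z) ξ.1 := by
  rw [C.neutralOf_vertical (X.mem z hz), C.rot_rot _ (X.mem z hz)]
  simp

theorem neutral_normal_vector {z : Plane} (hz : z ∈ N) :
    neutralOf h J (f z) (0, J (f z).1 (t z)) (P z) = -1 := by
  rw [X.neutral_vertical_normal C hz, X.vector_fst z hz, X.unit z hz]

theorem neutral_vector_normal {z : Plane} (hz : z ∈ N) :
    neutralOf h J (f z) (P z) (0, J (f z).1 (t z)) = -1 := by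
  rw [C.neutralOf_symm (X.mem z hz), X.neutral_normal_vector C hz]

/-- K P is proportional to t, which is also the base component of P, and ω(t, t) = 0. Killing the
normal part of K P was the purpose of passing from τ to v. -/
theorem neutral_vector {z : Plane} (hz : z ∈ N) : neutralOf h J (f z) (P z) (P z) = 0 := by
  obtain ⟨r, hr⟩ := X.vector_connection z hz
  rw [C.neutralOf_apply (X.mem z hz), hr, X.vector_fst z hz]
  simp [C.metric_rot_self (X.mem z hz)]

/-- Both coordinate vectors P and (0, Jt) are null, and their product is h(J(Jt), t) = -1. -/
theorem pullbackMetric_eq {z : Plane} (hz : z ∈ N) (u w : Plane) :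
    pullbackMetric (neutralOf h J) f z u w =
      -(fderiv ℝ σ z u * fderiv ℝ v z w + fderiv ℝ v z u * fderiv ℝ σ z w) := by
  have hT := X.mem z hz
  have : pullbackMetric (neutralOf h J) f z u w =
    neutralOf h J (f z) (fderiv ℝ f z u) (fderiv ℝ f z w) := rfl
  rw [this, X.fderiv_eq z hz, X.fderiv_eq z hz]
  simp only [map_add, map_smul, add_apply, smul_apply, smul_eq_mul,
    X.neutral_normal_vector C hz, X.neutral_vector_normal C hz, X.neutral_vector C hz,
    X.neutral_vertical_normal C hz, map_zero]
  ring

theorem nondegenerate {z : Plane} (hz : z ∈ N) :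
    Nondegenerate (pullbackMetric (neutralOf h J) f z) :=
  nondegenerate_coframe (X.det_ne hz) (X.pullbackMetric_eq C hz)

omit C in
theorem fderiv_prodMk {z : Plane} (hz : z ∈ N) :
    fderiv ℝ (fun y => (σ y, v y)) z = (fderiv ℝ σ z).prod (fderiv ℝ v z) :=
  (((X.smooth_fst z hz).differentiableAt (by simp)).hasFDerivAt.prodMk
    ((X.smooth_snd z hz).differentiableAt (by simp)).hasFDerivAt).fderiv

theorem pullback_nullForm {z : Plane} (hz : z ∈ N) : ∀ᶠ y in nhds z, ∀ u w,
    pullbackMetric (neutralOf h J) f y u w =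
      nullForm (fderiv ℝ (fun y => (σ y, v y)) y u) (fderiv ℝ (fun y => (σ y, v y)) y w) := by
  filter_upwards [X.isOpen.eventually_mem hz] with y hy u w
  rw [X.pullbackMetric_eq C hy, nullForm_apply, X.fderiv_prodMk hy]
  rfl

omit C in
theorem bijective_fderiv {z : Plane} (hz : z ∈ N) :
    Function.Bijective (fderiv ℝ (fun y => (σ y, v y)) z) := by
  rw [X.fderiv_prodMk hz]
  exact ⟨coframe_injective (X.det_ne hz), coframe_surjective (X.det_ne hz)⟩

omit X C in
theorem nullForm_symm (x y : ℝ × ℝ) : nullForm x y = nullForm y x := by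
  rw [nullForm_apply, nullForm_apply]; ring

theorem flat {z : Plane} (hz : z ∈ N) (u w x : Plane) :
    curvature (pullbackMetric (neutralOf h J) f) z u w x = 0 := by
  have hev := X.isOpen.eventually_mem hz
  exact curvature_pullback_const nullForm_symm
    ((X.smooth_fst z hz).prodMk (X.smooth_snd z hz)) (X.pullback_nullForm C hz)
    (hev.mono fun y hy => X.nondegenerate C hy) (hev.mono fun y hy => X.bijective_fderiv hy) u w x

/-- In a null frame the component along one vector is read off by pairing with the other. The signs
come from the product -1 of the two frame vectors. -/
theorem tangentPart_eq {z : Plane} (hz : z ∈ N) (ξ : Plane × Plane) :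
    tangentPart (neutralOf h J) f z ξ =
      -(neutralOf h J (f z) ξ (0, J (f z).1 (t z)) • dualFst (fderiv ℝ σ z) (fderiv ℝ v z)) -
        neutralOf h J (f z) ξ (P z) • dualSnd (fderiv ℝ σ z) (fderiv ℝ v z) := by
  have hD := X.det_ne hz
  refine ((X.nondegenerate C hz).isInvertible.inverse_apply_eq).2 ?_
  ext w
  rw [X.pullbackMetric_eq C hz, ContinuousLinearMap.comp_apply, X.fderiv_eq z hz]
  simp only [map_add, map_smul, map_sub, map_neg, fst_dualFst hD, snd_dualFst hD, fst_dualSnd hD,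
    snd_dualSnd hD, smul_eq_mul]
  ring

theorem normalPart_add (z : Plane) (ξ η : Plane × Plane) :
    normalPart (neutralOf h J) f z (ξ + η) =
      normalPart (neutralOf h J) f z ξ + normalPart (neutralOf h J) f z η := by
  simp [normalPart, tangentPart, map_add, ContinuousLinearMap.add_comp]
  abel

theorem normalPart_smul (z : Plane) (r : ℝ) (ξ : Plane × Plane) :
    normalPart (neutralOf h J) f z (r • ξ) = r • normalPart (neutralOf h J) f z ξ := by
  simp [normalPart, tangentPart, smul_sub]

theorem normalPart_fderiv {z : Plane} (hz : z ∈ N) (u : Plane) :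
    normalPart (neutralOf h J) f z (fderiv ℝ f z u) = 0 := by
  have : tangentPart (neutralOf h J) f z (fderiv ℝ f z u) = u :=
    ((X.nondegenerate C hz).isInvertible.inverse_apply_eq).2 rfl
  rw [normalPart, this, sub_self]

theorem normalPart_vector {z : Plane} (hz : z ∈ N) :
    normalPart (neutralOf h J) f z (P z) = 0 := by
  have hD := X.det_ne hz
  have := X.fderiv_eq z hz (dualFst (fderiv ℝ σ z) (fderiv ℝ v z))
  rw [fst_dualFst hD, snd_dualFst hD, one_smul, zero_smul, add_zero] at this
  rw [← this, X.normalPart_fderiv C hz]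

theorem normalPart_normal {z : Plane} (hz : z ∈ N) :
    normalPart (neutralOf h J) f z ((0 : Plane), J (f z).1 (t z)) = 0 := by
  have hD := X.det_ne hz
  have := X.fderiv_eq z hz (dualSnd (fderiv ℝ σ z) (fderiv ℝ v z))
  rw [fst_dualSnd hD, snd_dualSnd hD, one_smul, zero_smul, zero_add] at this
  rw [← this, X.normalPart_fderiv C hz]

/-- Its product with the vertical frame vector vanishes, and its product with P is ω(t, t) = 0. -/
theorem normalPart_vertical_tangent {z : Plane} (hz : z ∈ N) :
    normalPart (neutralOf h J) f z ((0 : Plane), t z) = (0, t z) := by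
  have hT := X.mem z hz
  rw [normalPart, X.tangentPart_eq C hz, C.neutralOf_vertical hT, C.neutralOf_vertical hT,
    X.vector_fst z hz, C.metric_rot_self hT]
  simp

theorem smooth_normal {z : Plane} (hz : z ∈ N) :
    ContDiffAt ℝ ∞ (fun y => J (f y).1 (t y)) z :=
  ContDiffAt.clm_apply (((C.smooth_rot _ (X.mem z hz)).comp z
    (contDiffAt_fst.comp z (X.smooth z hz)))) (X.smooth_tangent z hz)

theorem fderiv_fderiv {z : Plane} (hz : z ∈ N) (u w : Plane) :
    fderiv ℝ (fderiv ℝ f) z u w =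
      fderiv ℝ (fderiv ℝ σ) z u w • P z + fderiv ℝ σ z w • fderiv ℝ P z u +
      (fderiv ℝ (fderiv ℝ v) z u w • ((0 : Plane), J (f z).1 (t z)) +
      fderiv ℝ v z w • ((0 : Plane), fderiv ℝ (fun y => J (f y).1 (t y)) z u)) := by
  have d {E : Type} [NormedAddCommGroup E] [NormedSpace ℝ E] {g : Plane → E}
      (hg : ContDiffAt ℝ ∞ g z) : DifferentiableAt ℝ (fderiv ℝ g) z :=
    (hg.fderiv_right (m := ∞) (by simp)).differentiableAt (by simp)
  have e1 := hasFDerivAt_clm_const (d (X.smooth_fst z hz)) w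
  have e2 := hasFDerivAt_clm_const (d (X.smooth_snd z hz)) w
  have e3 := ((X.smooth_vector z hz).differentiableAt (by simp)).hasFDerivAt
  have e4 := (hasFDerivAt_const (0 : Plane) z).prodMk
    ((X.smooth_normal C hz).differentiableAt (by simp)).hasFDerivAt
  have e5 := hasFDerivAt_clm_const (d (X.smooth z hz)) w
  have e6 := ((e1.smul e3).add (e2.smul e4)).congr_of_eventuallyEq
    (f₁ := fun y => fderiv ℝ f y w)
    ((X.isOpen.eventually_mem hz).mono fun y hy => X.fderiv_eq y hy w)
  have := congrArg (fun l => l u) (e5.unique e6)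
  simp at this
  rw [this]
  ext1 <;> simp <;> abel

/-- The content is ∂_v P = ∂_v ∂_σ f = ∂_σ ∂_v f = (0, ∂_σ(Jt)), by equality of mixed derivatives;
`fderiv_normal` evaluates the last term. -/
theorem fderiv_vector {z : Plane} (hz : z ∈ N) (u : Plane) :
    fderiv ℝ P z u = fderiv ℝ σ z u • fderiv ℝ P z (dualFst (fderiv ℝ σ z) (fderiv ℝ v z)) +
      fderiv ℝ v z u • ((0 : Plane),
        -(k z • t z) - christoffel h (f z).1 (t z) (J (f z).1 (t z))) := by
  have hD := X.det_ne hz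
  have sy {E : Type} [NormedAddCommGroup E] [NormedSpace ℝ E] {g : Plane → E}
      (hg : ContDiffAt ℝ ∞ g z) : IsSymmSndFDerivAt ℝ g z :=
    hg.isSymmSndFDerivAt (by simp; norm_cast)
  have e := (sy (X.smooth z hz)).eq (dualFst (fderiv ℝ σ z) (fderiv ℝ v z))
    (dualSnd (fderiv ℝ σ z) (fderiv ℝ v z))
  rw [X.fderiv_fderiv C hz, X.fderiv_fderiv C hz, (sy (X.smooth_fst z hz)).eq,
    (sy (X.smooth_snd z hz)).eq, X.fderiv_normal z hz, X.fderiv_normal z hz] at e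
  simp only [fst_dualFst hD, snd_dualFst hD, fst_dualSnd hD, snd_dualSnd hD, one_smul, zero_smul,
    add_zero] at e
  conv_lhs => rw [coframe_expand hD u, map_add, map_smul, map_smul]
  congr 2
  rw [eq_comm, ← sub_eq_zero] at e
  rw [← sub_eq_zero, ← e]
  abel

/-- The coefficient R of dσ² is left unspecified, since it does not contribute to a trace with
respect to dσ dv. In the mixed term the Christoffel part of ∂_σ(Jt) is cancelled by the ambient
connection, which leaves -k t. -/
theorem ambientHessian_eq {z : Plane} (hz : z ∈ N) : ∃ R : Plane × Plane, ∀ u w,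
    ambientHessian (neutralOf h J) f z u w =
      fderiv ℝ (fderiv ℝ σ) z u w • P z +
      fderiv ℝ (fderiv ℝ v) z u w • ((0 : Plane), J (f z).1 (t z)) +
      (fderiv ℝ σ z u * fderiv ℝ σ z w) • R +
      (fderiv ℝ σ z u * fderiv ℝ v z w + fderiv ℝ v z u * fderiv ℝ σ z w) •
        ((0 : Plane), -(k z • t z)) := by
  have hT := X.mem z hz
  refine ⟨fderiv ℝ P z (dualFst (fderiv ℝ σ z) (fderiv ℝ v z)) +
    christoffel (neutralOf h J) (f z) (P z) (P z), fun u w => ?_⟩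
  have hs := christoffel_symm ((C.contDiffAt_neutralOf hT).differentiableAt (by simp))
    (C.neutralOf_symm_eventually hT)
  have e1 : christoffel (neutralOf h J) (f z) (P z) (0, J (f z).1 (t z)) =
      (0, christoffel h (f z).1 (t z) (J (f z).1 (t z))) := by
    rw [C.christoffel_vertical hT, X.vector_fst z hz]
  -- Vertical directions have no base component, so the fibres are flat and no dv² term appears.
  have e2 : christoffel (neutralOf h J) (f z) (0, J (f z).1 (t z)) (0, J (f z).1 (t z)) = 0 := by
    rw [C.christoffel_vertical hT]; simp
  rw [ambientHessian, X.fderiv_fderiv C hz, X.fderiv_vector C hz, X.fderiv_normal z hz,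
    X.fderiv_eq z hz, X.fderiv_eq z hz]
  simp only [map_add, map_smul, add_apply, smul_apply, hs _ (P z), e1, e2]
  generalize christoffel (neutralOf h J) (f z) (P z) (P z) = A
  generalize fderiv ℝ P z (dualFst (fderiv ℝ σ z) (fderiv ℝ v z)) = B
  generalize christoffel h (f z).1 (t z) (J (f z).1 (t z)) = G
  ext1
  · simp; module
  · simp; module

theorem secondFundamentalForm_eq {z : Plane} (hz : z ∈ N) : ∃ R : Plane × Plane, ∀ u w,
    secondFundamentalForm (neutralOf h J) f z u w =
      (fderiv ℝ σ z u * fderiv ℝ σ z w) • R +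
      (fderiv ℝ σ z u * fderiv ℝ v z w + fderiv ℝ v z u * fderiv ℝ σ z w) •
        (-(k z) • ((0 : Plane), t z)) := by
  obtain ⟨R, hR⟩ := X.ambientHessian_eq C hz
  refine ⟨normalPart (neutralOf h J) f z R, fun u w => ?_⟩
  have : ((0 : Plane), -(k z • t z)) = -(k z) • ((0 : Plane), t z) := by simp
  rw [secondFundamentalForm, hR]
  simp only [X.normalPart_add C, X.normalPart_smul C, X.normalPart_vector C hz,
    X.normalPart_normal C hz, this, X.normalPart_vertical_tangent C hz, smul_zero, zero_add]

/-- The mean curvature vector of an affine normal bundle. -/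
theorem meanCurvature_eq {z : Plane} (hz : z ∈ N) :
    meanCurvature (neutralOf h J) f z = ((0 : Plane), k z • t z) := by
  obtain ⟨R, hR⟩ := X.secondFundamentalForm_eq C hz
  rw [meanCurvature, trace_coframe (X.det_ne hz) (X.pullbackMetric_eq C hz) hR]
  ext1
  · simp
  · simp [smul_smul]

/-- 𝕁(0, k t) = (0, k Jt) is k times the coordinate vector ∂_v f, so it is already tangent. -/
theorem tangentPart_complex_meanCurvature {z : Plane} (hz : z ∈ N) :
    tangentPart (neutralOf h J) f z
      (complexOf h J (f z) (meanCurvature (neutralOf h J) f z)) =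
        k z • dualSnd (fderiv ℝ σ z) (fderiv ℝ v z) := by
  have hT := X.mem z hz
  rw [X.meanCurvature_eq C hz, complexOf_vertical, X.tangentPart_eq C hz, C.neutralOf_vertical hT,
    C.neutralOf_vertical hT, X.vector_fst z hz, C.rot_rot _ hT]
  simp [X.unit z hz]

omit C in
theorem smooth_dual {z : Plane} (hz : z ∈ N) :
    ContDiffAt ℝ ∞ (fun y => dualFst (fderiv ℝ σ y) (fderiv ℝ v y)) z ∧
      ContDiffAt ℝ ∞ (fun y => dualSnd (fderiv ℝ σ y) (fderiv ℝ v y)) z := by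
  have a (w : Plane) : ContDiffAt ℝ ∞ (fun y => fderiv ℝ σ y w) z :=
    ((X.smooth_fst z hz).fderiv_right (m := ∞) (by simp)).clm_apply contDiffAt_const
  have b (w : Plane) : ContDiffAt ℝ ∞ (fun y => fderiv ℝ v y w) z :=
    ((X.smooth_snd z hz).fderiv_right (m := ∞) (by simp)).clm_apply contDiffAt_const
  have c : ContDiffAt ℝ ∞ (fun y => (coframeDet (fderiv ℝ σ y) (fderiv ℝ v y))⁻¹) z :=
    ContDiffAt.inv (((a (e 0)).mul (b (e 1))).sub ((a (e 1)).mul (b (e 0)))) (X.det_ne hz)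
  exact ⟨c.smul (((b (e 1)).smul contDiffAt_const).sub ((b (e 0)).smul contDiffAt_const)),
    c.smul (((a (e 0)).smul contDiffAt_const).sub ((a (e 1)).smul contDiffAt_const))⟩

/-- The Euler equation of Hamiltonian stationary surfaces. -/
theorem divergence_eq_zero {z : Plane} (hz : z ∈ N) :
    divergence (pullbackMetric (neutralOf h J) f)
      (fun y => tangentPart (neutralOf h J) f y
        (complexOf h J (f y) (meanCurvature (neutralOf h J) f y))) z = 0 := by
  have hev := X.isOpen.eventually_mem hz
  have hD := X.det_ne hz
  obtain ⟨r, hr⟩ := X.fderiv_curvature z hz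
  have hY : (fun y => tangentPart (neutralOf h J) f y
      (complexOf h J (f y) (meanCurvature (neutralOf h J) f y))) =ᶠ[nhds z]
      fun y => k y • dualSnd (fderiv ℝ σ y) (fderiv ℝ v y) :=
    hev.mono fun y hy => X.tangentPart_complex_meanCurvature C hy
  have hd : DifferentiableAt ℝ (fun y => k y • dualSnd (fderiv ℝ σ y) (fderiv ℝ v y)) z :=
    ((X.smooth_curvature z hz).smul (X.smooth_dual hz).2).differentiableAt (by simp)
  -- In the flat coordinates (σ, v) the field is (0, k) and dk = r dσ. Its covariant derivative is
  -- therefore (r dσ) ⊗ ∂_v, and dσ(∂_v) = 0.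
  refine divergence_pullback_const nullForm_symm
    (((X.smooth_fst z hz).prodMk (X.smooth_snd z hz)).of_le (by norm_cast))
    (X.pullback_nullForm C hz) (X.nondegenerate C hz) (X.bijective_fderiv hz)
    (hd.congr_of_eventuallyEq hY) (l := r • fderiv ℝ σ z)
    (b := dualSnd (fderiv ℝ σ z) (fderiv ℝ v z)) (fun u => ?_) ?_
  · have h1 : (fun y => fderiv ℝ (fun y => (σ y, v y)) y (tangentPart (neutralOf h J) f y
      (complexOf h J (f y) (meanCurvature (neutralOf h J) f y)))) =ᶠ[nhds z]
        fun y => ((0 : ℝ), k y) := by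
      filter_upwards [hev] with y hy
      rw [X.tangentPart_complex_meanCurvature C hy, X.fderiv_prodMk hy]
      simp [fst_dualSnd (X.det_ne hy), snd_dualSnd (X.det_ne hy)]
    rw [h1.fderiv_eq, ((hasFDerivAt_const (0 : ℝ) z).prodMk
      ((X.smooth_curvature z hz).differentiableAt (by simp)).hasFDerivAt).fderiv, X.fderiv_prodMk hz]
    simp [fst_dualSnd hD, snd_dualSnd hD, hr]
  · simp [fst_dualSnd hD]

end NullCoordinates


/-! ### Differentiation under the integral sign -/

section Integrals

open MeasureTheory

variable {E : Type*} [NormedAddCommGroup E] [NormedSpace ℝ E] [FiniteDimensional ℝ E]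
  [MeasurableSpace E] [BorelSpace E] (μ : Measure E)

/-- By compactness of A the integrand is C¹ on a whole tube around {0} × A, where its derivative in
ε has a uniform bound. That bound dominates, since A has finite measure. -/
theorem hasDerivAt_setIntegral [IsFiniteMeasureOnCompacts μ] {F : ℝ × E → ℝ} {A : Set E}
    (hA : IsCompact A) (hF : ∀ z ∈ A, ContDiffAt ℝ 1 F (0, z)) :
    HasDerivAt (fun ε => ∫ z in A, F (ε, z) ∂μ) (∫ z in A, fderiv ℝ F (0, z) (1, 0) ∂μ) 0 := by
  have hO : IsOpen {p | ContDiffAt ℝ 1 F p} :=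
    isOpen_iff_mem_nhds.2 fun p hp => ContDiffAt.eventually hp (by simp)
  obtain ⟨u, v, hu, hv, h0u, hAv, huv⟩ := generalized_tube_lemma (isCompact_singleton (x := (0 : ℝ)))
    hA hO (by rintro ⟨a, z⟩ ⟨ha : a = 0, hz⟩; rw [ha]; exact hF z hz)
  obtain ⟨r, hr, hru⟩ := Metric.isOpen_iff.1 hu 0 (h0u rfl)
  have hsub : ∀ p ∈ Metric.closedBall (0 : ℝ) (r / 2) ×ˢ A, ContDiffAt ℝ 1 F p := fun p hp =>
    (prod_mono ((Metric.closedBall_subset_ball (by linarith)).trans hru) hAv).trans huv hp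
  have hcont : ContinuousOn (fun p => fderiv ℝ F p (1, 0))
      (Metric.closedBall (0 : ℝ) (r / 2) ×ˢ A) := fun p hp =>
    (((hsub p hp).fderiv_right (m := 0) (by simp)).continuousAt.clm_apply
      continuousAt_const).continuousWithinAt
  obtain ⟨M, hM⟩ := ((isCompact_closedBall (0 : ℝ) (r / 2)).prod hA).exists_bound_of_continuousOn hcont
  have hslice {ε : ℝ} (hε : ε ∈ Metric.closedBall (0 : ℝ) (r / 2)) :
      ContinuousOn (fun z => F (ε, z)) A := fun z hz =>
    ((hsub _ (mk_mem_prod hε hz)).continuousAt.comp (f := fun z => (ε, z))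
      (by fun_prop)).continuousWithinAt
  have hAm := hA.measurableSet
  have : IsFiniteMeasure (μ.restrict A) := ⟨by simpa using hA.measure_lt_top⟩
  refine (hasDerivAt_integral_of_dominated_loc_of_deriv_le (bound := fun _ => M)
    (F' := fun ε z => fderiv ℝ F (ε, z) (1, 0)) (s := Metric.ball (0 : ℝ) (r / 2))
    (Metric.ball_mem_nhds _ (by linarith)) ?_ ?_ ?_ ?_ ?_ ?_).2
  · filter_upwards [Metric.ball_mem_nhds (0 : ℝ) (half_pos hr)] with ε hε
    exact (hslice (Metric.ball_subset_closedBall hε)).aestronglyMeasurable hAm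
  · exact (hslice (Metric.mem_closedBall_self (by linarith))).integrableOn_compact hA
  · refine ContinuousOn.aestronglyMeasurable (fun z hz => ?_) hAm
    have h1 := (hF z hz).fderiv_right (m := 0) (by simp)
    have h2 : ContinuousAt (fun z => fderiv ℝ F (0, z)) z :=
      ContinuousAt.comp (f := fun z => ((0 : ℝ), z)) h1.continuousAt (by fun_prop)
    exact (h2.clm_apply continuousAt_const).continuousWithinAt
  · filter_upwards [ae_restrict_mem hAm] with z hz ε hε
    exact hM _ (mk_mem_prod (Metric.ball_subset_closedBall hε) hz)
  · exact integrable_const _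
  · filter_upwards [ae_restrict_mem hAm] with z hz ε hε
    have hd : DifferentiableAt ℝ F (ε, z) :=
      (hsub _ (mk_mem_prod (Metric.ball_subset_closedBall hε) hz)).differentiableAt (by simp)
    exact hd.hasFDerivAt.comp_hasDerivAt ε ((hasDerivAt_id ε).prodMk (hasDerivAt_const ε z))

/-- Integration by parts against the constant function 1. -/
theorem integral_fderiv_eq_zero [μ.IsAddHaarMeasure] {g : E → ℝ} (hg : ContDiff ℝ 1 g)
    (hc : HasCompactSupport g) (w : E) : ∫ z, fderiv ℝ g z w ∂μ = 0 := by
  have h1 : Continuous fun z => fderiv ℝ g z w :=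
    (hg.continuous_fderiv (by simp)).clm_apply continuous_const
  have h2 : HasCompactSupport fun z => fderiv ℝ g z w := hc.fderiv_apply ℝ w
  have := integral_mul_fderiv_eq_neg_fderiv_mul_of_integrable (μ := μ) (f := fun _ : E => (1 : ℝ))
    (g := g) (v := w) (by simp) (by simpa using h1.integrable_of_hasCompactSupport h2)
    (by simpa using hg.continuous.integrable_of_hasCompactSupport hc) (by fun_prop)
    (fun z _ => (hg.differentiable (by simp)) z)
  simpa using this

/-- The divergence of a vector field for the Lebesgue measure. -/
noncomputable def planeDiv (Y : Plane → Plane) (z : Plane) : ℝ :=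
  (fderiv ℝ Y z (e 0)) 0 + (fderiv ℝ Y z (e 1)) 1

theorem integral_planeDiv {Y : Plane → Plane} (hY : ContDiff ℝ 1 Y) (hc : HasCompactSupport Y) :
    ∫ z, planeDiv Y z = 0 := by
  have h1 (i : Fin 2) : ContDiff ℝ 1 fun z => Y z i := contDiff_euclidean.1 hY i
  have h2 (i : Fin 2) : HasCompactSupport fun z => Y z i :=
    hc.comp_left (g := fun y : Plane => y i) rfl
  have h3 (i : Fin 2) (z w : Plane) : (fderiv ℝ Y z w) i = fderiv ℝ (fun y => Y y i) z w := by
    have := ((EuclideanSpace.proj i : Plane →L[ℝ] ℝ).hasFDerivAt.comp z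
      ((hY.differentiable (by simp)) z).hasFDerivAt).fderiv
    exact (congrArg (fun l : Plane →L[ℝ] ℝ => l w) this).symm
  have h4 (i : Fin 2) : Integrable (fun z => fderiv ℝ (fun y => Y y i) z (e i)) :=
    (((h1 i).continuous_fderiv (by simp)).clm_apply
      continuous_const).integrable_of_hasCompactSupport ((h2 i).fderiv_apply ℝ (e i))
  simp only [planeDiv, h3]
  rw [integral_add (h4 0) (h4 1), integral_fderiv_eq_zero _ (h1 0) (h2 0),
    integral_fderiv_eq_zero _ (h1 1) (h2 1), add_zero]

/-- The vector field `ρ (∂₁ v, -∂₀ v)` has divergence `dρ (∂₁ v, -∂₀ v)`. -/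
theorem planeDiv_smul_rotated {ρ v : Plane → ℝ} {z : Plane} (hρ : DifferentiableAt ℝ ρ z)
    (hv : ContDiffAt ℝ ∞ v z) :
    planeDiv (fun y => ρ y • (fderiv ℝ v y (e 1) • e 0 - fderiv ℝ v y (e 0) • e 1)) z =
      fderiv ℝ ρ z (fderiv ℝ v z (e 1) • e 0 - fderiv ℝ v z (e 0) • e 1) := by
  have d : DifferentiableAt ℝ (fderiv ℝ v) z :=
    (hv.fderiv_right (m := ∞) (by simp)).differentiableAt (by simp)
  have sy : IsSymmSndFDerivAt ℝ v z := hv.isSymmSndFDerivAt (by simp; norm_cast)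
  have e1 := hρ.hasFDerivAt.smul (((hasFDerivAt_clm_const d (e 1)).smul_const (e 0)).sub
    ((hasFDerivAt_clm_const d (e 0)).smul_const (e 1)))
  have : fderiv ℝ (fun y => ρ y • (fderiv ℝ v y (e 1) • e 0 - fderiv ℝ v y (e 0) • e 1)) z = _ :=
    e1.fderiv
  rw [planeDiv, this]
  simp [sy.eq (e 1) (e 0)]
  simp [e]
  ring

end Integrals

/-! ### Variations -/

section Variations

variable {V F : Type*} [NormedAddCommGroup V] [NormedSpace ℝ V]
  [NormedAddCommGroup F] [NormedSpace ℝ F]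

/-- The variation vector at time `0`. -/
noncomputable def variationVector (Ψ : ℝ × V → F) (z : V) : F := fderiv ℝ Ψ (0, z) (1, 0)

theorem hasFDerivAt_slice {Ψ : ℝ × V → F} {ε : ℝ} {z : V} (hΨ : DifferentiableAt ℝ Ψ (ε, z)) :
    HasFDerivAt (fun y => Ψ (ε, y)) (fderiv ℝ Ψ (ε, z) ∘L ContinuousLinearMap.inr ℝ ℝ V) z :=
  hΨ.hasFDerivAt.comp z (hasFDerivAt_prodMk_right ε z)

theorem hasDerivAt_slice {Ψ : ℝ × V → F} {ε : ℝ} {z : V} (hΨ : DifferentiableAt ℝ Ψ (ε, z)) :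
    HasDerivAt (fun r => Ψ (r, z)) (fderiv ℝ Ψ (ε, z) (1, 0)) ε :=
  hΨ.hasFDerivAt.comp_hasDerivAt ε ((hasDerivAt_id ε).prodMk (hasDerivAt_const ε z))

theorem smooth_variationVector {Ψ : ℝ × V → F} {z : V} (hΨ : ContDiffAt ℝ ∞ Ψ (0, z)) :
    ContDiffAt ℝ ∞ (variationVector Ψ) z :=
  ContDiffAt.clm_apply (ContDiffAt.comp z (f := fun y => ((0 : ℝ), y))
    (hΨ.fderiv_right (m := ∞) (by simp)) (contDiffAt_const.prodMk contDiffAt_id)) contDiffAt_const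

/-- The derivatives in ε and in z commute, so the differential of the varied map changes at the rate
of the differential of the variation vector. -/
theorem hasDerivAt_fderiv_slice {Ψ : ℝ × V → F} {z : V} (hΨ : ContDiffAt ℝ ∞ Ψ (0, z)) (w : V) :
    HasDerivAt (fun ε => fderiv ℝ Ψ (ε, z) (0, w)) (fderiv ℝ (variationVector Ψ) z w) 0 := by
  have d : DifferentiableAt ℝ (fderiv ℝ Ψ) (0, z) :=
    (hΨ.fderiv_right (m := ∞) (by simp)).differentiableAt (by simp)
  have sy : IsSymmSndFDerivAt ℝ Ψ (0, z) := hΨ.isSymmSndFDerivAt (by simp; norm_cast)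
  have e1 := hasDerivAt_slice (Ψ := fun p => fderiv ℝ Ψ p (0, w))
    (hasFDerivAt_clm_const d (0, w)).differentiableAt
  have e2 : HasFDerivAt (variationVector Ψ) _ z := hasFDerivAt_slice
    (Ψ := fun p => fderiv ℝ Ψ p (1, 0)) (hasFDerivAt_clm_const d ((1 : ℝ), (0 : V))).differentiableAt
  rw [e2.fderiv, (hasFDerivAt_clm_const d _).fderiv]
  rw [(hasFDerivAt_clm_const d _).fderiv] at e1
  refine e1.congr_deriv ?_
  simpa using sy.eq (1, 0) (0, w)

theorem pullbackMetric_slice {g : F → F →L[ℝ] F →L[ℝ] ℝ} {Ψ : ℝ × V → F} {ε : ℝ} {z : V}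
    (hΨ : DifferentiableAt ℝ Ψ (ε, z)) (u w : V) :
    pullbackMetric g (fun y => Ψ (ε, y)) z u w =
      g (Ψ (ε, z)) (fderiv ℝ Ψ (ε, z) (0, u)) (fderiv ℝ Ψ (ε, z) (0, w)) := by
  simp [pullbackMetric, (hasFDerivAt_slice hΨ).fderiv]

/-- The variation of the induced metric. -/
noncomputable def metricVariation (g : F → F →L[ℝ] F →L[ℝ] ℝ) (f Y : V → F) (z u w : V) : ℝ :=
  fderiv ℝ g (f z) (Y z) (fderiv ℝ f z u) (fderiv ℝ f z w) +
    g (f z) (fderiv ℝ Y z u) (fderiv ℝ f z w) + g (f z) (fderiv ℝ f z u) (fderiv ℝ Y z w)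

theorem hasDerivAt_pullbackMetric {g : F → F →L[ℝ] F →L[ℝ] ℝ} {Ψ : ℝ × V → F} {z : V}
    (hΨ : ContDiffAt ℝ ∞ Ψ (0, z)) (hg : DifferentiableAt ℝ g (Ψ (0, z))) (u w : V) :
    HasDerivAt (fun ε => pullbackMetric g (fun y => Ψ (ε, y)) z u w)
      (metricVariation g (fun y => Ψ (0, y)) (variationVector Ψ) z u w) 0 := by
  have hd : DifferentiableAt ℝ Ψ (0, z) := hΨ.differentiableAt (by simp)
  have hev : ∀ᶠ ε in nhds (0 : ℝ), DifferentiableAt ℝ Ψ (ε, z) := by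
    have h1 : ∀ᶠ p in nhds ((0 : ℝ), z), DifferentiableAt ℝ Ψ p :=
      ((hΨ.of_le (m := 1) (by norm_cast)).eventually (by simp)).mono
        fun p hp => hp.differentiableAt (by simp)
    exact (Continuous.tendsto (f := fun ε : ℝ => (ε, z)) (by fun_prop) 0).eventually h1
  have e0 : HasDerivAt (fun ε => g (Ψ (ε, z)))
      (fderiv ℝ g (Ψ (0, z)) (variationVector Ψ z)) 0 :=
    HasFDerivAt.comp_hasDerivAt (f := fun ε => Ψ (ε, z)) (0 : ℝ) hg.hasFDerivAt (hasDerivAt_slice hd)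
  have e1 := (e0.clm_apply (hasDerivAt_fderiv_slice hΨ u)).clm_apply (hasDerivAt_fderiv_slice hΨ w)
  have e2 := e1.congr_of_eventuallyEq
    (f₁ := fun ε => pullbackMetric g (fun y => Ψ (ε, y)) z u w)
    (hev.mono fun ε h => pullbackMetric_slice h u w)
  refine e2.congr_deriv ?_
  simp [metricVariation, (hasFDerivAt_slice hd).fderiv, variationVector]

theorem metricVariation_bilin {g : F → F →L[ℝ] F →L[ℝ] ℝ} {f Y : V → F} {z : V} :
    ∃ b : V →L[ℝ] V →L[ℝ] ℝ, ∀ u w, b u w = metricVariation g f Y z u w :=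
  ⟨(fderiv ℝ g (f z) (Y z)).bilinearComp (fderiv ℝ f z) (fderiv ℝ f z) +
    (g (f z)).bilinearComp (fderiv ℝ Y z) (fderiv ℝ f z) +
    (g (f z)).bilinearComp (fderiv ℝ f z) (fderiv ℝ Y z), fun u w => by simp [metricVariation]⟩

/-- The determinant of the metrics induced by a family of maps. -/
noncomputable def gramDet (g : F → F →L[ℝ] F →L[ℝ] ℝ) (Ψ : ℝ × Plane → F) (p : ℝ × Plane) : ℝ :=
  (gram (pullbackMetric g (fun y => Ψ (p.1, y)) p.2)).det

theorem smooth_gramDet {g : F → F →L[ℝ] F →L[ℝ] ℝ} {Ψ : ℝ × Plane → F} {p : ℝ × Plane}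
    (hΨ : ContDiffAt ℝ ∞ Ψ p) (hg : ContDiffAt ℝ ∞ g (Ψ p)) : ContDiffAt ℝ ∞ (gramDet g Ψ) p := by
  have h1 (u w : Plane) : ContDiffAt ℝ ∞
      (fun p => pullbackMetric g (fun y => Ψ (p.1, y)) p.2 u w) p := by
    have hd := hΨ.fderiv_right (m := ∞) (by simp)
    refine ContDiffAt.congr_of_eventuallyEq (((hg.comp p hΨ).clm_apply
      (hd.clm_apply (contDiffAt_const (c := ((0 : ℝ), u))))).clm_apply
      (hd.clm_apply (contDiffAt_const (c := ((0 : ℝ), w))))) ?_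
    filter_upwards [(hΨ.of_le (m := 1) (by norm_cast)).eventually (by simp)] with q hq
    exact pullbackMetric_slice (hq.differentiableAt (by simp)) u w
  have h2 : gramDet g Ψ = fun p =>
      pullbackMetric g (fun y => Ψ (p.1, y)) p.2 (e 0) (e 0) *
        pullbackMetric g (fun y => Ψ (p.1, y)) p.2 (e 1) (e 1) -
      pullbackMetric g (fun y => Ψ (p.1, y)) p.2 (e 0) (e 1) *
        pullbackMetric g (fun y => Ψ (p.1, y)) p.2 (e 1) (e 0) := by
    funext p
    rw [gramDet, Matrix.det_fin_two]; rfl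
  rw [h2]
  exact ((h1 _ _).mul (h1 _ _)).sub ((h1 _ _).mul (h1 _ _))

/-- The variation of the area element, when the induced metric at time `0` is `-(l m + m l)`. -/
theorem hasDerivAt_areaElement {g : F → F →L[ℝ] F →L[ℝ] ℝ} {Ψ : ℝ × Plane → F} {z : Plane}
    (hΨ : ContDiffAt ℝ ∞ Ψ (0, z)) (hg : DifferentiableAt ℝ g (Ψ (0, z)))
    (hs : ∀ u w, metricVariation g (fun y => Ψ (0, y)) (variationVector Ψ) z u w =
      metricVariation g (fun y => Ψ (0, y)) (variationVector Ψ) z w u)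
    {l m : Plane →L[ℝ] ℝ} (hD : coframeDet l m ≠ 0)
    (hb : ∀ u w, pullbackMetric g (fun y => Ψ (0, y)) z u w = -(l u * m w + m u * l w)) :
    HasDerivAt (fun ε => Real.sqrt |gramDet g Ψ (ε, z)|)
      (-(|coframeDet l m| * metricVariation g (fun y => Ψ (0, y)) (variationVector Ψ) z
        (dualFst l m) (dualSnd l m))) 0 := by
  obtain ⟨b, hbv⟩ := metricVariation_bilin (g := g) (f := fun y => Ψ (0, y))
    (Y := variationVector Ψ) (z := z)
  simp only [← hbv] at hs ⊢
  have h1 (u w : Plane) : HasDerivAt (fun ε => pullbackMetric g (fun y => Ψ (ε, y)) z u w)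
      (b u w) 0 := by rw [hbv]; exact hasDerivAt_pullbackMetric hΨ hg u w
  have h2 : (fun ε => gramDet g Ψ (ε, z)) = fun ε =>
      pullbackMetric g (fun y => Ψ (ε, y)) z (e 0) (e 0) *
        pullbackMetric g (fun y => Ψ (ε, y)) z (e 1) (e 1) -
      pullbackMetric g (fun y => Ψ (ε, y)) z (e 0) (e 1) *
        pullbackMetric g (fun y => Ψ (ε, y)) z (e 1) (e 0) := by
    funext ε
    rw [gramDet, Matrix.det_fin_two]; rfl
  have h0 : gramDet g Ψ (0, z) = -(coframeDet l m) ^ 2 := gram_coframe hb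
  have h3 : HasDerivAt (fun ε => gramDet g Ψ (ε, z))
      -- Jacobi's formula: the determinant is -D², with D = `coframeDet l m`, and the trace of b is
      -- -2 b(p, q) in the dual basis p, q.
      (2 * coframeDet l m ^ 2 * b (dualFst l m) (dualSnd l m)) 0 := by
    rw [h2]
    refine (((h1 (e 0) (e 0)).mul (h1 (e 1) (e 1))).sub
      ((h1 (e 0) (e 1)).mul (h1 (e 1) (e 0)))).congr_deriv ?_
    simp only [dualFst, dualSnd, map_smul, map_sub, smul_apply, sub_apply, smul_eq_mul, hb,
      hs (e 1) (e 0)]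
    field_simp
    ring
  -- The induced metric is indefinite. Its determinant stays negative for small ε, so the absolute
  -- value is smooth there.
  have hneg : gramDet g Ψ (0, z) < 0 := by
    rw [h0]; have := pow_pos (abs_pos.2 hD) 2; rw [sq_abs] at this; linarith
  have h4 : ∀ᶠ ε in nhds (0 : ℝ), gramDet g Ψ (ε, z) < 0 :=
    h3.continuousAt.eventually (gt_mem_nhds hneg)
  have h5 := (h3.neg.sqrt (by simpa using hneg.ne)).congr_of_eventuallyEq
    (f₁ := fun ε => Real.sqrt |gramDet g Ψ (ε, z)|)
    (h4.mono fun ε h => by simp [abs_of_neg h])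
  refine h5.congr_deriv ?_
  have h6 : Real.sqrt (coframeDet l m ^ 2) = |coframeDet l m| := Real.sqrt_sq_eq_abs _
  simp only [Pi.neg_apply, h0, neg_neg, h6]
  have h7 : |coframeDet l m| ≠ 0 := abs_ne_zero.2 hD
  rw [← sq_abs (coframeDet l m)]
  field_simp

end Variations


variable {T : Set Plane} {h : Plane → Plane →L[ℝ] Plane →L[ℝ] ℝ} {J : Plane → Plane →L[ℝ] Plane}

/-! ### The first variation of the area -/

theorem fderiv_metric_apply {V F : Type*} [NormedAddCommGroup V] [NormedSpace ℝ V]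
    [NormedAddCommGroup F] [NormedSpace ℝ F] {g : F → F →L[ℝ] F →L[ℝ] ℝ} {f a b : V → F} {z : V}
    (hg : DifferentiableAt ℝ g (f z)) (hf : DifferentiableAt ℝ f z) (ha : DifferentiableAt ℝ a z)
    (hb : DifferentiableAt ℝ b z) (u : V) :
    fderiv ℝ (fun y => g (f y) (a y) (b y)) z u =
      fderiv ℝ g (f z) (fderiv ℝ f z u) (a z) (b z) + g (f z) (fderiv ℝ a z u) (b z) +
        g (f z) (a z) (fderiv ℝ b z u) := by
  have e0 : HasFDerivAt (fun y => g (f y)) (fderiv ℝ g (f z) ∘L fderiv ℝ f z) z :=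
    hg.hasFDerivAt.comp z hf.hasFDerivAt
  rw [((e0.clm_apply ha.hasFDerivAt).clm_apply hb.hasFDerivAt).fderiv]
  simp
  ring

theorem pullbackMetric_congr {V F : Type*} [NormedAddCommGroup V] [NormedSpace ℝ V]
    [NormedAddCommGroup F] [NormedSpace ℝ F] {g : F → F →L[ℝ] F →L[ℝ] ℝ} {f f' : V → F} {z : V}
    (hf : f =ᶠ[nhds z] f') : pullbackMetric g f z = pullbackMetric g f' z := by
  rw [pullbackMetric, pullbackMetric, hf.fderiv_eq, hf.self_of_nhds]

theorem metricVariation_congr {V F : Type*} [NormedAddCommGroup V] [NormedSpace ℝ V]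
    [NormedAddCommGroup F] [NormedSpace ℝ F] {g : F → F →L[ℝ] F →L[ℝ] ℝ} {f f' Y : V → F} {z : V}
    (hf : f =ᶠ[nhds z] f') : metricVariation g f Y z = metricVariation g f' Y z := by
  funext u w
  rw [metricVariation, metricVariation, hf.fderiv_eq, hf.self_of_nhds]

theorem metricVariation_symm {V F : Type*} [NormedAddCommGroup V] [NormedSpace ℝ V]
    [NormedAddCommGroup F] [NormedSpace ℝ F] [FiniteDimensional ℝ F]
    {g : F → F →L[ℝ] F →L[ℝ] ℝ} {f Y : V → F} {z : V}
    (hg : DifferentiableAt ℝ g (f z))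
    (hs : ∀ᶠ q in nhds (f z), ∀ u v, g q u v = g q v u) (u w : V) :
    metricVariation g f Y z u w = metricVariation g f Y z w u := by
  rw [metricVariation, metricVariation, fderiv_symm hg hs, hs.self_of_nhds (fderiv ℝ Y z u),
    hs.self_of_nhds (fderiv ℝ f z u)]
  ring

namespace NullCoordinates

variable {f : Plane → Plane × Plane} {N : Set Plane} {σ v k : Plane → ℝ} {t : Plane → Plane}
  {P : Plane → Plane × Plane}
variable (X : NullCoordinates T h J f N σ v k t P) (C : KaehlerChart T h J)
include X C

/-- For coordinate vectors p, q the variation of the metric is ∂_p G(Y, f_q) + ∂_q G(Y, f_p) - 2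
G(Y, D_p f_q). Here D_p f_q = (0, -k t), and G(Y, (0, t)) = -Ω(Y, (0, Jt)) = -∂_q u by the
Hamiltonian condition, which turns the last term into -2k ∂_q u. -/
theorem metricVariation_dual {Y : Plane → Plane × Plane} {u : Plane → ℝ} {z : Plane} (hz : z ∈ N)
    (hY : DifferentiableAt ℝ Y z)
    (hu : ∀ w, omegaOf h (f z) (Y z) (fderiv ℝ f z w) = fderiv ℝ u z w) :
    metricVariation (neutralOf h J) f Y z (dualFst (fderiv ℝ σ z) (fderiv ℝ v z))
        (dualSnd (fderiv ℝ σ z) (fderiv ℝ v z)) =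
      fderiv ℝ (fun y => neutralOf h J (f y) (Y y) (0, J (f y).1 (t y))) z
        (dualFst (fderiv ℝ σ z) (fderiv ℝ v z)) +
      fderiv ℝ (fun y => neutralOf h J (f y) (Y y) (P y)) z
        (dualSnd (fderiv ℝ σ z) (fderiv ℝ v z)) -
      2 * k z * fderiv ℝ u z (dualSnd (fderiv ℝ σ z) (fderiv ℝ v z)) := by
  have hT := X.mem z hz
  have hD := X.det_ne hz
  have hg : DifferentiableAt ℝ (neutralOf h J) (f z) :=
    (C.contDiffAt_neutralOf hT).differentiableAt (by simp)
  have hf := (X.smooth z hz).differentiableAt (by simp)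
  have hn := ((X.smooth_normal C hz).differentiableAt (by simp))
  have hP := ((X.smooth_vector z hz).differentiableAt (by simp))
  have hn' : fderiv ℝ (fun y => ((0 : Plane), J (f y).1 (t y))) z
      (dualFst (fderiv ℝ σ z) (fderiv ℝ v z)) =
        (0, -(k z • t z) - christoffel h (f z).1 (t z) (J (f z).1 (t z))) := by
    rw [((hasFDerivAt_const (0 : Plane) z).prodMk hn.hasFDerivAt).fderiv]
    simp [X.fderiv_normal z hz, fst_dualFst hD]
  have hP' := X.fderiv_vector C hz (dualSnd (fderiv ℝ σ z) (fderiv ℝ v z))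
  have hfp := X.fderiv_eq z hz (dualFst (fderiv ℝ σ z) (fderiv ℝ v z))
  have hfq := X.fderiv_eq z hz (dualSnd (fderiv ℝ σ z) (fderiv ℝ v z))
  simp only [fst_dualFst hD, snd_dualFst hD, fst_dualSnd hD, snd_dualSnd hD, one_smul, zero_smul,
    add_zero, zero_add] at hP' hfp hfq
  rw [fderiv_metric_apply hg hf hY ((differentiableAt_const (0 : Plane)).prodMk hn),
    fderiv_metric_apply hg hf hY hP, metricVariation, ← hu, hn', hP', hfp, hfq]
  have hs := C.neutralOf_symm_eventually hT
  -- Koszul's formula for G(D_P(0, Jt), Y): it accounts for all derivatives of the ambient metric in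
  -- the identity.
  have hCF := C.christoffelFirst_vertical hT (P z) (Y z) (J (f z).1 (t z))
  rw [christoffelFirst_apply, fderiv_symm hg hs (P z), fderiv_symm hg hs _ (P z), X.vector_fst z hz]
    at hCF
  have hΩ : omegaOf h (f z) (Y z) (0, J (f z).1 (t z)) = -h (f z).1 (J (f z).1 (t z)) (Y z).1 := by
    rw [omegaOf_apply, connectionOf_apply _ (0, _), C.symm _ hT (Y z).1]
    simp
  rw [hΩ, C.neutralOf_symm hT (Y z) (0, _), C.neutralOf_vertical hT,
    C.neutralOf_symm hT (P z)]
  simp only [map_sub, map_neg, map_smul, sub_apply, neg_apply, smul_apply, smul_eq_mul]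
  linarith

/-- The vector field whose divergence is the variation of the area element. -/
theorem planeDiv_variation {Y : Plane → Plane × Plane} {u : Plane → ℝ} {z : Plane} (hz : z ∈ N)
    (hY : ContDiffAt ℝ ∞ Y z) (hu' : ContDiffAt ℝ ∞ u z)
    (hu : ∀ w, omegaOf h (f z) (Y z) (fderiv ℝ f z w) = fderiv ℝ u z w) {Z : Plane → Plane}
    (hZ : ∀ᶠ y in nhds z, Z y = Real.sqrt |(gram (pullbackMetric (neutralOf h J) f y)).det| •
      (tangentPart (neutralOf h J) f y (Y y) + (2 * u y) • tangentPart (neutralOf h J) f y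
        (complexOf h J (f y) (meanCurvature (neutralOf h J) f y)))) :
    ContDiffAt ℝ ∞ Z z ∧ planeDiv Z z = -(|coframeDet (fderiv ℝ σ z) (fderiv ℝ v z)| *
      metricVariation (neutralOf h J) f Y z (dualFst (fderiv ℝ σ z) (fderiv ℝ v z))
        (dualSnd (fderiv ℝ σ z) (fderiv ℝ v z))) := by
  have hT := X.mem z hz
  have hD := X.det_ne hz
  set α := fun y => neutralOf h J (f y) (Y y) (0, J (f y).1 (t y)) with hα
  set β := fun y => neutralOf h J (f y) (Y y) (P y) with hβ
  set D := fun y => coframeDet (fderiv ℝ σ y) (fderiv ℝ v y) with hDdef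
  have sg : ContDiffAt ℝ ∞ (fun y => neutralOf h J (f y)) z :=
    (C.contDiffAt_neutralOf hT).comp z (X.smooth z hz)
  have sα : ContDiffAt ℝ ∞ α z :=
    (sg.clm_apply hY).clm_apply (contDiffAt_const.prodMk (X.smooth_normal C hz))
  have sβ : ContDiffAt ℝ ∞ β z := (sg.clm_apply hY).clm_apply (X.smooth_vector z hz)
  have sk := X.smooth_curvature z hz
  have dσ (w : Plane) : ContDiffAt ℝ ∞ (fun y => fderiv ℝ σ y w) z :=
    ((X.smooth_fst z hz).fderiv_right (m := ∞) (by simp)).clm_apply contDiffAt_const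
  have dv (w : Plane) : ContDiffAt ℝ ∞ (fun y => fderiv ℝ v y w) z :=
    ((X.smooth_snd z hz).fderiv_right (m := ∞) (by simp)).clm_apply contDiffAt_const
  have sD : ContDiffAt ℝ ∞ D z := ((dσ (e 0)).mul (dv (e 1))).sub ((dσ (e 1)).mul (dv (e 0)))
  -- D has locally constant sign s, which makes |D| = sD differentiable.
  obtain ⟨s, hs⟩ : ∃ s : ℝ, ∀ᶠ y in nhds z, |D y| = s * D y := by
    rcases lt_or_gt_of_ne hD with hlt | hgt
    · exact ⟨-1, (sD.continuousAt.eventually (gt_mem_nhds hlt)).mono fun y hy => by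
        rw [abs_of_neg hy]; ring⟩
    · exact ⟨1, (sD.continuousAt.eventually (lt_mem_nhds hgt)).mono fun y hy => by
        rw [abs_of_pos hy]; ring⟩
  have hN := X.isOpen.eventually_mem hz
  -- With p, q dual to dσ, dv, the fields D p = (∂₁v, -∂₀v) and D q = (-∂₁σ, ∂₀σ) are divergence
  -- free. Writing Z as a combination of them leaves only the derivatives of the coefficients: α
  -- along p, and β - 2uk along q.
  set Z₁ := fun y => (-(s * α y)) • (fderiv ℝ v y (e 1) • e 0 - fderiv ℝ v y (e 0) • e 1)
  set Z₂ := fun y => (s * (β y - 2 * (u y * k y))) •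
    (fderiv ℝ σ y (e 1) • e 0 - fderiv ℝ σ y (e 0) • e 1)
  have hZ' : Z =ᶠ[nhds z] fun y => Z₁ y + Z₂ y := by
    filter_upwards [hZ, hs, hN] with y h1 h2 h3
    have hDy : D y ≠ 0 := X.det_ne h3
    have h4 : Real.sqrt |(gram (pullbackMetric (neutralOf h J) f y)).det| = |D y| := by
      rw [gram_coframe (X.pullbackMetric_eq C h3), abs_neg, abs_of_nonneg (sq_nonneg _),
        Real.sqrt_sq_eq_abs]
    rw [h1, h4, h2, X.tangentPart_eq C h3, X.tangentPart_complex_meanCurvature C h3]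
    change (s * D y) • (-(α y • _) - β y • _ + _) = _
    simp only [dualFst, dualSnd, Z₁, Z₂]
    change (s * D y) • (-(α y • (D y)⁻¹ • _) - β y • (D y)⁻¹ • _ + (2 * u y) • k y • (D y)⁻¹ • _) = _
    match_scalars <;> field_simp <;> ring
  have sa : ContDiffAt ℝ ∞ (fun y => -(s * α y)) z := (contDiffAt_const.mul sα).neg
  have sb : ContDiffAt ℝ ∞ (fun y => s * (β y - 2 * (u y * k y))) z :=
    contDiffAt_const.mul (sβ.sub (contDiffAt_const.mul (hu'.mul sk)))
  have s1 : ContDiffAt ℝ ∞ Z₁ z :=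
    sa.smul (((dv (e 1)).smul contDiffAt_const).sub ((dv (e 0)).smul contDiffAt_const))
  have s2 : ContDiffAt ℝ ∞ Z₂ z :=
    sb.smul (((dσ (e 1)).smul contDiffAt_const).sub ((dσ (e 0)).smul contDiffAt_const))
  refine ⟨(s1.add s2).congr_of_eventuallyEq hZ', ?_⟩
  have dd {E : Type} [NormedAddCommGroup E] [NormedSpace ℝ E] {g : Plane → E}
      (hg : ContDiffAt ℝ ∞ g z) : DifferentiableAt ℝ g z := hg.differentiableAt (by simp)
  have e1 : planeDiv Z z = planeDiv Z₁ z + planeDiv Z₂ z := by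
    unfold planeDiv
    rw [hZ'.fderiv_eq, fderiv_fun_add (dd s1) (dd s2)]
    simp
    ring
  rw [e1, planeDiv_smul_rotated (dd sa) (X.smooth_snd z hz),
    planeDiv_smul_rotated (dd sb) (X.smooth_fst z hz), X.metricVariation_dual C hz (dd hY) hu]
  have h1 : fderiv ℝ v z (e 1) • e 0 - fderiv ℝ v z (e 0) • e 1 =
      D z • dualFst (fderiv ℝ σ z) (fderiv ℝ v z) := by
    rw [dualFst, smul_inv_smul₀ hD]
  have h2 : fderiv ℝ σ z (e 1) • e 0 - fderiv ℝ σ z (e 0) • e 1 =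
      -(D z • dualSnd (fderiv ℝ σ z) (fderiv ℝ v z)) := by
    rw [dualSnd, smul_inv_smul₀ hD]; abel
  obtain ⟨r, hr⟩ := X.fderiv_curvature z hz
  -- The curvature is constant along the fibres. This is the Euler equation, and it removes the term
  -- 2u ∂_v k, the only one in which u is not differentiated.
  have hkq : fderiv ℝ k z (dualSnd (fderiv ℝ σ z) (fderiv ℝ v z)) = 0 := by
    rw [hr]; simp [fst_dualSnd hD]
  have h3 : fderiv ℝ (fun y => -(s * α y)) z = -(s • fderiv ℝ α z) :=
    ((dd sα).hasFDerivAt.const_mul s).neg.fderiv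
  have h4 : fderiv ℝ (fun y => s * (β y - 2 * (u y * k y))) z = s • (fderiv ℝ β z -
      (2 : ℝ) • (u z • fderiv ℝ k z + k z • fderiv ℝ u z)) :=
    (((dd sβ).hasFDerivAt.sub
      (((dd hu').hasFDerivAt.mul (dd sk).hasFDerivAt).const_mul 2)).const_mul s).fderiv
  rw [h1, h2, h3, h4, hs.self_of_nhds]
  simp only [map_smul, map_neg, neg_apply, smul_apply, sub_apply, add_apply, smul_eq_mul, hkq]
  ring

end NullCoordinates

/-- A surface that is locally an affine normal bundle is a critical point of the area under
Hamiltonian variations. -/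
theorem hasDerivAt_area (C : KaehlerChart T h J) {U A : Set Plane} {f : Plane → Plane × Plane}
    (hU : IsOpen U)
    (hN : ∀ z ∈ U, ∃ (N : Set Plane) (σ v k : Plane → ℝ) (t : Plane → Plane)
      (P : Plane → Plane × Plane), z ∈ N ∧ NullCoordinates T h J f N σ v k t P)
    (hA : IsCompact A) (hAU : A ⊆ U) {Φ : ℝ → Plane → Plane × Plane}
    (hΦ : ∀ z ∈ U, ContDiffAt ℝ ∞ (fun p : ℝ × Plane => Φ p.1 p.2) (0, z))
    (h0 : ∀ z ∈ U, Φ 0 z = f z) (hfix : ∀ᶠ ε in nhds (0 : ℝ), ∀ z ∈ U \ A, Φ ε z = f z)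
    {u : Plane → ℝ} (hu : ContDiff ℝ ∞ u) (huc : HasCompactSupport u) (huU : tsupport u ⊆ U)
    (hham : ∀ z ∈ U, ∀ w : Plane,
      omegaOf h (f z) (deriv (fun ε => Φ ε z) 0) (fderiv ℝ f z w) = fderiv ℝ u z w) :
    HasDerivAt (fun ε => area (neutralOf h J) (Φ ε) A) 0 0 := by
  set Ψ : ℝ × Plane → Plane × Plane := fun p => Φ p.1 p.2 with hΨ
  set Y := variationVector Ψ with hY
  set g := neutralOf h J with hg
  have hYd : ∀ z ∈ U, deriv (fun ε => Φ ε z) 0 = Y z := fun z hz =>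
    (hasDerivAt_slice ((hΦ z hz).differentiableAt (by simp))).deriv
  have hY0 : ∀ z ∈ U \ A, Y z = 0 := by
    intro z hz
    rw [← hYd z hz.1, Filter.EventuallyEq.deriv_eq (hfix.mono fun ε hε => hε z hz), deriv_const]
  have hfΦ : ∀ z ∈ U, Φ 0 =ᶠ[nhds z] f := fun z hz => (hU.eventually_mem hz).mono h0
  have sY : ∀ z ∈ U, ContDiffAt ℝ ∞ Y z := fun z hz => smooth_variationVector (hΦ z hz)
  -- The first variation of area is div Yᵀ - 2G(H, Y). For a Hamiltonian variation -2G(H, Y) = 2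
  -- du(𝕁H), and this equals 2 div(u 𝕁H) because div 𝕁H = 0.
  set Z₀ : Plane → Plane := fun y => Real.sqrt |(gram (pullbackMetric g f y)).det| •
      (tangentPart g f y (Y y) + (2 * u y) • tangentPart g f y
        (complexOf h J (f y) (meanCurvature g f y))) with hZ₀
  set Z := U.indicator Z₀ with hZ
  -- Off A the variation vector vanishes, but u need only be locally constant there; the support of
  -- u must be added.
  have hK : IsCompact (A ∪ tsupport u) := hA.union huc
  have hKU : A ∪ tsupport u ⊆ U := union_subset hAU huU
  have hZzero : ∀ z ∉ A ∪ tsupport u, Z z = 0 := by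
    intro z hz
    by_cases hzU : z ∈ U
    · rw [hZ, indicator_of_mem hzU]
      simp only [mem_union, not_or] at hz
      simp [hZ₀, hY0 z ⟨hzU, hz.1⟩, image_eq_zero_of_notMem_tsupport hz.2, tangentPart]
    · exact indicator_of_notMem hzU _
  have hZev : ∀ z ∉ U, Z =ᶠ[nhds z] fun _ => 0 := fun z hz =>
    (hK.isClosed.isOpen_compl.eventually_mem (fun hz' => hz (hKU hz'))).mono hZzero
  have hZU : ∀ z ∈ U, ∀ᶠ y in nhds z, Z y = Z₀ y := fun z hz =>
    (hU.eventually_mem hz).mono fun y hy => indicator_of_mem hy _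
  have hT : ∀ z ∈ U, (Φ 0 z).1 ∈ T := by
    intro z hz
    obtain ⟨N, σ, v, k, t, P, hzN, X⟩ := hN z hz
    rw [h0 z hz]; exact X.mem z hzN
  have sg : ∀ z ∈ U, ContDiffAt ℝ ∞ g (Ψ (0, z)) := fun z hz => C.contDiffAt_neutralOf (hT z hz)
  have key : ∀ z ∈ U, ContDiffAt ℝ ∞ Z z ∧ gramDet g Ψ (0, z) ≠ 0 ∧
      HasDerivAt (fun ε => Real.sqrt |gramDet g Ψ (ε, z)|) (planeDiv Z z) 0 := by
    intro z hz
    obtain ⟨N, σ, v, k, t, P, hzN, X⟩ := hN z hz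
    obtain ⟨h1, h2⟩ := X.planeDiv_variation C hzN (sY z hz) hu.contDiffAt
      (fun w => by rw [← hYd z hz]; exact hham z hz w) (hZU z hz)
    have hpb : pullbackMetric g (fun y => Ψ (0, y)) z = pullbackMetric g f z :=
      pullbackMetric_congr (hfΦ z hz)
    have hmv : metricVariation g (fun y => Ψ (0, y)) Y z = metricVariation g f Y z :=
      metricVariation_congr (hfΦ z hz)
    refine ⟨h1, ?_, ?_⟩
    · rw [gramDet]
      simp only [hpb]
      rw [gram_coframe (X.pullbackMetric_eq C hzN)]
      exact neg_ne_zero.2 (pow_ne_zero 2 (X.det_ne hzN))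
    · rw [h2, ← hmv]
      refine hasDerivAt_areaElement (hΦ z hz) ((sg z hz).differentiableAt (by simp))
        (metricVariation_symm ((sg z hz).differentiableAt (by simp))
          (C.neutralOf_symm_eventually (hT z hz))) (X.det_ne hzN) fun u w => ?_
      rw [hpb]; exact X.pullbackMetric_eq C hzN u w
  have sZ : ContDiff ℝ ∞ Z := by
    rw [contDiff_iff_contDiffAt]
    intro z
    by_cases hz : z ∈ U
    · exact (key z hz).1
    · exact contDiffAt_const.congr_of_eventuallyEq (hZev z hz)
  have cZ : HasCompactSupport Z := HasCompactSupport.intro hK hZzero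
  have sF : ∀ z ∈ A, ContDiffAt ℝ 1 (fun p => Real.sqrt |gramDet g Ψ p|) (0, z) := by
    intro z hz
    have hne := (key z (hAU hz)).2.1
    exact (((smooth_gramDet (hΦ z (hAU hz)) (sg z (hAU hz))).abs hne).sqrt
      (abs_ne_zero.2 hne)).of_le (by norm_cast)
  have e1 := hasDerivAt_setIntegral MeasureTheory.volume hA sF
  refine e1.congr_deriv ?_
  have e2 : ∀ z ∈ A, fderiv ℝ (fun p => Real.sqrt |gramDet g Ψ p|) (0, z) (1, 0) = planeDiv Z z :=
    fun z hz => (hasDerivAt_slice ((sF z hz).differentiableAt (by simp))).unique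
      (key z (hAU hz)).2.2
  rw [MeasureTheory.setIntegral_congr_fun hA.measurableSet e2,
    MeasureTheory.setIntegral_eq_integral_of_forall_compl_eq_zero,
    integral_planeDiv (sZ.of_le (by norm_cast)) cZ]
  -- Off A the surface does not move, so the variation of its area element, and with it the
  -- divergence of Z, is zero. Hence the integral over A is the integral over the whole plane.
  intro z hzA
  by_cases hz : z ∈ U
  · have h1 := (key z hz).2.2
    refine h1.unique ?_
    have h2 : ∀ᶠ ε in nhds (0 : ℝ), gramDet g Ψ (ε, z) = gramDet g Ψ (0, z) := by
      filter_upwards [hfix] with ε hε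
      have hev : (fun y => Φ ε y) =ᶠ[nhds z] fun y => Φ 0 y := by
        filter_upwards [hU.eventually_mem hz, hA.isClosed.isOpen_compl.eventually_mem hzA]
          with y hy hyA
        rw [hε y ⟨hy, hyA⟩, h0 y hy]
      rw [gramDet, gramDet]
      exact congrArg (fun m => (gram m).det) (pullbackMetric_congr hev)
    exact (hasDerivAt_const (0 : ℝ) (Real.sqrt |gramDet g Ψ (0, z)|)).congr_of_eventuallyEq
      (h2.mono fun ε hε => congrArg (fun x => Real.sqrt |x|) hε)
  · rw [planeDiv, (hZev z hz).fderiv_eq]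
    simp


variable {T : Set Plane} {h : Plane → Plane →L[ℝ] Plane →L[ℝ] ℝ} {J : Plane → Plane →L[ℝ] Plane}

/-! ### Lagrangian surfaces of rank one in coordinates -/

/-- A function `σ`, a unit vector field `E` along the base and the normal coordinate `τ` of a rank
one Lagrangian surface `f`. -/
structure RankOneFrame (T : Set Plane) (h : Plane → Plane →L[ℝ] Plane →L[ℝ] ℝ)
    (J : Plane → Plane →L[ℝ] Plane) (f : Plane → Plane × Plane) (B : Set Plane)
    (σ τ : Plane → ℝ) (E : Plane → Plane) : Prop where
  isOpen : IsOpen B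
  mem : ∀ z ∈ B, (f z).1 ∈ T
  smooth : ∀ z ∈ B, ContDiffAt ℝ ∞ f z
  smooth_fst : ∀ z ∈ B, ContDiffAt ℝ ∞ σ z
  smooth_snd : ∀ z ∈ B, ContDiffAt ℝ ∞ τ z
  smooth_tangent : ∀ z ∈ B, ContDiffAt ℝ ∞ E z
  unit : ∀ z ∈ B, h (f z).1 (E z) (E z) = 1
  fderiv_base : ∀ z ∈ B, ∀ u, fderiv ℝ (fun y => (f y).1) z u = fderiv ℝ σ z u • E z
  fderiv_tangent : ∀ z ∈ B, ∀ u, fderiv ℝ σ z u = 0 → fderiv ℝ E z u = 0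
  orthogonal : ∀ z ∈ B, ∀ u, fderiv ℝ σ z u = 0 →
    h (f z).1 (fderiv ℝ (fun y => (f y).2) z u) (E z) = 0
  snd_eq : ∀ z ∈ B, τ z = h (f z).1 (f z).2 (J (f z).1 (E z))
  indep : ∀ z ∈ B, ∀ u, fderiv ℝ σ z u = 0 → fderiv ℝ τ z u = 0 → u = 0

/-- σ is arc length along the image curve, obtained as a primitive of λ = h(E, dx). The Lagrangian
condition is used only for `orthogonal`, and the immersion only for `indep`. -/
theorem exists_rankOneFrame (C : KaehlerChart T h J) {f : Plane → Plane × Plane} {U : Set Plane}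
    (hU : IsOpen U) (hmem : ∀ z ∈ U, (f z).1 ∈ T) (hf : ∀ z ∈ U, ContDiffAt ℝ ∞ f z)
    (hinj : ∀ z ∈ U, ∀ u, fderiv ℝ f z u = 0 → u = 0)
    (hrank : ∀ z ∈ U, Module.finrank ℝ
      (LinearMap.range (fderiv ℝ (fun y => (f y).1) z).toLinearMap) = 1)
    (hLag : ∀ z ∈ U, ∀ u w, omegaOf h (f z) (fderiv ℝ f z u) (fderiv ℝ f z w) = 0)
    {z₀ : Plane} (hz₀ : z₀ ∈ U) :
    ∃ (B : Set Plane) (σ τ : Plane → ℝ) (E : Plane → Plane), z₀ ∈ B ∧ B ⊆ U ∧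
      RankOneFrame T h J f B σ τ E := by
  set x : Plane → Plane := fun y => (f y).1 with hx
  have sx : ∀ z ∈ U, ContDiffAt ℝ ∞ x z := fun z hz => contDiffAt_fst.comp z (hf z hz)
  have sy : ∀ z ∈ U, ContDiffAt ℝ ∞ (fun y => (f y).2) z := fun z hz =>
    contDiffAt_snd.comp z (hf z hz)
  have sdx : ∀ z ∈ U, ContDiffAt ℝ ∞ (fderiv ℝ x) z := fun z hz =>
    (sx z hz).fderiv_right (by simp)
  obtain ⟨w, hw⟩ : ∃ w, fderiv ℝ x z₀ w ≠ 0 := by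
    by_contra! hcon
    have : fderiv ℝ x z₀ = 0 := ContinuousLinearMap.ext hcon
    have h1 := hrank z₀ hz₀
    have h2 : (fderiv ℝ (fun y => (f y).1) z₀).toLinearMap = 0 := by rw [this]; rfl
    rw [h2, LinearMap.range_zero, finrank_bot] at h1
    exact zero_ne_one h1
  have hev : ∀ᶠ z in nhds z₀, fderiv ℝ x z w ≠ 0 :=
    ((sdx z₀ hz₀).continuousAt.clm_apply continuousAt_const).eventually_ne hw
  -- A ball, because the Poincaré lemma below is applied on a convex set.
  obtain ⟨r, hr, hball⟩ := Metric.eventually_nhds_iff_ball.1 (hev.and (hU.eventually_mem hz₀))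
  set B := Metric.ball z₀ r with hB
  have hBo : IsOpen B := Metric.isOpen_ball
  have hBU : ∀ z ∈ B, z ∈ U := fun z hz => (hball z hz).2
  have hBw : ∀ z ∈ B, fderiv ℝ x z w ≠ 0 := fun z hz => (hball z hz).1
  set q : Plane → ℝ := fun z => h (x z) (fderiv ℝ x z w) (fderiv ℝ x z w) with hq
  have hqpos : ∀ z ∈ B, 0 < q z := fun z hz => C.pos _ (hmem z (hBU z hz)) _ (hBw z hz)
  set E : Plane → Plane := fun z => (Real.sqrt (q z))⁻¹ • fderiv ℝ x z w with hE
  have shx : ∀ z ∈ B, ContDiffAt ℝ ∞ (fun y => h (x y)) z := fun z hz =>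
    (C.smooth_metric _ (hmem z (hBU z hz))).comp z (sx z (hBU z hz))
  have sJx : ∀ z ∈ B, ContDiffAt ℝ ∞ (fun y => J (x y)) z := fun z hz =>
    (C.smooth_rot _ (hmem z (hBU z hz))).comp z (sx z (hBU z hz))
  have sE : ∀ z ∈ B, ContDiffAt ℝ ∞ E z := by
    intro z hz
    have h1 : ContDiffAt ℝ ∞ (fun y => fderiv ℝ x y w) z :=
      (sdx z (hBU z hz)).clm_apply contDiffAt_const
    have h2 : ContDiffAt ℝ ∞ q z := ((shx z hz).clm_apply h1).clm_apply h1
    exact ((h2.sqrt (hqpos z hz).ne').inv (Real.sqrt_pos.2 (hqpos z hz)).ne').smul h1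
  have hunit : ∀ z ∈ B, h (x z) (E z) (E z) = 1 := by
    intro z hz
    have h1 : Real.sqrt (q z) ≠ 0 := (Real.sqrt_pos.2 (hqpos z hz)).ne'
    have h2 : h (x z) (E z) (E z) = (Real.sqrt (q z))⁻¹ * ((Real.sqrt (q z))⁻¹ * q z) := by
      simp [hE, hq]
    rw [h2]
    nth_rewrite 3 [← Real.mul_self_sqrt (hqpos z hz).le]
    field_simp
  -- As the image of dx is the line of E, this form is the coefficient in dx = λ ⊗ E.
  set lam : Plane → Plane →L[ℝ] ℝ := fun z => h (x z) (E z) ∘L fderiv ℝ x z with hlam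
  have hdx : ∀ z ∈ B, ∀ u, fderiv ℝ x z u = lam z u • E z := by
    intro z hz u
    have hfr := hrank z (hBU z hz)
    have hEmem : E z ∈ LinearMap.range (fderiv ℝ x z).toLinearMap :=
      ⟨(Real.sqrt (q z))⁻¹ • w, by simp [hE]⟩
    have hE0 : (⟨E z, hEmem⟩ : LinearMap.range (fderiv ℝ x z).toLinearMap) ≠ 0 := by
      intro h0
      have h1 : E z = 0 := congrArg Subtype.val h0
      have := hunit z hz
      rw [h1] at this
      simp at this
    obtain ⟨a, ha⟩ := (finrank_eq_one_iff_of_nonzero' _ hE0).1 hfr ⟨fderiv ℝ x z u, ⟨u, rfl⟩⟩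
    have ha' : a • E z = fderiv ℝ x z u := congrArg Subtype.val ha
    simp only [hlam, ContinuousLinearMap.comp_apply]
    rw [← ha', map_smul, hunit z hz]
    simp
  have slam : ∀ z ∈ B, ContDiffAt ℝ ∞ lam z := fun z hz =>
    ((shx z hz).clm_apply (sE z hz)).clm_comp (sdx z (hBU z hz))
  have dd {G : Type} [NormedAddCommGroup G] [NormedSpace ℝ G] {g : Plane → G} {z : Plane}
      (hg : ContDiffAt ℝ ∞ g z) : DifferentiableAt ℝ g z := hg.differentiableAt (by simp)
  have hdE : ∀ z ∈ B, ∀ u, h (x z) (fderiv ℝ E z u) (E z) +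
      h (x z) (christoffel h (x z) (fderiv ℝ x z u) (E z)) (E z) = 0 := by
    intro z hz u
    have hT := hmem z (hBU z hz)
    have hh : DifferentiableAt ℝ h (x z) := (C.smooth_metric _ hT).differentiableAt (by simp)
    have e1 := fderiv_metric_apply hh (dd (sx z (hBU z hz))) (dd (sE z hz)) (dd (sE z hz)) u
    have e2 : (fun y => h (x y) (E y) (E y)) =ᶠ[nhds z] fun _ => 1 :=
      (hBo.eventually_mem hz).mono hunit
    rw [e2.fderiv_eq, fderiv_metric (C.nondegenerate hT) hh (C.symm_eventually hT),
      C.symm _ hT (E z), C.symm _ hT (E z)] at e1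
    simp at e1
    linarith
  -- Dλ(u)(v) = h(∇_u E, dx v) + h(E, ∇_u(dx v)). The first term vanishes since dx v is proportional
  -- to E and |E| = 1, and the second is symmetric in u, v.
  have hclosed : ∀ z ∈ B, ∀ u v, fderiv ℝ lam z u v = fderiv ℝ lam z v u := by
    intro z hz
    have hT := hmem z (hBU z hz)
    have hh : DifferentiableAt ℝ h (x z) := (C.smooth_metric _ hT).differentiableAt (by simp)
    have key (u v : Plane) : fderiv ℝ lam z u v =
        h (x z) (E z) (christoffel h (x z) (fderiv ℝ x z u) (fderiv ℝ x z v)) +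
          h (x z) (E z) (fderiv ℝ (fderiv ℝ x) z u v) := by
      have e1 : fderiv ℝ (fun y => lam y v) z u = fderiv ℝ lam z u v := by
        rw [(hasFDerivAt_clm_const (dd (slam z hz)) v).fderiv]; rfl
      have e2 := fderiv_metric_apply hh (dd (sx z (hBU z hz))) (dd (sE z hz))
        (hasFDerivAt_clm_const (dd (sdx z (hBU z hz))) v).differentiableAt u
      rw [(hasFDerivAt_clm_const (dd (sdx z (hBU z hz))) v).fderiv,
        fderiv_metric (C.nondegenerate hT) hh (C.symm_eventually hT)] at e2
      have e3 : fderiv ℝ (fun y => lam y v) z u = _ := e2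
      have e4 := hdE z hz u
      have e5 : h (x z) (christoffel h (x z) (fderiv ℝ x z u) (E z)) (fderiv ℝ x z v) +
          h (x z) (fderiv ℝ E z u) (fderiv ℝ x z v) = 0 := by
        rw [hdx z hz v, map_smul (h (x z) (fderiv ℝ E z u)), map_smul (h (x z) _) (lam z v) (E z),
          smul_eq_mul, smul_eq_mul]
        linear_combination (lam z v) * e4
      rw [← e1, e3, ContinuousLinearMap.flip_apply]
      linear_combination e5
    intro u v
    have sym : IsSymmSndFDerivAt ℝ x z := (sx z (hBU z hz)).isSymmSndFDerivAt (by simp; norm_cast)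
    rw [key, key, sym.eq u v, christoffel_symm hh (C.symm_eventually hT)]
  obtain ⟨σ, hσ⟩ := (convex_ball z₀ r).exists_forall_hasFDerivAt_of_fderiv_symmetric hBo
    (fun z hz => (dd (slam z hz)).differentiableWithinAt) hclosed
  have hdσ : ∀ z ∈ B, fderiv ℝ σ z = lam z := fun z hz => (hσ z hz).fderiv
  have sσ : ∀ z ∈ B, ContDiffAt ℝ ∞ σ z := by
    have : ContDiffOn ℝ ∞ σ B := by
      rw [contDiffOn_infty_iff_fderiv_of_isOpen hBo]
      exact ⟨fun z hz => (hσ z hz).differentiableAt.differentiableWithinAt, fun z hz =>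
        (slam z hz).contDiffWithinAt.congr hdσ (hdσ z hz)⟩
    exact fun z hz => this.contDiffAt (hBo.mem_nhds hz)
  -- Differentiating dx = λ ⊗ E gives D²x(u, w) = Dλ(u)(w) E + λ(w) DE(u). Exchanging u and w, with
  -- Dλ symmetric and λ(u) = 0, leaves λ(w) DE(u) = 0, where λ(w) ≠ 0.
  have hker : ∀ z ∈ B, ∀ u, lam z u = 0 → fderiv ℝ E z u = 0 := by
    intro z hz u hu
    have sym : IsSymmSndFDerivAt ℝ x z := (sx z (hBU z hz)).isSymmSndFDerivAt (by simp; norm_cast)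
    have key (u v : Plane) : fderiv ℝ (fderiv ℝ x) z u v =
        fderiv ℝ lam z u v • E z + lam z v • fderiv ℝ E z u := by
      have e1 : (fun y => fderiv ℝ x y v) =ᶠ[nhds z] fun y => lam y v • E y :=
        (hBo.eventually_mem hz).mono fun y hy => hdx y hy v
      have e2 := ((hasFDerivAt_clm_const (dd (slam z hz)) v).smul
        (dd (sE z hz)).hasFDerivAt).congr_of_eventuallyEq e1
      have e3 := congrArg (fun l : Plane →L[ℝ] Plane => l u)
        (e2.unique (hasFDerivAt_clm_const (dd (sdx z (hBU z hz))) v))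
      simp at e3
      rw [← e3]; abel
    have e1 := sym.eq u w
    rw [key, key, hclosed z hz u w, add_right_inj, hu, zero_smul] at e1
    refine (smul_eq_zero.1 e1).resolve_left fun h0 => hBw z hz ?_
    rw [hdx z hz, h0, zero_smul]
  have hfd : ∀ z ∈ U, ∀ u, fderiv ℝ f z u = (fderiv ℝ x z u, fderiv ℝ (fun y => (f y).2) z u) := by
    intro z hz u
    have : HasFDerivAt f _ z := (dd (sx z hz)).hasFDerivAt.prodMk (dd (sy z hz)).hasFDerivAt
    rw [this.fderiv]; rfl
  -- Test Ω against the direction that dx maps to E: for u in ker λ only h(dy(u), E) survives.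
  have horth : ∀ z ∈ B, ∀ u, lam z u = 0 →
      h (x z) (fderiv ℝ (fun y => (f y).2) z u) (E z) = 0 := by
    intro z hz u hu
    have e1 := hLag z (hBU z hz) u ((Real.sqrt (q z))⁻¹ • w)
    have e2 : fderiv ℝ x z u = 0 := by rw [hdx z hz, hu, zero_smul]
    have e3 : fderiv ℝ x z ((Real.sqrt (q z))⁻¹ • w) = E z := by simp [hE]
    rw [hfd z (hBU z hz), hfd z (hBU z hz), omegaOf_apply, connectionOf_apply, e2, e3] at e1
    simpa using e1
  have sn : ∀ z ∈ B, ContDiffAt ℝ ∞ (fun y => J (x y) (E y)) z := fun z hz =>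
    (sJx z hz).clm_apply (sE z hz)
  refine ⟨B, σ, fun z => h (x z) (f z).2 (J (x z) (E z)), E, Metric.mem_ball_self hr, hBU, ?_⟩
  constructor
  · exact hBo
  · exact fun z hz => hmem z (hBU z hz)
  · exact fun z hz => hf z (hBU z hz)
  · exact sσ
  · exact fun z hz => ((shx z hz).clm_apply (sy z (hBU z hz))).clm_apply (sn z hz)
  · exact sE
  · exact hunit
  · intro z hz u
    rw [hdσ z hz]; exact hdx z hz u
  · intro z hz u hu
    rw [hdσ z hz] at hu; exact hker z hz u hu
  · intro z hz u hu
    rw [hdσ z hz] at hu; exact horth z hz u hu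
  · exact fun z hz => rfl
  -- Along u neither x nor E moves, so dτ(u) = h(dy(u), JE). Then dy(u) is orthogonal to E and JE,
  -- hence df(u) = 0.
  · intro z hz u hu h2
    rw [hdσ z hz] at hu
    have hT := hmem z (hBU z hz)
    have hh : DifferentiableAt ℝ h (x z) := (C.smooth_metric _ hT).differentiableAt (by simp)
    have hJ : DifferentiableAt ℝ J (x z) := (C.smooth_rot _ hT).differentiableAt (by simp)
    have e2 : fderiv ℝ x z u = 0 := by rw [hdx z hz, hu, zero_smul]
    have e0 : HasFDerivAt (fun y => J (x y)) (fderiv ℝ J (x z) ∘L fderiv ℝ x z) z :=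
      hJ.hasFDerivAt.comp z (dd (sx z (hBU z hz))).hasFDerivAt
    have e3 : fderiv ℝ (fun y => J (x y) (E y)) z u = 0 := by
      rw [(e0.clm_apply (dd (sE z hz)).hasFDerivAt).fderiv]
      simp [e2, hker z hz u hu]
    rw [fderiv_metric_apply hh (dd (sx z (hBU z hz))) (dd (sy z (hBU z hz))) (dd (sn z hz)), e2, e3]
      at h2
    simp at h2
    apply hinj z (hBU z hz)
    rw [hfd z (hBU z hz), e2, C.expand hT (hunit z hz) (fderiv ℝ (fun y => (f y).2) z u),
      horth z hz u hu, h2]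
    simp

theorem norm_lt_of_coordinates {w : Plane} {r : ℝ} (h0 : |w 0| < r / 2) (h1 : |w 1| < r / 2) :
    ‖w‖ < r := by
  have he (i : Fin 2) : ‖e i‖ = 1 := by simp [e]
  rw [plane_eq w]
  calc _ ≤ ‖w 0 • e 0‖ + ‖w 1 • e 1‖ := norm_add_le _ _
    _ = |w 0| + |w 1| := by simp [norm_smul, he]
    _ < r := by linarith

theorem isOpen_box (s₀ s₁ t₀ t₁ : ℝ) :
    IsOpen {z : Plane | z 0 ∈ Ioo s₀ s₁ ∧ z 1 ∈ Ioo t₀ t₁} :=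
  (isOpen_Ioo.preimage (by fun_prop)).inter (isOpen_Ioo.preimage (by fun_prop))

/-- A function on a box whose derivative in the second direction vanishes depends only on the first
coordinate. -/
theorem eq_of_fderiv_snd_eq_zero {G : Type*} [NormedAddCommGroup G] [NormedSpace ℝ G]
    {s₀ s₁ t₀ t₁ : ℝ} {g : Plane → G}
    (hg : ∀ z : Plane, z 0 ∈ Ioo s₀ s₁ → z 1 ∈ Ioo t₀ t₁ → DifferentiableAt ℝ g z)
    (hg' : ∀ z : Plane, z 0 ∈ Ioo s₀ s₁ → z 1 ∈ Ioo t₀ t₁ → fderiv ℝ g z (e 1) = 0)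
    {t : ℝ} (ht : t ∈ Ioo t₀ t₁) {z : Plane} (h0 : z 0 ∈ Ioo s₀ s₁) (h1 : z 1 ∈ Ioo t₀ t₁) :
    g z = g (z 0 • e 0 + t • e 1) := by
  have hd : ∀ r ∈ Ioo t₀ t₁, HasDerivAt (fun r : ℝ => g (z 0 • e 0 + r • e 1)) 0 r := by
    intro r hr
    have e1 : HasDerivAt (fun r : ℝ => z 0 • e 0 + r • e 1) (e 1) r := by
      simpa using ((hasDerivAt_id r).smul_const (e 1)).const_add (z 0 • e 0)
    have m0 : (z 0 • e 0 + r • e 1) 0 = z 0 := by simp [e]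
    have m1 : (z 0 • e 0 + r • e 1) 1 = r := by simp [e]
    have e2 := (hg (z 0 • e 0 + r • e 1) (by rw [m0]; exact h0)
      (by rw [m1]; exact hr)).hasFDerivAt.comp_hasDerivAt r e1
    rw [hg' _ (by rw [m0]; exact h0) (by rw [m1]; exact hr)] at e2
    exact e2
  have := isOpen_Ioo.is_const_of_deriv_eq_zero isPreconnected_Ioo
    (fun r hr => (hd r hr).differentiableAt.differentiableWithinAt) (fun r hr => (hd r hr).deriv) h1 ht
  rw [← this, ← plane_eq z]

/-- Coordinates on a box in which a rank one Lagrangian surface is an affine normal bundle. -/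
theorem RankOneFrame.exists_coordinates (C : KaehlerChart T h J) {f : Plane → Plane × Plane}
    {B : Set Plane} {σ τ : Plane → ℝ} {E : Plane → Plane} (R : RankOneFrame T h J f B σ τ E)
    {z₀ : Plane} (hz₀ : z₀ ∈ B) :
    ∃ (Θ : OpenPartialHomeomorph Plane Plane) (s₀ s₁ t₀ t₁ : ℝ) (c : ℝ → Plane) (a : ℝ → ℝ),
      z₀ ∈ Θ.source ∧ Θ.source ⊆ B ∧ s₀ < s₁ ∧ t₀ < t₁ ∧
      Θ.target = {z | z 0 ∈ Ioo s₀ s₁ ∧ z 1 ∈ Ioo t₀ t₁} ∧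
      (∀ z ∈ Θ.source, ContDiffAt ℝ ∞ Θ z) ∧ (∀ z ∈ Θ.target, ContDiffAt ℝ ∞ Θ.symm z) ∧
      UnitSpeedCurve T h (Ioo s₀ s₁) c ∧ (∀ s ∈ Ioo s₀ s₁, ContDiffAt ℝ ∞ a s) ∧
      ∀ z ∈ Θ.target, f (Θ.symm z) =
        (c (z 0), a (z 0) • deriv c (z 0) + z 1 • J (c (z 0)) (deriv c (z 0))) := by
  set θ : Plane → Plane := fun z => σ z • e 0 + τ z • e 1 with hθ
  have sθ : ∀ z ∈ B, ContDiffAt ℝ ∞ θ z := fun z hz =>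
    ((R.smooth_fst z hz).smul contDiffAt_const).add ((R.smooth_snd z hz).smul contDiffAt_const)
  have hcoord (a b : ℝ) : (a • e 0 + b • e 1) 0 = a ∧ (a • e 0 + b • e 1) 1 = b := by simp [e]
  have hdθ : ∀ z ∈ B, ∀ u, fderiv ℝ θ z u = fderiv ℝ σ z u • e 0 + fderiv ℝ τ z u • e 1 := by
    intro z hz u
    have := ((((R.smooth_fst z hz).differentiableAt (by simp)).hasFDerivAt.smul_const (e 0)).add
      (((R.smooth_snd z hz).differentiableAt (by simp)).hasFDerivAt.smul_const (e 1))).fderiv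
    rw [show fderiv ℝ θ z = _ from this]
    simp
  have hinv : ∀ z ∈ B, (fderiv ℝ θ z).IsInvertible := by
    intro z hz
    refine isInvertible_of_injective ((injective_iff_map_eq_zero _).2 fun u hu => ?_)
    rw [hdθ z hz] at hu
    have h0 := (hcoord (fderiv ℝ σ z u) (fderiv ℝ τ z u)).1
    have h1 := (hcoord (fderiv ℝ σ z u) (fderiv ℝ τ z u)).2
    rw [hu] at h0 h1
    exact R.indep z hz u h0.symm h1.symm
  have hequiv : ∀ z ∈ B, ∃ M : Plane ≃L[ℝ] Plane, HasFDerivAt θ (M : Plane →L[ℝ] Plane) z := by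
    intro z hz
    obtain ⟨M, hM⟩ := hinv z hz
    exact ⟨M, hM ▸ ((sθ z hz).differentiableAt (by simp)).hasFDerivAt⟩
  obtain ⟨M, hM⟩ := hequiv z₀ hz₀
  set Θ₀ := (sθ z₀ hz₀).toOpenPartialHomeomorph θ hM (by simp) with hΘ₀
  have hΘ₀c : (Θ₀ : Plane → Plane) = θ := rfl
  have hs₀ : z₀ ∈ Θ₀.source := (sθ z₀ hz₀).mem_toOpenPartialHomeomorph_source hM (by simp)
  set Θ₁ := Θ₀.restrOpen B R.isOpen with hΘ₁
  have hs₁ : z₀ ∈ Θ₁.source := by rw [hΘ₁, Θ₀.restrOpen_source]; exact ⟨hs₀, hz₀⟩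
  obtain ⟨r, hr, hball⟩ := Metric.isOpen_iff.1 Θ₁.open_target _ (Θ₁.map_source hs₁)
  set p := Θ₁ z₀ with hp
  set Q : Set Plane := {z | z 0 ∈ Ioo (p 0 - r / 2) (p 0 + r / 2) ∧
    z 1 ∈ Ioo (p 1 - r / 2) (p 1 + r / 2)} with hQ
  have hQo : IsOpen Q := isOpen_box _ _ _ _
  have hQt : Q ⊆ Θ₁.target := by
    intro z hz
    apply hball
    rw [mem_ball_iff_norm]
    obtain ⟨⟨a1, a2⟩, a3, a4⟩ := hz
    apply norm_lt_of_coordinates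
    · rw [PiLp.sub_apply, abs_lt]; constructor <;> linarith
    · rw [PiLp.sub_apply, abs_lt]; constructor <;> linarith
  -- Restricting the inverse, not the map itself, makes the target exactly the box Q.
  set Θ := (Θ₁.symm.restrOpen Q hQo).symm with hΘ
  have hΘt : Θ.target = Q := by
    change (Θ₁.symm.restrOpen Q hQo).source = Q
    rw [OpenPartialHomeomorph.restrOpen_source]
    exact inter_eq_right.2 hQt
  have hΘs : ∀ z ∈ Θ.source, z ∈ B := by
    intro z hz
    have h1 : Θ z ∈ Q := hΘt ▸ Θ.map_source hz
    have h2 := Θ₁.map_target (hQt h1)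
    have h3 : Θ₁.symm (Θ z) = z := Θ.left_inv hz
    rw [h3, hΘ₁, Θ₀.restrOpen_source] at h2
    exact h2.2
  have hΘc : (Θ : Plane → Plane) = θ := rfl
  have hz₀s : z₀ ∈ Θ.source := by
    have h1 : p ∈ Θ.target := by
      rw [hΘt]; constructor <;> constructor <;> linarith
    have h2 := Θ.map_target h1
    have h3 : Θ.symm p = z₀ := Θ₁.left_inv hs₁
    rwa [h3] at h2
  have hB' : ∀ z ∈ Q, Θ.symm z ∈ B := fun z hz => hΘs _ (Θ.map_target (hΘt ▸ hz))
  have sΨ : ∀ z ∈ Q, ContDiffAt ℝ ∞ Θ.symm z := by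
    intro z hz
    obtain ⟨M, hM⟩ := hequiv _ (hB' z hz)
    exact Θ.contDiffAt_symm (hΘt ▸ hz) hM (sθ _ (hB' z hz))
  have hσΨ : ∀ z ∈ Q, σ (Θ.symm z) = z 0 ∧ τ (Θ.symm z) = z 1 := by
    intro z hz
    have h1 : θ (Θ.symm z) = z := Θ.right_inv (hΘt ▸ hz)
    have h2 := hcoord (σ (Θ.symm z)) (τ (Θ.symm z))
    constructor
    · rw [← h2.1]; exact congrArg (fun y : Plane => y 0) h1
    · rw [← h2.2]; exact congrArg (fun y : Plane => y 1) h1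
  have dd {V G : Type} [NormedAddCommGroup V] [NormedSpace ℝ V] [NormedAddCommGroup G]
      [NormedSpace ℝ G] {g : V → G} {z : V}
      (hg : ContDiffAt ℝ ∞ g z) : DifferentiableAt ℝ g z := hg.differentiableAt (by simp)
  have hdσ : ∀ z ∈ Q, ∀ u, fderiv ℝ σ (Θ.symm z) (fderiv ℝ Θ.symm z u) = u 0 := by
    intro z hz u
    have e1 := (dd (R.smooth_fst _ (hB' z hz))).hasFDerivAt.comp z (dd (sΨ z hz)).hasFDerivAt
    have e2 : HasFDerivAt (fun y : Plane => y 0) (EuclideanSpace.proj 0 : Plane →L[ℝ] ℝ) z :=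
      (EuclideanSpace.proj 0 : Plane →L[ℝ] ℝ).hasFDerivAt
    have e3 := e2.congr_of_eventuallyEq (f₁ := σ ∘ Θ.symm)
      ((hQo.eventually_mem hz).mono fun y hy => (hσΨ y hy).1)
    exact congrArg (fun l : Plane →L[ℝ] ℝ => l u) (e1.unique e3)
  have he1 : (e 1) 0 = (0 : ℝ) := by simp [e]
  have he0 : (e 0) 0 = (1 : ℝ) := by simp [e]
  have chain {G : Type} [NormedAddCommGroup G] [NormedSpace ℝ G] {g : Plane → G}
      (hg : ∀ z ∈ B, ContDiffAt ℝ ∞ g z) (z : Plane) (hz : z ∈ Q) (u : Plane) :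
      fderiv ℝ (fun y => g (Θ.symm y)) z u =
        fderiv ℝ g (Θ.symm z) (fderiv ℝ Θ.symm z u) :=
    congrArg (fun l : Plane →L[ℝ] G => l u)
      ((dd (hg _ (hB' z hz))).hasFDerivAt.comp z (dd (sΨ z hz)).hasFDerivAt).fderiv
  have sx : ∀ z ∈ B, ContDiffAt ℝ ∞ (fun y => (f y).1) z := fun z hz =>
    contDiffAt_fst.comp z (R.smooth z hz)
  have sy : ∀ z ∈ B, ContDiffAt ℝ ∞ (fun y => (f y).2) z := fun z hz =>
    contDiffAt_snd.comp z (R.smooth z hz)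
  have sh : ∀ z ∈ B, ContDiffAt ℝ ∞ (fun y => h (f y).1) z := fun z hz =>
    (C.smooth_metric _ (R.mem z hz)).comp z (sx z hz)
  set α : Plane → ℝ := fun y => h (f y).1 (f y).2 (E y) with hα
  have sα : ∀ z ∈ B, ContDiffAt ℝ ∞ α z := fun z hz =>
    ((sh z hz).clm_apply (sy z hz)).clm_apply (R.smooth_tangent z hz)
  have sc {G : Type} [NormedAddCommGroup G] [NormedSpace ℝ G] {g : Plane → G}
      (hg : ∀ z ∈ B, ContDiffAt ℝ ∞ g z) : ∀ z ∈ Q, ContDiffAt ℝ ∞ (fun y => g (Θ.symm y)) z :=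
    fun z hz => (hg _ (hB' z hz)).comp z (sΨ z hz)
  have hpt : p 1 ∈ Ioo (p 1 - r / 2) (p 1 + r / 2) := ⟨by linarith, by linarith⟩
  have hline : ∀ s ∈ Ioo (p 0 - r / 2) (p 0 + r / 2), s • e 0 + p 1 • e 1 ∈ Q := by
    intro s hs
    refine ⟨?_, ?_⟩
    · rw [(hcoord _ _).1]; exact hs
    · rw [(hcoord _ _).2]; exact hpt
  have const {G : Type} [NormedAddCommGroup G] [NormedSpace ℝ G] {g : Plane → G}
      (hg : ∀ z ∈ B, ContDiffAt ℝ ∞ g z)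
      -- A function whose differential kills ker dσ depends on the first coordinate only. This is
      -- applied to the base point, to E and to the tangential component α.
      (hg' : ∀ z ∈ B, ∀ u, fderiv ℝ σ z u = 0 → fderiv ℝ g z u = 0) (z : Plane) (hz : z ∈ Q) :
      g (Θ.symm z) = g (Θ.symm (z 0 • e 0 + p 1 • e 1)) := by
    refine eq_of_fderiv_snd_eq_zero (g := fun y => g (Θ.symm y))
      (fun y h0 h1 => dd (sc hg y ⟨h0, h1⟩)) (fun y h0 h1 => ?_) hpt hz.1 hz.2
    rw [chain hg y ⟨h0, h1⟩]
    exact hg' _ (hB' y ⟨h0, h1⟩) _ (by rw [hdσ y ⟨h0, h1⟩, he1])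
  have kx : ∀ z ∈ B, ∀ u, fderiv ℝ σ z u = 0 → fderiv ℝ (fun y => (f y).1) z u = 0 := by
    intro z hz u hu
    rw [R.fderiv_base z hz, hu, zero_smul]
  -- Along ker dσ the base point and E are fixed, so dα(u) = h(dy(u), E), which is zero by the
  -- Lagrangian condition.
  have kα : ∀ z ∈ B, ∀ u, fderiv ℝ σ z u = 0 → fderiv ℝ α z u = 0 := by
    intro z hz u hu
    have hh : DifferentiableAt ℝ h (f z).1 := dd (C.smooth_metric _ (R.mem z hz))
    rw [hα, fderiv_metric_apply (g := h) (f := fun y => (f y).1) hh (dd (sx z hz)) (dd (sy z hz)) (dd (R.smooth_tangent z hz)),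
      kx z hz u hu, R.orthogonal z hz u hu, R.fderiv_tangent z hz u hu]
    simp
  have hlineD (s : ℝ) : HasDerivAt (fun s : ℝ => s • e 0 + p 1 • e 1) (e 0) s := by
    simpa using ((hasDerivAt_id s).smul_const (e 0)).add_const (p 1 • e 1)
  have sline (s : ℝ) : ContDiffAt ℝ ∞ (fun s : ℝ => s • e 0 + p 1 • e 1) s := by fun_prop
  -- The base curve is read along the line where the second coordinate equals p 1. As dx = dσ ⊗ E
  -- and σ is the first coordinate, its velocity is E, of length one.
  have hcurve : ∀ s ∈ Ioo (p 0 - r / 2) (p 0 + r / 2),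
      HasDerivAt (fun s : ℝ => (f (Θ.symm (s • e 0 + p 1 • e 1))).1)
        (E (Θ.symm (s • e 0 + p 1 • e 1))) s := by
    intro s hs
    have e1 := (dd (sc sx _ (hline s hs))).hasFDerivAt.comp_hasDerivAt s (hlineD s)
    refine e1.congr_deriv ?_
    rw [chain sx _ (hline s hs), R.fderiv_base _ (hB' _ (hline s hs)), hdσ _ (hline s hs), he0,
      one_smul]
  refine ⟨Θ, p 0 - r / 2, p 0 + r / 2, p 1 - r / 2, p 1 + r / 2,
    fun s => (f (Θ.symm (s • e 0 + p 1 • e 1))).1, fun s => α (Θ.symm (s • e 0 + p 1 • e 1)),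
    hz₀s, hΘs, by linarith, by linarith, hΘt, fun z hz => sθ z (hΘs z hz),
    fun z hz => sΨ z (hΘt ▸ hz), ?_, ?_, ?_⟩
  · exact ⟨isOpen_Ioo, fun s hs => ContDiffAt.comp (g := fun y => (f (Θ.symm y)).1)
        (f := fun s : ℝ => s • e 0 + p 1 • e 1) s (sc sx _ (hline s hs)) (sline s),
      fun s hs => R.mem _ (hB' _ (hline s hs)), fun s hs => by
        rw [(hcurve s hs).deriv]; exact R.unit _ (hB' _ (hline s hs))⟩
  · exact fun s hs => ContDiffAt.comp (g := fun y => α (Θ.symm y))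
      (f := fun s : ℝ => s • e 0 + p 1 • e 1) s (sc sα _ (hline s hs)) (sline s)
  · intro z hz
    rw [hΘt] at hz
    have hzB := hB' z hz
    have c1 : (f (Θ.symm z)).1 = _ := const sx kx z hz
    have c2 : E (Θ.symm z) = _ := const R.smooth_tangent R.fderiv_tangent z hz
    have c3 : α (Θ.symm z) = _ := const sα kα z hz
    have c4 : τ (Θ.symm z) = _ := R.snd_eq _ hzB
    rw [(hcurve _ hz.1).deriv]
    beta_reduce
    rw [← c1, ← c2, ← c3, ← (hσΨ z hz).2, c4]
    exact Prod.ext rfl (C.expand (R.mem _ hzB) (R.unit _ hzB) (f (Θ.symm z)).2)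


/-! ### The metric and the complex structure in a chart -/

/-- The form on the left is the volume form, which represents the orientation. Two representatives
of one orientation differ by a positive factor. -/
theorem exists_inner_rightAngleRotation_eq {E F : Type*} [NormedAddCommGroup E]
    [InnerProductSpace ℝ E] [Fact (Module.finrank ℝ E = 2)] [AddCommGroup F] [Module ℝ F]
    (o : Orientation ℝ E (Fin 2)) (A : E ≃ₗ[ℝ] F) (η : F [⋀^Fin 2]→ₗ[ℝ] ℝ) (hη : η ≠ 0)
    (h : Orientation.map (Fin 2) A o = rayOfNeZero ℝ η hη) :
    ∃ r : ℝ, 0 < r ∧ ∀ u w : E, inner ℝ (o.rightAngleRotation u) w = r * η ![A u, A w] := by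
  let b := o.finOrthonormalBasis zero_lt_two Fact.out
  have hb : b.toBasis.orientation = o := o.finOrthonormalBasis_orientation zero_lt_two Fact.out
  have hv : o.volumeForm = b.toBasis.det := o.volumeForm_robust b hb
  rw [← hb, Module.Basis.orientation, Orientation.map_apply, ray_eq_iff] at h
  have hne : b.toBasis.det.compLinearMap (A.symm : F →ₗ[ℝ] E) ≠ 0 := by
    intro h0
    apply b.toBasis.det_ne_zero
    ext v
    have := congrArg (fun f : F [⋀^Fin 2]→ₗ[ℝ] ℝ => f (fun i => A (v i))) h0
    simpa [AlternatingMap.compLinearMap_apply] using this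
  obtain ⟨r₁, r₂, h1, h2, he⟩ := h.exists_pos hne hη
  refine ⟨r₂ / r₁, by positivity, fun u w => ?_⟩
  have h3 := congrArg (fun f : F [⋀^Fin 2]→ₗ[ℝ] ℝ => f ![A u, A w]) he
  have h4 : (fun i => A.symm (![A u, A w] i)) = ![u, w] := by
    ext i; fin_cases i <;> simp
  simp only [AlternatingMap.smul_apply, AlternatingMap.compLinearMap_apply, smul_eq_mul,
    LinearEquiv.coe_coe] at h3
  rw [Orientation.inner_rightAngleRotation_left, Orientation.areaForm_to_volumeForm, hv]
  rw [h4] at h3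
  field_simp
  linarith

section Surface

theorem contMDiffAt_tangentMap {M M' : Type*} [TopologicalSpace M] [ChartedSpace Plane M]
    [IsManifold (𝓡 2) ∞ M] [TopologicalSpace M'] [ChartedSpace Plane M'] [IsManifold (𝓡 2) ∞ M']
    {f : M → M'} {s : Set M} (hs : IsOpen s) (hf : ContMDiffOn (𝓡 2) (𝓡 2) ∞ f s)
    {p : TangentBundle (𝓡 2) M} (hp : p.proj ∈ s) :
    ContMDiffAt (𝓡 2).tangent (𝓡 2).tangent ∞ (tangentMap (𝓡 2) (𝓡 2) f) p := by
  have h1 := hf.contMDiffOn_tangentMapWithin (m := ∞) (by simp) hs.uniqueMDiffOn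
  have ho : IsOpen (TotalSpace.proj ⁻¹' s : Set (TangentBundle (𝓡 2) M)) :=
    hs.preimage (FiberBundle.continuous_proj Plane (TangentSpace (𝓡 2)))
  refine ((h1 p hp).contMDiffAt (ho.mem_nhds hp)).congr_of_eventuallyEq ?_
  filter_upwards [ho.mem_nhds hp] with q hq
  have hq' : q.proj ∈ s := hq
  simp only [tangentMap, tangentMapWithin, mfderivWithin_of_isOpen hs hq']

variable {S : Type*} [TopologicalSpace S] [ChartedSpace Plane S] [IsManifold (𝓡 2) ∞ S]
  {φ : OpenPartialHomeomorph S Plane}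

/-- The differential of a chart, as a map to the plane. -/
noncomputable def chartDeriv (φ : OpenPartialHomeomorph S Plane) (p : S) :
    TangentSpace (𝓡 2) p →L[ℝ] Plane :=
  mfderiv (𝓡 2) (𝓡 2) φ p

/-- The differential of the inverse of a chart, as a map from the plane. -/
noncomputable def chartDerivSymm (φ : OpenPartialHomeomorph S Plane) (x : Plane) :
    Plane →L[ℝ] TangentSpace (𝓡 2) (φ.symm x) :=
  mfderiv (𝓡 2) (𝓡 2) φ.symm x

theorem chart_mdifferentiable (hφ : φ ∈ IsManifold.maximalAtlas (𝓡 2) ∞ S) :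
    φ.MDifferentiable (𝓡 2) (𝓡 2) :=
  ⟨(contMDiffOn_of_mem_maximalAtlas hφ).mdifferentiableOn (by simp),
    (contMDiffOn_symm_of_mem_maximalAtlas hφ).mdifferentiableOn (by simp)⟩

theorem chartDeriv_symm_apply (hφ : φ ∈ IsManifold.maximalAtlas (𝓡 2) ∞ S) {x : Plane}
    (hx : x ∈ φ.target) (u : Plane) : chartDeriv φ (φ.symm x) (chartDerivSymm φ x u) = u :=
  congrArg (fun l : Plane →L[ℝ] Plane => l u) ((chart_mdifferentiable hφ).comp_symm_deriv hx)

theorem chartDerivSymm_injective (hφ : φ ∈ IsManifold.maximalAtlas (𝓡 2) ∞ S) {x : Plane}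
    (hx : x ∈ φ.target) : Function.Injective (chartDerivSymm φ x) :=
  Function.LeftInverse.injective (chartDeriv_symm_apply hφ hx)

theorem chartDerivSymm_surjective (hφ : φ ∈ IsManifold.maximalAtlas (𝓡 2) ∞ S) {x : Plane}
    (hx : x ∈ φ.target) : Function.Surjective (chartDerivSymm φ x) :=
  (LinearMap.injective_iff_surjective (V := Plane)
    (f := (chartDerivSymm φ x).toLinearMap)).1 (chartDerivSymm_injective hφ hx)

theorem chartDerivSymm_apply (hφ : φ ∈ IsManifold.maximalAtlas (𝓡 2) ∞ S) {x : Plane}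
    (hx : x ∈ φ.target) (v : TangentSpace (𝓡 2) (φ.symm x)) :
    chartDerivSymm φ x (chartDeriv φ (φ.symm x) v) = v := by
  obtain ⟨u, rfl⟩ := chartDerivSymm_surjective hφ hx v
  rw [chartDeriv_symm_apply hφ hx]

theorem contMDiffAt_chartDerivSymm (hφ : φ ∈ IsManifold.maximalAtlas (𝓡 2) ∞ S) {x : Plane}
    (hx : x ∈ φ.target) (u : Plane) :
    ContMDiffAt (𝓡 2) (𝓡 2).tangent ∞ (fun y : Plane =>
      (⟨φ.symm y, chartDerivSymm φ y u⟩ : TangentBundle (𝓡 2) S)) x := by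
  have h1 : ContMDiffAt (𝓡 2) (𝓡 2).tangent ∞
      (fun y : Plane => (⟨y, u⟩ : TangentBundle (𝓡 2) Plane)) x :=
    contMDiffWithinAt_univ.1 (contMDiffWithinAt_vectorSpace_iff_contDiffWithinAt.2
      (contDiffWithinAt_const (c := u)))
  have h2 := contMDiffAt_tangentMap φ.open_target (contMDiffOn_symm_of_mem_maximalAtlas hφ)
    (p := (⟨x, u⟩ : TangentBundle (𝓡 2) Plane)) hx
  exact h2.comp x h1

variable [RiemannianBundle (fun p : S => TangentSpace (𝓡 2) p)]

theorem metricIn_apply (φ : OpenPartialHomeomorph S Plane) (x u w : Plane) :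
    metricIn φ x u w = inner ℝ (chartDerivSymm φ x u) (chartDerivSymm φ x w) := rfl

theorem metricIn_chart (hφ : φ ∈ IsManifold.maximalAtlas (𝓡 2) ∞ S) {p : S} (hp : p ∈ φ.source)
    (v w : TangentSpace (𝓡 2) p) :
    metricIn φ (φ p) (chartDeriv φ p v) (chartDeriv φ p w) = inner ℝ v w := by
  obtain ⟨x, hx, rfl⟩ : ∃ x ∈ φ.target, φ.symm x = p := ⟨φ p, φ.map_source hp, φ.left_inv hp⟩
  rw [φ.right_inv hx, metricIn_apply, chartDerivSymm_apply hφ hx, chartDerivSymm_apply hφ hx]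

theorem contDiffAt_metricIn [IsContMDiffRiemannianBundle (𝓡 2) ∞ Plane
    (fun p : S => TangentSpace (𝓡 2) p)] (hφ : φ ∈ IsManifold.maximalAtlas (𝓡 2) ∞ S)
    {x : Plane} (hx : x ∈ φ.target) : ContDiffAt ℝ ∞ (metricIn φ) x :=
  contDiffAt_clm₂ fun u w => ContMDiffAt.contDiffAt
    (ContMDiffAt.inner_bundle (contMDiffAt_chartDerivSymm hφ hx u)
      (contMDiffAt_chartDerivSymm hφ hx w))

theorem metricIn_pos (hφ : φ ∈ IsManifold.maximalAtlas (𝓡 2) ∞ S) {x : Plane} (hx : x ∈ φ.target)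
    {u : Plane} (hu : u ≠ 0) : 0 < metricIn φ x u u := by
  rw [metricIn_apply, real_inner_self_pos]
  exact fun h0 => hu (chartDerivSymm_injective hφ hx (h0.trans (map_zero _).symm))

theorem metricIn_symm (x u w : Plane) : metricIn φ x u w = metricIn φ x w u := by
  rw [metricIn_apply, metricIn_apply, real_inner_comm]

variable (o : SurfaceOrientation S)

theorem rotIn_apply (φ : OpenPartialHomeomorph S Plane) (x u : Plane) :
    rotIn o φ x u = chartDeriv φ (φ.symm x) (rot o (φ.symm x) (chartDerivSymm φ x u)) := rfl

theorem chartDerivSymm_rotIn (hφ : φ ∈ IsManifold.maximalAtlas (𝓡 2) ∞ S) {x : Plane}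
    (hx : x ∈ φ.target) (u : Plane) :
    chartDerivSymm φ x (rotIn o φ x u) = rot o (φ.symm x) (chartDerivSymm φ x u) := by
  rw [rotIn_apply, chartDerivSymm_apply hφ hx]

theorem rotIn_chart (hφ : φ ∈ IsManifold.maximalAtlas (𝓡 2) ∞ S) {p : S} (hp : p ∈ φ.source)
    (v : TangentSpace (𝓡 2) p) :
    rotIn o φ (φ p) (chartDeriv φ p v) = chartDeriv φ p (rot o p v) := by
  obtain ⟨x, hx, rfl⟩ : ∃ x ∈ φ.target, φ.symm x = p := ⟨φ p, φ.map_source hp, φ.left_inv hp⟩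
  rw [φ.right_inv hx, rotIn_apply, chartDerivSymm_apply hφ hx]

theorem rot_rot (p : S) (v : TangentSpace (𝓡 2) p) : rot o p (rot o p v) = -v :=
  haveI : Fact (Module.finrank ℝ (TangentSpace (𝓡 2) p) = 2) := ⟨finrank_tangent p⟩
  (o.at_point p).rightAngleRotation_rightAngleRotation v

theorem inner_rot_left (p : S) (v w : TangentSpace (𝓡 2) p) :
    inner ℝ (rot o p v) w = -inner ℝ v (rot o p w) :=
  haveI : Fact (Module.finrank ℝ (TangentSpace (𝓡 2) p) = 2) := ⟨finrank_tangent p⟩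
  (o.at_point p).inner_rightAngleRotation_swap' v w

theorem rotIn_rotIn (hφ : φ ∈ IsManifold.maximalAtlas (𝓡 2) ∞ S) {x : Plane} (hx : x ∈ φ.target)
    (u : Plane) : rotIn o φ x (rotIn o φ x u) = -u := by
  apply chartDerivSymm_injective hφ hx
  rw [chartDerivSymm_rotIn o hφ hx, chartDerivSymm_rotIn o hφ hx, rot_rot, map_neg]

theorem metricIn_rotIn_left (hφ : φ ∈ IsManifold.maximalAtlas (𝓡 2) ∞ S) {x : Plane}
    (hx : x ∈ φ.target) (u w : Plane) :
    metricIn φ x (rotIn o φ x u) w = -metricIn φ x u (rotIn o φ x w) := by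
  rw [metricIn_apply, metricIn_apply, chartDerivSymm_rotIn o hφ hx, chartDerivSymm_rotIn o hφ hx,
    inner_rot_left]

theorem metricIn_rotIn_eq_inner (hφ : φ ∈ IsManifold.maximalAtlas (𝓡 2) ∞ S) {x : Plane}
    (hx : x ∈ φ.target) (u w : Plane) : metricIn φ x (rotIn o φ x u) w =
      inner ℝ (rot o (φ.symm x) (chartDerivSymm φ x u)) (chartDerivSymm φ x w) := by
  rw [metricIn_apply, chartDerivSymm_rotIn o hφ hx]

theorem metricIn_rotIn_sq (hφ : φ ∈ IsManifold.maximalAtlas (𝓡 2) ∞ S) {x : Plane}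
    (hx : x ∈ φ.target) (u w : Plane) : metricIn φ x (rotIn o φ x u) w ^ 2 =
      metricIn φ x u u * metricIn φ x w w - metricIn φ x u w ^ 2 := by
  have : Fact (Module.finrank ℝ (TangentSpace (𝓡 2) (φ.symm x)) = 2) := ⟨finrank_tangent _⟩
  rw [metricIn_rotIn_eq_inner o hφ hx]
  have h1 := (o.at_point (φ.symm x)).inner_sq_add_areaForm_sq (chartDerivSymm φ x u)
    (chartDerivSymm φ x w)
  rw [← Orientation.inner_rightAngleRotation_left, ← real_inner_self_eq_norm_sq,
    ← real_inner_self_eq_norm_sq] at h1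
  have h2 : inner ℝ (rot o (φ.symm x) (chartDerivSymm φ x u)) (chartDerivSymm φ x w) =
    inner ℝ ((o.at_point (φ.symm x)).rightAngleRotation (chartDerivSymm φ x u))
      (chartDerivSymm φ x w) := rfl
  rw [h2]
  simp only [metricIn_apply]
  linarith

theorem alternatingMap_plane (η : Plane [⋀^Fin 2]→ₗ[ℝ] ℝ) (u w : Plane) :
    η ![u, w] = η ![e 0, e 1] * (u 0 * w 1 - u 1 * w 0) := by
  have h1 := congrArg (fun f : Plane [⋀^Fin 2]→ₗ[ℝ] ℝ => f ![u, w])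
    (η.eq_smul_basis_det (EuclideanSpace.basisFun (Fin 2) ℝ).toBasis)
  have h2 : (⇑(EuclideanSpace.basisFun (Fin 2) ℝ).toBasis : Fin 2 → Plane) = ![e 0, e 1] := by
    ext i; fin_cases i <;> simp [e]
  rw [h2] at h1
  refine h1.trans ?_
  simp [Module.Basis.det_apply, Matrix.det_fin_two, Module.Basis.toMatrix_apply]
  left; ring

/-- Orientations are given pointwise, constant in trivializations. A fixed alternating form,
evaluated on the coordinate frame in the trivialization, is a smooth function with the sign of the
area form; nothing is claimed about how the positive factor depends on x. -/
theorem exists_smooth_orientation (hφ : φ ∈ IsManifold.maximalAtlas (𝓡 2) ∞ S) {x₀ : Plane}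
    (hx₀ : x₀ ∈ φ.target) : ∃ ρ : Plane → ℝ, ContDiffAt ℝ ∞ ρ x₀ ∧ ∀ᶠ x in nhds x₀,
      ∃ r : ℝ, 0 < r ∧ metricIn φ x (rotIn o φ x (e 0)) (e 1) = r * ρ x := by
  obtain ⟨o', ho'⟩ := o.locally_constant (φ.symm x₀)
  induction o' using Module.Ray.ind with
  | h η hη =>
  let t := trivializationAt Plane (TangentSpace (𝓡 2)) (φ.symm x₀)
  have hM : ∀ (u : Plane) (i : Fin 2), ContDiffAt ℝ ∞
      (fun x => (t ⟨φ.symm x, chartDerivSymm φ x u⟩).2 i) x₀ := fun u i =>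
    (contDiffAt_piLp_apply 2).comp x₀
      (Bundle.contMDiffAt_totalSpace.1 (contMDiffAt_chartDerivSymm hφ hx₀ u)).2.contDiffAt
  refine ⟨fun x => η ![(t ⟨φ.symm x, chartDerivSymm φ x (e 0)⟩).2,
    (t ⟨φ.symm x, chartDerivSymm φ x (e 1)⟩).2], ?_, ?_⟩
  · refine ContDiffAt.congr_of_eventuallyEq ?_
      (Filter.Eventually.of_forall fun x => alternatingMap_plane η _ _)
    exact contDiffAt_const.mul (((hM _ _).mul (hM _ _)).sub ((hM _ _).mul (hM _ _)))
  · have hc : ContinuousAt φ.symm x₀ := φ.continuousAt_symm hx₀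
    filter_upwards [hc.eventually ho', φ.open_target.mem_nhds hx₀,
      hc.eventually (t.open_baseSet.mem_nhds
        (FiberBundle.mem_baseSet_trivializationAt' (φ.symm x₀)))] with x h1 hx h2
    have : Fact (Module.finrank ℝ (TangentSpace (𝓡 2) (φ.symm x)) = 2) := ⟨finrank_tangent _⟩
    obtain ⟨r, hr, h3⟩ := exists_inner_rightAngleRotation_eq (o.at_point (φ.symm x)) _ η hη (h1 h2)
    refine ⟨r, hr, ?_⟩
    rw [metricIn_rotIn_eq_inner o hφ hx]
    exact h3 _ _

/-- The area form δ = g(J e₀, e₁) satisfies δ² = det g > 0, and its sign is that of the smooth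
function ρ, so δ is smooth. Then J is an explicit expression in δ and the metric coefficients. -/
theorem contDiffAt_rotIn [IsContMDiffRiemannianBundle (𝓡 2) ∞ Plane
    (fun p : S => TangentSpace (𝓡 2) p)] (hφ : φ ∈ IsManifold.maximalAtlas (𝓡 2) ∞ S)
    {x₀ : Plane} (hx₀ : x₀ ∈ φ.target) : ContDiffAt ℝ ∞ (rotIn o φ) x₀ := by
  obtain ⟨ρ, hρ, hev⟩ := exists_smooth_orientation o hφ hx₀
  have he : ∀ i, e i ≠ 0 := fun i h0 => by
    simpa [e] using congrArg (fun v : Plane => v i) h0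
  have hm : ∀ u w : Plane, ContDiffAt ℝ ∞ (fun x => metricIn φ x u w) x₀ := fun u w =>
    ((contDiffAt_metricIn hφ hx₀).clm_apply contDiffAt_const).clm_apply contDiffAt_const
  let D : Plane → ℝ := fun x =>
    metricIn φ x (e 0) (e 0) * metricIn φ x (e 1) (e 1) - metricIn φ x (e 0) (e 1) ^ 2
  have hD : ContDiffAt ℝ ∞ D x₀ := ((hm _ _).mul (hm _ _)).sub ((hm _ _).pow 2)
  have hsq : ∀ x ∈ φ.target, metricIn φ x (rotIn o φ x (e 0)) (e 1) ^ 2 = D x := fun x hx =>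
    metricIn_rotIn_sq o hφ hx _ _
  have hself : ∀ x ∈ φ.target, ∀ u, metricIn φ x (rotIn o φ x u) u = 0 := fun x hx u => by
    have h1 := metricIn_rotIn_left o hφ hx u u
    rw [metricIn_symm x u] at h1
    linarith
  have hvec : ∀ x ∈ φ.target, ∀ v, metricIn φ x v (e 0) = 0 → metricIn φ x v (e 1) = 0 → v = 0 := by
    intro x hx v h0 h1
    by_contra hv
    have h2 := metricIn_pos hφ hx hv
    nth_rewrite 2 [plane_eq v] at h2
    simp [h0, h1] at h2
  have hDpos : ∀ x ∈ φ.target, 0 < D x := fun x hx => by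
    rw [← hsq x hx]
    refine lt_of_le_of_ne (sq_nonneg _) fun h0 => ?_
    have h1 := hvec x hx _ (hself x hx (e 0)) (by simpa using h0.symm)
    have h2 := rotIn_rotIn o hφ hx (e 0)
    rw [h1, map_zero] at h2
    exact he 0 (neg_eq_zero.1 h2.symm)
  obtain ⟨r₀, hr₀, h₀⟩ := hev.self_of_nhds
  have hρ0 : ρ x₀ ≠ 0 := fun h => by
    have h1 := hDpos x₀ hx₀
    rw [← hsq x₀ hx₀, h₀, h] at h1
    simp at h1
  -- ρ / √(ρ²) is the sign of ρ, written so as to be visibly smooth where ρ ≠ 0; the unknown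
  -- positive factor drops out.
  let δ : Plane → ℝ := fun x => ρ x / Real.sqrt (ρ x ^ 2) * Real.sqrt (D x)
  have hW : ContDiffAt ℝ ∞ δ x₀ :=
    (hρ.div ((hρ.pow 2).sqrt (pow_ne_zero 2 hρ0)) (Real.sqrt_ne_zero'.2 (by positivity))).mul
      (hD.sqrt (hDpos x₀ hx₀).ne')
  have hW0 : δ x₀ ≠ 0 := mul_ne_zero
    (div_ne_zero hρ0 (Real.sqrt_ne_zero'.2 (by positivity))) (Real.sqrt_ne_zero'.2 (hDpos x₀ hx₀))
  -- The vectors J e₀ and J e₁ are determined by their products 0 and ±δ with the frame; solving the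
  -- linear system divides by det g = δ².
  refine contDiffAt_clm fun u => ContDiffAt.congr_of_eventuallyEq (f := fun x => (δ x)⁻¹ •
    (u 0 • (metricIn φ x (e 0) (e 0) • e 1 - metricIn φ x (e 0) (e 1) • e 0) +
      u 1 • (metricIn φ x (e 0) (e 1) • e 1 - metricIn φ x (e 1) (e 1) • e 0))) ?_ ?_
  · have h1 : ∀ u w z : Plane, ContDiffAt ℝ ∞ (fun x => metricIn φ x u w • z) x₀ := fun u w z =>
      (hm u w).smul (contDiffAt_const (c := z))
    have h2 : ∀ c : ℝ, ContDiffAt ℝ ∞ (fun _ : Plane => c) x₀ := fun c => contDiffAt_const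
    exact (hW.inv hW0).smul (((h2 (u 0)).smul ((h1 _ _ _).sub (h1 _ _ _))).add
      ((h2 (u 1)).smul ((h1 _ _ _).sub (h1 _ _ _))))
  · filter_upwards [hev, φ.open_target.mem_nhds hx₀] with x ⟨r, hr, h1⟩ hx
    have hr1 : δ x = metricIn φ x (rotIn o φ x (e 0)) (e 1) := by
      have h2 : Real.sqrt (D x) = r * Real.sqrt (ρ x ^ 2) := by
        rw [← hsq x hx, h1, mul_pow, Real.sqrt_mul (sq_nonneg r), Real.sqrt_sq hr.le]
      have h3 : Real.sqrt (ρ x ^ 2) ≠ 0 := fun h => by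
        rw [h, mul_zero] at h2
        exact (Real.sqrt_ne_zero'.2 (hDpos x hx)) h2
      simp only [δ]
      rw [h2, h1]
      field_simp
    have hWx : δ x ≠ 0 := fun h => by
      have h2 := hDpos x hx
      rw [← hsq x hx, ← hr1, h] at h2
      simp at h2
    have h10 : metricIn φ x (rotIn o φ x (e 1)) (e 0) = -δ x := by
      rw [metricIn_rotIn_left o hφ hx, metricIn_symm, hr1]
    have hWsq : δ x ^ 2 = D x := by rw [hr1, hsq x hx]
    have hJ : rotIn o φ x u = u 0 • rotIn o φ x (e 0) + u 1 • rotIn o φ x (e 1) := by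
      conv_lhs => rw [plane_eq u]
      simp
    rw [hJ, ← sub_eq_zero]
    have hs := metricIn_symm (φ := φ) x (e 1) (e 0)
    simp only [D] at hWsq
    refine hvec x hx _ ?_ ?_
    · simp [hself x hx, h10, hs]
      field_simp
      linear_combination (-u 1) * hWsq
    · simp [hself x hx, ← hr1]
      field_simp
      linear_combination (u 0) * hWsq

theorem kaehlerChart [IsContMDiffRiemannianBundle (𝓡 2) ∞ Plane
    (fun p : S => TangentSpace (𝓡 2) p)] (hφ : φ ∈ IsManifold.maximalAtlas (𝓡 2) ∞ S) :
    KaehlerChart φ.target (metricIn φ) (rotIn o φ) where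
  isOpen := φ.open_target
  smooth_metric _ hx := contDiffAt_metricIn hφ hx
  smooth_rot _ hx := contDiffAt_rotIn o hφ hx
  symm x _ := metricIn_symm x
  pos _ hx _ hu := metricIn_pos hφ hx hu
  rot_rot _ hx := rotIn_rotIn o hφ hx
  rot_skew _ hx := metricIn_rotIn_left o hφ hx

end Surface


/-! ### Coordinate expressions of an immersed surface -/

theorem finrank_range_comp_comp {V₁ V₂ V₃ V₄ : Type*} [AddCommGroup V₁] [Module ℝ V₁]
    [AddCommGroup V₂] [Module ℝ V₂] [AddCommGroup V₃] [Module ℝ V₃] [AddCommGroup V₄] [Module ℝ V₄]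
    {A : V₃ →ₗ[ℝ] V₄} {M : V₂ →ₗ[ℝ] V₃} {B : V₁ →ₗ[ℝ] V₂} (hA : Function.Injective A)
    (hB : Function.Surjective B) : Module.finrank ℝ (LinearMap.range (A ∘ₗ M ∘ₗ B)) =
      Module.finrank ℝ (LinearMap.range M) := by
  rw [LinearMap.range_comp, LinearMap.range_comp_of_range_eq_top _ (LinearMap.range_eq_top.2 hB)]
  exact (Submodule.equivMapOfInjective A hA _).finrank_eq.symm

section Surface

variable {S : Type*} [TopologicalSpace S] [ChartedSpace Plane S] [IsManifold (𝓡 2) ∞ S]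
  {φ : OpenPartialHomeomorph S Plane}

theorem chartDeriv_injective (hφ : φ ∈ IsManifold.maximalAtlas (𝓡 2) ∞ S) {p : S}
    (hp : p ∈ φ.source) : Function.Injective (chartDeriv φ p) := by
  obtain ⟨x, hx, rfl⟩ : ∃ x ∈ φ.target, φ.symm x = p := ⟨φ p, φ.map_source hp, φ.left_inv hp⟩
  exact Function.LeftInverse.injective (chartDerivSymm_apply hφ hx)

/-- The coordinates on the tangent bundle induced by a chart. -/
noncomputable def bundleCoord (φ : OpenPartialHomeomorph S Plane) (p : TangentBundle (𝓡 2) S) :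
    Plane × Plane :=
  (φ p.proj, chartDeriv φ p.proj p.snd)

/-- The point of the tangent bundle with given coordinates. -/
noncomputable def bundlePoint (φ : OpenPartialHomeomorph S Plane) (q : Plane × Plane) :
    TangentBundle (𝓡 2) S :=
  ⟨φ.symm q.1, chartDerivSymm φ q.1 q.2⟩

theorem bundlePoint_bundleCoord (hφ : φ ∈ IsManifold.maximalAtlas (𝓡 2) ∞ S)
    {p : TangentBundle (𝓡 2) S} (hp : p.proj ∈ φ.source) : bundlePoint φ (bundleCoord φ p) = p := by
  obtain ⟨p, v⟩ := p
  obtain ⟨x, hx, rfl⟩ : ∃ x ∈ φ.target, φ.symm x = p := ⟨φ p, φ.map_source hp, φ.left_inv hp⟩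
  -- φ(φ⁻¹ x) = x is not definitional and the fibre depends on the point; with the first coordinate
  -- generalized the equation can be substituted.
  have key : ∀ y, y = x → bundlePoint φ (y, chartDeriv φ (φ.symm x) v) = ⟨φ.symm x, v⟩ := by
    rintro _ rfl
    exact congrArg (TotalSpace.mk (φ.symm _)) (chartDerivSymm_apply hφ hx v)
  exact key _ (φ.right_inv hx)

theorem contMDiffAt_bundleCoord (hφ : φ ∈ IsManifold.maximalAtlas (𝓡 2) ∞ S)
    {p : TangentBundle (𝓡 2) S} (hp : p.proj ∈ φ.source) :
    ContMDiffAt (𝓡 2).tangent 𝓘(ℝ, Plane × Plane) ∞ (bundleCoord φ) p := by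
  have h1 := contMDiffAt_tangentMap φ.open_source (contMDiffOn_of_mem_maximalAtlas hφ) hp
  have h2 := (contMDiff_snd_tangentBundle_modelSpace Plane (𝓡 2)).contMDiffAt.comp p h1
  have h3 := (contMDiff_proj (n := ∞) (TangentSpace (𝓡 2) : Plane → Type)).contMDiffAt.comp p h1
  exact h3.prodMk_space h2

theorem contMDiffAt_bundlePoint (hφ : φ ∈ IsManifold.maximalAtlas (𝓡 2) ∞ S)
    {q : Plane × Plane} (hq : q.1 ∈ φ.target) :
    ContMDiffAt 𝓘(ℝ, Plane × Plane) (𝓡 2).tangent ∞ (bundlePoint φ) q := by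
  have h1 : ContMDiffAt 𝓘(ℝ, Plane × Plane) (𝓡 2).tangent ∞
      (fun r : Plane × Plane => (⟨r.1, r.2⟩ : TangentBundle (𝓡 2) Plane)) q := by
    refine Bundle.contMDiffAt_totalSpace.2 ⟨contDiffAt_fst.contMDiffAt, ?_⟩
    refine (contDiffAt_snd.contMDiffAt : ContMDiffAt 𝓘(ℝ, Plane × Plane) 𝓘(ℝ, Plane) ∞
      (fun r : Plane × Plane => r.2) q).congr_of_eventuallyEq ?_
    filter_upwards with r
    simp
  exact (contMDiffAt_tangentMap φ.open_target (contMDiffOn_symm_of_mem_maximalAtlas hφ)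
    (p := (⟨q.1, q.2⟩ : TangentBundle (𝓡 2) Plane)) hq).comp q h1

variable {L : Type*} [TopologicalSpace L] [ChartedSpace Plane L] [IsManifold (𝓡 2) ∞ L]
  {ψ : OpenPartialHomeomorph L Plane} {X : L → TangentBundle (𝓡 2) S}

theorem localExpr_eq (φ : OpenPartialHomeomorph S Plane) (ψ : OpenPartialHomeomorph L Plane)
    (X : L → TangentBundle (𝓡 2) S) (z : Plane) :
    localExpr φ ψ X z = bundleCoord φ (X (ψ.symm z)) := rfl

theorem isOpen_localDomain (hX : Continuous X) : IsOpen (localDomain φ ψ X) := by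
  have h1 : ContinuousOn (fun z => (X (ψ.symm z)).proj) ψ.target :=
    ((FiberBundle.continuous_proj Plane (TangentSpace (𝓡 2))).comp hX).comp_continuousOn
      ψ.continuousOn_symm
  exact h1.isOpen_inter_preimage ψ.open_target φ.open_source

theorem localExpr_fst_mem {z : Plane} (hz : z ∈ localDomain φ ψ X) :
    (localExpr φ ψ X z).1 ∈ φ.target :=
  φ.map_source hz.2

theorem contMDiffAt_comp_symm (hX : ContMDiff (𝓡 2) (𝓡 2).tangent ∞ X)
    (hψ : ψ ∈ IsManifold.maximalAtlas (𝓡 2) ∞ L) {z : Plane} (hz : z ∈ ψ.target) :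
    ContMDiffAt (𝓡 2) (𝓡 2).tangent ∞ (fun y => X (ψ.symm y)) z :=
  hX.contMDiffAt.comp z
    ((contMDiffOn_symm_of_mem_maximalAtlas hψ).contMDiffAt (ψ.open_target.mem_nhds hz))

theorem contDiffAt_localExpr (hX : ContMDiff (𝓡 2) (𝓡 2).tangent ∞ X)
    (hφ : φ ∈ IsManifold.maximalAtlas (𝓡 2) ∞ S) (hψ : ψ ∈ IsManifold.maximalAtlas (𝓡 2) ∞ L)
    {z : Plane} (hz : z ∈ localDomain φ ψ X) : ContDiffAt ℝ ∞ (localExpr φ ψ X) z :=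
  ContMDiffAt.contDiffAt (ContMDiffAt.comp (g := bundleCoord φ) (f := fun y => X (ψ.symm y)) z
    (contMDiffAt_bundleCoord hφ hz.2) (contMDiffAt_comp_symm hX hψ hz.1))

/-- X ∘ ψ⁻¹ factors locally through its coordinate expression via `bundlePoint`. A vector killed by
the differential of the latter is killed by the injective map dX ∘ dψ⁻¹. -/
theorem fderiv_localExpr_injective (hX : IsSmoothImmersion X)
    (hφ : φ ∈ IsManifold.maximalAtlas (𝓡 2) ∞ S) (hψ : ψ ∈ IsManifold.maximalAtlas (𝓡 2) ∞ L)
    {z : Plane} (hz : z ∈ localDomain φ ψ X) (u : Plane)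
    (hu : fderiv ℝ (localExpr φ ψ X) z u = 0) : u = 0 := by
  have h1 : (fun y => X (ψ.symm y)) =ᶠ[nhds z] fun y => bundlePoint φ (localExpr φ ψ X y) := by
    filter_upwards [(isOpen_localDomain hX.1.continuous).mem_nhds hz] with y hy
    exact (bundlePoint_bundleCoord hφ hy.2).symm
  have h2 : HasMFDerivAt (𝓡 2) (𝓡 2).tangent (fun y => X (ψ.symm y)) z
      ((mfderiv (𝓡 2) (𝓡 2).tangent X (ψ.symm z)).comp (mfderiv (𝓡 2) (𝓡 2) ψ.symm z)) :=
    (hX.1.mdifferentiable (by simp) _).hasMFDerivAt.comp z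
      ((chart_mdifferentiable hψ).mdifferentiableAt_symm hz.1).hasMFDerivAt
  have h3 : HasMFDerivAt (𝓡 2) (𝓡 2).tangent (fun y => bundlePoint φ (localExpr φ ψ X y)) z
      ((mfderiv 𝓘(ℝ, Plane × Plane) (𝓡 2).tangent (bundlePoint φ) (localExpr φ ψ X z)).comp
        (fderiv ℝ (localExpr φ ψ X) z)) :=
    ((contMDiffAt_bundlePoint hφ (localExpr_fst_mem hz)).mdifferentiableAt (by simp)).hasMFDerivAt.comp
      z ((contDiffAt_localExpr hX.1 hφ hψ hz).differentiableAt (by simp)).hasFDerivAt.hasMFDerivAt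
  have h4 := hasMFDerivAt_unique h2 (h3.congr_of_eventuallyEq h1)
  apply chartDerivSymm_injective hψ hz.1
  apply hX.2 (ψ.symm z)
  have h5 := congrArg (fun l : Plane →L[ℝ] Plane × Plane => l u) h4
  have h6 : mfderiv (𝓡 2) (𝓡 2).tangent X (ψ.symm z) (chartDerivSymm ψ z u) =
    mfderiv 𝓘(ℝ, Plane × Plane) (𝓡 2).tangent (bundlePoint φ) (localExpr φ ψ X z)
      (fderiv ℝ (localExpr φ ψ X) z u) := h5
  rw [h6, hu]
  exact (map_zero _).trans ((congrArg _ (map_zero _)).trans (map_zero _)).symm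

theorem finrank_range_fderiv_localExpr (hX : IsSmoothImmersion X) (hrank : HasRankOne X)
    (hφ : φ ∈ IsManifold.maximalAtlas (𝓡 2) ∞ S) (hψ : ψ ∈ IsManifold.maximalAtlas (𝓡 2) ∞ L)
    {z : Plane} (hz : z ∈ localDomain φ ψ X) : Module.finrank ℝ (LinearMap.range
      (fderiv ℝ (fun y => (localExpr φ ψ X y).1) z).toLinearMap) = 1 := by
  have h1 : HasMFDerivAt (𝓡 2) (𝓡 2) (fun y => (X (ψ.symm y)).proj) z
      ((mfderiv (𝓡 2) (𝓡 2) (fun y => (X y).proj) (ψ.symm z)).comp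
        (mfderiv (𝓡 2) (𝓡 2) ψ.symm z)) :=
    HasMFDerivAt.comp (g := fun y => (X y).proj) (f := ψ.symm) z (((contMDiff_proj (n := ∞) (TangentSpace (𝓡 2) : S → Type)).comp
      hX.1).mdifferentiable (by simp) _).hasMFDerivAt
      ((chart_mdifferentiable hψ).mdifferentiableAt_symm hz.1).hasMFDerivAt
  have h2 : HasMFDerivAt (𝓡 2) (𝓡 2) φ (X (ψ.symm z)).proj
      (mfderiv (𝓡 2) (𝓡 2) φ (X (ψ.symm z)).proj) :=
    ((chart_mdifferentiable hφ).mdifferentiableAt hz.2).hasMFDerivAt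
  let M : TangentSpace (𝓡 2) (ψ.symm z) →L[ℝ] TangentSpace (𝓡 2) (X (ψ.symm z)).proj :=
    mfderiv (𝓡 2) (𝓡 2) (fun y => (X y).proj) (ψ.symm z)
  have h3 : HasFDerivAt (fun y => (localExpr φ ψ X y).1)
      ((chartDeriv φ (X (ψ.symm z)).proj).comp (M.comp (chartDerivSymm ψ z))) z :=
    hasMFDerivAt_iff_hasFDerivAt.1
      (HasMFDerivAt.comp (g := φ) (f := fun y => (X (ψ.symm y)).proj) z h2 h1)
  have h4 : Module.finrank ℝ (LinearMap.range M.toLinearMap) = 1 := hrank (ψ.symm z)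
  rw [h3.fderiv, ← h4]
  exact finrank_range_comp_comp (A := (chartDeriv φ (X (ψ.symm z)).proj).toLinearMap)
    (M := M.toLinearMap) (B := (chartDerivSymm ψ z).toLinearMap)
    (chartDeriv_injective hφ hz.2) (chartDerivSymm_surjective hψ hz.1)

end Surface


/-! ### Affine normal patches -/

section Surface

variable {S : Type*} [TopologicalSpace S] [ChartedSpace Plane S] [IsManifold (𝓡 2) ∞ S]
  {φ : OpenPartialHomeomorph S Plane}

theorem chartDeriv_velocity (hφ : φ ∈ IsManifold.maximalAtlas (𝓡 2) ∞ S) {γ : ℝ → S} {s : ℝ}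
    (hγ : ContMDiffAt 𝓘(ℝ, ℝ) (𝓡 2) ∞ γ s) (hs : γ s ∈ φ.source) :
    chartDeriv φ (γ s) (velocity γ s) = deriv (fun r => φ (γ r)) s := by
  have h1 : HasFDerivAt (fun r => φ (γ r))
      ((chartDeriv φ (γ s)).comp (mfderiv 𝓘(ℝ, ℝ) (𝓡 2) γ s)) s :=
    hasMFDerivAt_iff_hasFDerivAt.1 (HasMFDerivAt.comp (g := φ) (f := γ) s
      ((chart_mdifferentiable hφ).mdifferentiableAt hs).hasMFDerivAt
      (hγ.mdifferentiableAt (by simp)).hasMFDerivAt)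
  rw [h1.hasDerivAt.deriv]
  rfl

theorem velocity_chart_symm (hφ : φ ∈ IsManifold.maximalAtlas (𝓡 2) ∞ S) {c : ℝ → Plane} {s : ℝ}
    (hc : ContDiffAt ℝ ∞ c s) (hs : c s ∈ φ.target) :
    velocity (fun r => φ.symm (c r)) s = chartDerivSymm φ (c s) (deriv c s) := by
  have h1 : HasMFDerivAt 𝓘(ℝ, ℝ) (𝓡 2) (fun r => φ.symm (c r)) s
      ((mfderiv (𝓡 2) (𝓡 2) φ.symm (c s)).comp (fderiv ℝ c s)) :=
    HasMFDerivAt.comp (g := φ.symm) (f := c) s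
      ((chart_mdifferentiable hφ).mdifferentiableAt_symm hs).hasMFDerivAt
      (hc.differentiableAt (by simp)).hasFDerivAt.hasMFDerivAt
  have h2 := congrArg (fun l : ℝ →L[ℝ] Plane => l 1) h1.mfderiv
  have h3 : chartDerivSymm φ (c s) (fderiv ℝ c s 1) = chartDerivSymm φ (c s) (deriv c s) := by
    rw [fderiv_apply_one_eq_deriv]
  exact h2.trans h3

variable [RiemannianBundle (fun p : S => TangentSpace (𝓡 2) p)]
  [IsContMDiffRiemannianBundle (𝓡 2) ∞ Plane (fun p : S => TangentSpace (𝓡 2) p)]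
  (o : SurfaceOrientation S)
  {L : Type*} [TopologicalSpace L] [ChartedSpace Plane L] [IsManifold (𝓡 2) ∞ L]
  {ψ : OpenPartialHomeomorph L Plane} {X : L → TangentBundle (𝓡 2) S}

theorem exists_affineNormalPatch (hX : IsSmoothImmersion X) (hrank : HasRankOne X)
    (hLag : IsLagrangian X) (x : L) :
    ∃ (ψ : OpenPartialHomeomorph L Plane) (s₀ s₁ t₀ t₁ : ℝ) (γ : ℝ → S) (a : ℝ → ℝ),
      x ∈ ψ.source ∧ IsAffineNormalPatch o X ψ s₀ s₁ t₀ t₁ γ a := by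
  let ψ₀ := chartAt Plane x
  let φ := chartAt Plane (X x).proj
  have hψ₀ : ψ₀ ∈ IsManifold.maximalAtlas (𝓡 2) ∞ L := IsManifold.chart_mem_maximalAtlas x
  have hφ : φ ∈ IsManifold.maximalAtlas (𝓡 2) ∞ S := IsManifold.chart_mem_maximalAtlas _
  have C := kaehlerChart o hφ
  have hx : x ∈ ψ₀.source := mem_chart_source Plane x
  have hz₀ : ψ₀ x ∈ localDomain φ ψ₀ X := by
    refine ⟨ψ₀.map_source hx, ?_⟩
    rw [ψ₀.left_inv hx]
    exact mem_chart_source Plane _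
  obtain ⟨B, σ, τ, E, hzB, hBU, R⟩ := exists_rankOneFrame C (isOpen_localDomain hX.1.continuous)
    (fun z hz => localExpr_fst_mem hz) (fun z hz => contDiffAt_localExpr hX.1 hφ hψ₀ hz)
    (fun z hz => fderiv_localExpr_injective hX hφ hψ₀ hz)
    (fun z hz => finrank_range_fderiv_localExpr hX hrank hφ hψ₀ hz)
    (fun z hz => hLag φ hφ ψ₀ hψ₀ z hz (mem_univ _)) hz₀
  obtain ⟨Θ, s₀, s₁, t₀, t₁, c, a, h1, h2, hs, ht, htar, hΘ, hΘ', U, ha, hf⟩ :=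
    R.exists_coordinates C hzB
  have hsub : Θ.source ⊆ ψ₀.target := fun z hz => (hBU (h2 hz)).1
  have htarget : (ψ₀ ≫ₕ Θ).target = Θ.target := by
    rw [OpenPartialHomeomorph.trans_target]
    exact inter_eq_left.2 fun z hz => hsub (Θ.map_target hz)
  -- The patch is the initial chart of L followed by the adapted coordinates of the plane, and its
  -- base curve is the coordinate curve carried back to the surface.
  refine ⟨ψ₀ ≫ₕ Θ, s₀, s₁, t₀, t₁, fun s => φ.symm (c s), a, ?_, ?_⟩
  · rw [OpenPartialHomeomorph.trans_source]
    exact ⟨hx, h1⟩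
  have hvel : ∀ s ∈ Ioo s₀ s₁, velocity (fun s => φ.symm (c s)) s =
      chartDerivSymm φ (c s) (deriv c s) := fun s hs =>
    velocity_chart_symm hφ (U.smooth s hs) (U.mem s hs)
  constructor
  · apply OpenPartialHomeomorph.mem_maximalAtlas_of_contMDiffOn
    · rw [OpenPartialHomeomorph.trans_source]
      intro y hy
      exact ((hΘ _ hy.2).contMDiffAt.comp y ((contMDiffOn_of_mem_maximalAtlas hψ₀).contMDiffAt
        (ψ₀.open_source.mem_nhds hy.1))).contMDiffWithinAt
    · rw [htarget]
      intro z hz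
      exact (((contMDiffOn_symm_of_mem_maximalAtlas hψ₀).contMDiffAt
        (ψ₀.open_target.mem_nhds (hsub (Θ.map_target hz)))).comp z
          (hΘ' z hz).contMDiffAt).contMDiffWithinAt
  · exact hs
  · exact ht
  · rw [htarget, htar]
  · intro s hs
    exact (((contMDiffOn_symm_of_mem_maximalAtlas hφ).contMDiffAt
      (φ.open_target.mem_nhds (U.mem s hs))).comp s (U.smooth s hs).contMDiffAt).contMDiffWithinAt
  · intro s hs
    rw [hvel s hs]
    have h3 := U.unit s hs
    rw [metricIn_apply, real_inner_self_eq_norm_sq] at h3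
    nlinarith [norm_nonneg (chartDerivSymm φ (c s) (deriv c s))]
  · exact fun s hs => (ha s hs).contDiffWithinAt
  · rw [htarget]
    intro z hz
    have hz0 : z 0 ∈ Ioo s₀ s₁ := by rw [htar] at hz; exact hz.1
    have h3 : X (ψ₀.symm (Θ.symm z)) = bundlePoint φ (localExpr φ ψ₀ X (Θ.symm z)) :=
      (bundlePoint_bundleCoord hφ (hBU (h2 (Θ.map_target hz))).2).symm
    rw [hf z hz] at h3
    refine h3.trans (congrArg (TotalSpace.mk (φ.symm (c (z 0)))) ?_)
    rw [hvel _ hz0]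
    change chartDerivSymm φ (c (z 0)) (a (z 0) • deriv c (z 0) +
      z 1 • rotIn o φ (c (z 0)) (deriv c (z 0))) = _
    rw [map_add, map_smul, map_smul, chartDerivSymm_rotIn o hφ (U.mem _ hz0)]

variable {o} {s₀ s₁ t₀ t₁ : ℝ} {γ : ℝ → S} {a : ℝ → ℝ}

theorem IsAffineNormalPatch.contMDiffAt_curve (A : IsAffineNormalPatch o X ψ s₀ s₁ t₀ t₁ γ a)
    {s : ℝ} (hs : s ∈ Ioo s₀ s₁) : ContMDiffAt 𝓘(ℝ, ℝ) (𝓡 2) ∞ γ s :=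
  A.smooth_curve.contMDiffAt (isOpen_Ioo.mem_nhds hs)

theorem IsAffineNormalPatch.unitSpeedCurve (A : IsAffineNormalPatch o X ψ s₀ s₁ t₀ t₁ γ a)
    (hφ : φ ∈ IsManifold.maximalAtlas (𝓡 2) ∞ S) {I : Set ℝ} (hI : IsOpen I)
    (hIs : I ⊆ Ioo s₀ s₁) (hIφ : ∀ s ∈ I, γ s ∈ φ.source) :
    UnitSpeedCurve φ.target (metricIn φ) I (fun s => φ (γ s)) where
  isOpen := hI
  smooth s hs := (((contMDiffOn_of_mem_maximalAtlas hφ).contMDiffAt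
    (φ.open_source.mem_nhds (hIφ s hs))).comp s (A.contMDiffAt_curve (hIs hs))).contDiffAt
  mem s hs := φ.map_source (hIφ s hs)
  unit s hs := by
    rw [← chartDeriv_velocity hφ (A.contMDiffAt_curve (hIs hs)) (hIφ s hs),
      metricIn_chart hφ (hIφ s hs), real_inner_self_eq_norm_sq, A.unit_speed s (hIs hs), one_pow]

/-- If the determinant vanished, the vectors (l₁, -l₀) and (m₁, -m₀) would be annihilated by both
functionals, hence be zero; then e₀ would be annihilated too. -/
theorem det_ne_zero_of_injective {l m : Plane →L[ℝ] ℝ} (h : ∀ u, l u = 0 → m u = 0 → u = 0) :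
    l (e 0) * m (e 1) - l (e 1) * m (e 0) ≠ 0 := by
  intro h0
  have he : e 0 ≠ 0 := fun h0 => by simpa [e] using congrArg (fun v : Plane => v 0) h0
  have h1 := h (l (e 1) • e 0 - l (e 0) • e 1) (by simp; ring) (by simp; linarith)
  have h2 := h (m (e 1) • e 0 - m (e 0) • e 1) (by simp; linarith) (by simp; ring)
  have a0 : l (e 0) = 0 := by simpa [e] using congrArg (fun v : Plane => v 1) h1
  have b0 : m (e 0) = 0 := by simpa [e] using congrArg (fun v : Plane => v 1) h2
  exact he (h _ a0 b0)

/-- In an arbitrary chart ψ' the components of the transition map ψ ∘ ψ'⁻¹ serve as σ and τ; they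
are independent because this map has a smooth inverse. -/
theorem IsAffineNormalPatch.exists_affineNormalForm
    (A : IsAffineNormalPatch o X ψ s₀ s₁ t₀ t₁ γ a) (hφ : φ ∈ IsManifold.maximalAtlas (𝓡 2) ∞ S)
    {ψ' : OpenPartialHomeomorph L Plane} (hψ' : ψ' ∈ IsManifold.maximalAtlas (𝓡 2) ∞ L)
    {z : Plane} (hz : z ∈ localDomain φ ψ' X) (hzψ : ψ'.symm z ∈ ψ.source) :
    ∃ (N : Set Plane) (r₀ r₁ : ℝ) (σ τ : Plane → ℝ), z ∈ N ∧ σ z = ψ (ψ'.symm z) 0 ∧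
      σ z ∈ Ioo s₀ s₁ ∧ γ (σ z) ∈ φ.source ∧
      AffineNormalForm φ.target (metricIn φ) (rotIn o φ) (localExpr φ ψ' X) N r₀ r₁ σ τ
        (fun s => φ (γ s)) a := by
  let g : Plane → Plane := fun y => ψ (ψ'.symm y)
  let N₀ : Set Plane := ψ'.target ∩ ψ'.symm ⁻¹' ψ.source
  have hN₀ : IsOpen N₀ := ψ'.continuousOn_symm.isOpen_inter_preimage ψ'.open_target ψ.open_source
  have hg : ∀ y ∈ N₀, ContDiffAt ℝ ∞ g y := fun y hy =>
    (((contMDiffOn_of_mem_maximalAtlas A.chart_mem).contMDiffAt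
      (ψ.open_source.mem_nhds hy.2)).comp y ((contMDiffOn_symm_of_mem_maximalAtlas hψ').contMDiffAt
        (ψ'.open_target.mem_nhds hy.1))).contDiffAt
  have hg' : ∀ y ∈ N₀, ContDiffAt ℝ ∞ (fun w => ψ' (ψ.symm w)) (g y) := fun y hy => by
    have hy' : ψ.symm (g y) = ψ'.symm y := ψ.left_inv hy.2
    refine (ContMDiffAt.comp (g := ψ') (f := ψ.symm) (g y)
      ((contMDiffOn_of_mem_maximalAtlas hψ').contMDiffAt (ψ'.open_source.mem_nhds ?_))
      ((contMDiffOn_symm_of_mem_maximalAtlas A.chart_mem).contMDiffAt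
        (ψ.open_target.mem_nhds (ψ.map_source hy.2)))).contDiffAt
    rw [hy']
    exact ψ'.map_target hy.1
  have hgi : ∀ y ∈ N₀, ∀ u, fderiv ℝ g y u = 0 → u = 0 := by
    intro y hy u hu
    have h1 : (fun w => ψ' (ψ.symm (g w))) =ᶠ[nhds y] fun w => w := by
      filter_upwards [hN₀.mem_nhds hy] with w hw
      rw [show ψ.symm (g w) = ψ'.symm w from ψ.left_inv hw.2, ψ'.right_inv hw.1]
    have h2 : HasFDerivAt (fun w => ψ' (ψ.symm (g w)))
        ((fderiv ℝ (fun w => ψ' (ψ.symm w)) (g y)).comp (fderiv ℝ g y)) y :=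
      HasFDerivAt.comp (g := fun w => ψ' (ψ.symm w)) (f := g) y
        ((hg' y hy).differentiableAt (by simp)).hasFDerivAt
        ((hg y hy).differentiableAt (by simp)).hasFDerivAt
    have h3 := congrArg (fun l : Plane →L[ℝ] Plane => l u)
      (h2.unique ((hasFDerivAt_id y).congr_of_eventuallyEq h1))
    simpa [hu] using h3.symm
  have hcoord : ∀ i : Fin 2, ∀ y ∈ N₀, ContDiffAt ℝ ∞ (fun y => g y i) y := fun i y hy =>
    (contDiffAt_piLp_apply 2).comp y (hg y hy)
  have hfd : ∀ i : Fin 2, ∀ y ∈ N₀, ∀ u, fderiv ℝ (fun y => g y i) y u = fderiv ℝ g y u i := by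
    intro i y hy u
    have h1 := ((EuclideanSpace.proj i : Plane →L[ℝ] ℝ).hasFDerivAt
      (x := g y)).comp y ((hg y hy).differentiableAt (by simp)).hasFDerivAt
    exact congrArg (fun l : Plane →L[ℝ] ℝ => l u) h1.fderiv
  have hXg : ∀ y ∈ N₀, X (ψ'.symm y) = ⟨γ (g y 0),
      a (g y 0) • velocity γ (g y 0) + g y 1 • rot o (γ (g y 0)) (velocity γ (g y 0))⟩ := by
    intro y hy
    rw [← A.eq (g y) (ψ.map_source hy.2), show ψ.symm (g y) = ψ'.symm y from ψ.left_inv hy.2]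
  have hg0 : ∀ y ∈ N₀, g y 0 ∈ Ioo s₀ s₁ := fun y hy => by
    have := ψ.map_source hy.2
    rw [A.target_eq] at this
    exact this.1
  have hzN : z ∈ N₀ := ⟨hz.1, hzψ⟩
  have hγz : γ (g z 0) ∈ φ.source := by
    have h1 := hz.2
    rw [hXg z hzN] at h1
    exact h1
  -- The base curve may leave the domain of φ, so the parameter interval is shrunk around the given
  -- point.
  obtain ⟨r₀, r₁, hr, hI⟩ := mem_nhds_iff_exists_Ioo_subset.1
    (Filter.inter_mem (isOpen_Ioo.mem_nhds (hg0 z hzN))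
      ((A.contMDiffAt_curve (hg0 z hzN)).continuousAt.preimage_mem_nhds
        (φ.open_source.mem_nhds hγz)))
  refine ⟨N₀ ∩ (fun y => g y 0) ⁻¹' Ioo r₀ r₁, r₀, r₁, fun y => g y 0, fun y => g y 1, ⟨hzN, hr⟩,
    rfl, hg0 z hzN, hγz, ?_⟩
  have U := A.unitSpeedCurve hφ isOpen_Ioo (fun s hs => (hI hs).1) (fun s hs => (hI hs).2)
  constructor
  · exact ContinuousOn.isOpen_inter_preimage
      (fun y hy => (hcoord 0 y hy).continuousAt.continuousWithinAt) hN₀ isOpen_Ioo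
  · exact U
  · exact fun y hy => hy.2
  · exact fun y hy => hcoord 0 y hy.1
  · exact fun y hy => hcoord 1 y hy.1
  · exact fun s hs => A.smooth_coeff.contDiffAt (isOpen_Ioo.mem_nhds (hI hs).1)
  · intro y hy
    refine det_ne_zero_of_injective fun u h0 h1 => hgi y hy.1 u ?_
    rw [hfd 0 y hy.1] at h0
    rw [hfd 1 y hy.1] at h1
    ext i
    fin_cases i
    · exact h0
    · exact h1
  · intro y hy
    have hs := (hI hy.2).1
    have hsφ : γ (g y 0) ∈ φ.source := (hI hy.2).2
    rw [localExpr_eq, hXg y hy.1]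
    refine Prod.ext rfl ?_
    change chartDeriv φ (γ (g y 0)) (a (g y 0) • velocity γ (g y 0) +
      g y 1 • rot o (γ (g y 0)) (velocity γ (g y 0))) = _
    rw [map_add, map_smul, map_smul, ← rotIn_chart o hφ hsφ,
      chartDeriv_velocity hφ (A.contMDiffAt_curve hs) hsφ]

end Surface


/-! ### Geometry of rank one Lagrangian surfaces -/

section Surface

variable {S : Type*} [TopologicalSpace S] [ChartedSpace Plane S] [IsManifold (𝓡 2) ∞ S]
  [RiemannianBundle (fun p : S => TangentSpace (𝓡 2) p)]
  [IsContMDiffRiemannianBundle (𝓡 2) ∞ Plane (fun p : S => TangentSpace (𝓡 2) p)]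
  {o : SurfaceOrientation S}
  {L : Type*} [TopologicalSpace L] [ChartedSpace Plane L] [IsManifold (𝓡 2) ∞ L]
  {X : L → TangentBundle (𝓡 2) S} {φ : OpenPartialHomeomorph S Plane}
  {ψ : OpenPartialHomeomorph L Plane}

theorem exists_nullCoordinates (hX : IsSmoothImmersion X) (hrank : HasRankOne X)
    (hLag : IsLagrangian X) (hφ : φ ∈ IsManifold.maximalAtlas (𝓡 2) ∞ S)
    (hψ : ψ ∈ IsManifold.maximalAtlas (𝓡 2) ∞ L) {z : Plane} (hz : z ∈ localDomain φ ψ X) :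
    ∃ N σ v k t P, z ∈ N ∧
      NullCoordinates φ.target (metricIn φ) (rotIn o φ) (localExpr φ ψ X) N σ v k t P := by
  obtain ⟨ψ₁, s₀, s₁, t₀, t₁, γ, a, hx, A⟩ :=
    exists_affineNormalPatch o hX hrank hLag (ψ.symm z)
  obtain ⟨N, r₀, r₁, σ, τ, hzN, -, -, -, B⟩ := A.exists_affineNormalForm hφ hψ hz hx
  obtain ⟨v, P, Y⟩ := B.exists_nullCoordinates (kaehlerChart o hφ)
  exact ⟨N, σ, v, _, _, P, hzN, Y⟩

theorem isFlat (hX : IsSmoothImmersion X) (hrank : HasRankOne X) (hLag : IsLagrangian X) :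
    IsFlat o X := by
  intro φ hφ ψ hψ z hz _
  obtain ⟨N, σ, v, k, t, P, hzN, Y⟩ := exists_nullCoordinates (o := o) hX hrank hLag hφ hψ hz
  exact ⟨Y.nondegenerate (kaehlerChart o hφ) hzN, Y.flat (kaehlerChart o hφ) hzN⟩

theorem hasDivergenceFreeJH (hX : IsSmoothImmersion X) (hrank : HasRankOne X)
    (hLag : IsLagrangian X) : HasDivergenceFreeJH o X := by
  intro φ hφ ψ hψ z hz _
  obtain ⟨N, σ, v, k, t, P, hzN, Y⟩ := exists_nullCoordinates (o := o) hX hrank hLag hφ hψ hz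
  exact Y.divergence_eq_zero (kaehlerChart o hφ) hzN

theorem isHamiltonianStationary (hX : IsSmoothImmersion X) (hrank : HasRankOne X)
    (hLag : IsLagrangian X) : IsHamiltonianStationary o X := by
  intro φ hφ ψ hψ A δ Φ H
  obtain ⟨u, hu, huc, huU, hham⟩ := H.hamiltonian
  have hU : IsOpen (localDomain φ ψ X) := isOpen_localDomain hX.1.continuous
  have hδ : Ioo (-δ) δ ∈ nhds (0 : ℝ) := Ioo_mem_nhds (by linarith [H.pos]) H.pos
  refine hasDerivAt_area (kaehlerChart o hφ) hU (fun z hz => exists_nullCoordinates hX hrank hLag hφ hψ hz)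
    H.compact H.subset (fun z hz => H.smooth.contDiffAt ?_) H.initial ?_ hu huc huU hham
  · exact prod_mem_nhds hδ (hU.mem_nhds hz)
  · filter_upwards [hδ] with ε hε using H.fixed ε hε

/-- H = (0, κγ') and ∇γ' = κ jγ' have the same factor κ, while γ' and jγ' never vanish. So both
conditions say κ = 0 at the corresponding parameter. -/
theorem IsAffineNormalPatch.isMinimalOn_iff {s₀ s₁ t₀ t₁ : ℝ} {γ : ℝ → S} {a : ℝ → ℝ}
    (A : IsAffineNormalPatch o X ψ s₀ s₁ t₀ t₁ γ a) :
    IsMinimalOn o X ψ.source ↔ IsGeodesicOn γ (Ioo s₀ s₁) := by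
  have key : ∀ φ ∈ IsManifold.maximalAtlas (𝓡 2) ∞ S, ∀ ψ' ∈ IsManifold.maximalAtlas (𝓡 2) ∞ L,
      ∀ z ∈ localDomain φ ψ' X, ψ'.symm z ∈ ψ.source →
      Nondegenerate (pullbackMetric (neutralIn o φ) (localExpr φ ψ' X) z) ∧
      ψ (ψ'.symm z) 0 ∈ Ioo s₀ s₁ ∧ γ (ψ (ψ'.symm z) 0) ∈ φ.source ∧
      (meanCurvature (neutralIn o φ) (localExpr φ ψ' X) z = 0 ↔
        acceleration (metricIn φ) (fun r => φ (γ r)) (ψ (ψ'.symm z) 0) = 0) := by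
    intro φ hφ ψ' hψ' z hz hx
    obtain ⟨N, r₀, r₁, σ, τ, hzN, hσ, hI, hγ, B⟩ := A.exists_affineNormalForm hφ hψ' hz hx
    have C := kaehlerChart o hφ
    obtain ⟨v, P, Y⟩ := B.exists_nullCoordinates C
    have hs := B.maps_to z hzN
    have hH := Y.meanCurvature_eq C hzN
    have hacc := B.curve.acceleration_eq C hs
    have hunit := B.curve.unit _ hs
    have ht : deriv (fun r => φ (γ r)) (σ z) ≠ 0 := fun h0 => by simp [h0] at hunit
    have hn : rotIn o φ (φ (γ (σ z))) (deriv (fun r => φ (γ r)) (σ z)) ≠ 0 := fun h0 => by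
      have h1 := C.rot_rot _ (B.curve.mem _ hs) (deriv (fun r => φ (γ r)) (σ z))
      rw [h0, map_zero] at h1
      exact ht (neg_eq_zero.1 h1.symm)
    rw [← hσ]
    refine ⟨Y.nondegenerate C hzN, hI, hγ, ?_⟩
    rw [hacc]
    change meanCurvature (neutralOf (metricIn φ) (rotIn o φ)) _ _ = _ ↔ _
    rw [hH, smul_eq_zero, or_iff_left hn]
    simp [Prod.ext_iff, ht]
  constructor
  · intro hM φ hφ s hs hγ
    -- Any point of the patch over the parameter s would do; the midpoint of the fibre interval is
    -- one.
    let z : Plane := s • e 0 + ((t₀ + t₁) / 2) • e 1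
    have hz0 : z 0 = s := by simp [z, e]
    have hz1 : z 1 = (t₀ + t₁) / 2 := by simp [z, e]
    have hzt : z ∈ ψ.target := by
      rw [A.target_eq]
      refine ⟨by rwa [hz0], ?_⟩
      rw [hz1]
      constructor <;> linarith [A.t_lt]
    have hzd : z ∈ localDomain φ ψ X := by
      refine ⟨hzt, ?_⟩
      rw [A.eq z hzt, hz0]
      exact hγ
    have hzs := ψ.map_target hzt
    obtain ⟨-, -, -, h1⟩ := key φ hφ ψ A.chart_mem z hzd hzs
    have h2 := h1.1 (hM φ hφ ψ A.chart_mem z hzd hzs).2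
    rw [ψ.right_inv hzt, hz0] at h2
    exact h2
  · intro hG φ hφ ψ' hψ' z hz hx
    obtain ⟨h1, hI, hγ, h2⟩ := key φ hφ ψ' hψ' z hz hx
    exact ⟨h1, h2.2 (hG φ hφ _ hI hγ)⟩

/-- Minimality is a pointwise condition and the patches cover L. -/
theorem isMinimalOn_univ_iff (hX : IsSmoothImmersion X) (hrank : HasRankOne X)
    (hLag : IsLagrangian X) : IsMinimalOn o X univ ↔
      ∀ (ψ : OpenPartialHomeomorph L Plane) (s₀ s₁ t₀ t₁ : ℝ) (γ : ℝ → S) (a : ℝ → ℝ),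
        IsAffineNormalPatch o X ψ s₀ s₁ t₀ t₁ γ a → IsGeodesicOn γ (Ioo s₀ s₁) := by
  constructor
  · intro hM ψ s₀ s₁ t₀ t₁ γ a A
    exact A.isMinimalOn_iff.1 fun φ hφ ψ' hψ' z hz _ => hM φ hφ ψ' hψ' z hz (mem_univ _)
  · intro hG φ hφ ψ' hψ' z hz _
    obtain ⟨ψ, s₀, s₁, t₀, t₁, γ, a, hx, A⟩ := exists_affineNormalPatch o hX hrank hLag (ψ'.symm z)
    exact A.isMinimalOn_iff.2 (hG ψ s₀ s₁ t₀ t₁ γ a A) φ hφ ψ' hψ' z hz hx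

end Surface

end TangentSurface

theorem mainTheorem3
    {S : Type*} [TopologicalSpace S] [T2Space S] [ChartedSpace TangentSurface.Plane S]
    [IsManifold (𝓡 2) ∞ S]
    [RiemannianBundle (fun p : S => TangentSpace (𝓡 2) p)]
    [IsContMDiffRiemannianBundle (𝓡 2) ∞ TangentSurface.Plane
      (fun p : S => TangentSpace (𝓡 2) p)]
    (o : TangentSurface.SurfaceOrientation S)
    {L : Type*} [TopologicalSpace L] [T2Space L] [ChartedSpace TangentSurface.Plane L]
    [IsManifold (𝓡 2) ∞ L]
    (X : L → TangentBundle (𝓡 2) S)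
    (hX : TangentSurface.IsSmoothImmersion X)
    (hrank : TangentSurface.HasRankOne X)
    (hLag : TangentSurface.IsLagrangian X) :
    -- `L` is locally an affine normal bundle over a curve
    (∀ x : L, ∃ (ψ : OpenPartialHomeomorph L TangentSurface.Plane) (s₀ s₁ t₀ t₁ : ℝ)
      (γ : ℝ → S) (a : ℝ → ℝ),
        x ∈ ψ.source ∧ TangentSurface.IsAffineNormalPatch o X ψ s₀ s₁ t₀ t₁ γ a) ∧
    -- `L` is Hamiltonian stationary, and satisfies the corresponding Euler equation
    TangentSurface.IsHamiltonianStationary o X ∧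
    TangentSurface.HasDivergenceFreeJH o X ∧
    -- the induced metric is nondegenerate and flat
    TangentSurface.IsFlat o X ∧
    -- each patch is minimal if and only if its base curve is a geodesic
    (∀ (ψ : OpenPartialHomeomorph L TangentSurface.Plane) (s₀ s₁ t₀ t₁ : ℝ)
      (γ : ℝ → S) (a : ℝ → ℝ),
        TangentSurface.IsAffineNormalPatch o X ψ s₀ s₁ t₀ t₁ γ a →
          (TangentSurface.IsMinimalOn o X ψ.source ↔
            TangentSurface.IsGeodesicOn γ (Ioo s₀ s₁))) ∧
    -- `L` is minimal if and only if all its base curves are geodesics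
    (TangentSurface.IsMinimalOn o X univ ↔
      ∀ (ψ : OpenPartialHomeomorph L TangentSurface.Plane) (s₀ s₁ t₀ t₁ : ℝ)
        (γ : ℝ → S) (a : ℝ → ℝ),
          TangentSurface.IsAffineNormalPatch o X ψ s₀ s₁ t₀ t₁ γ a →
            TangentSurface.IsGeodesicOn γ (Ioo s₀ s₁)) :=
  ⟨TangentSurface.exists_affineNormalPatch o hX hrank hLag,
    TangentSurface.isHamiltonianStationary hX hrank hLag,
    TangentSurface.hasDivergenceFreeJH hX hrank hLag, TangentSurface.isFlat hX hrank hLag,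
    fun _ _ _ _ _ _ _ A => A.isMinimalOn_iff,
    TangentSurface.isMinimalOn_univ_iff hX hrank hLag⟩
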